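/- Let $(Z,d)$ be a nonempty bounded metric space and $\mu$ a Borel regular measure on $Z$ such that every open ball has positive finite measure and, for some constants $Q>0$ and $C_0\ge 1$, $\mu(B(\xi,\lambda r))\le C_0\lambda^Q\mu(B(\xi,r))$ for all $\xi\in Z$, $r>0$, $\lambda\ge 1$. Hyperbolic filling. For each integer $n\ge 1$ let $\{\xi_x\}_{x\in X_n}$ be a maximal set of points of $Z$ with $d(\xi_x,\xi_{x'})\ge 2^{-n-1}$ for distinct $x,x'\in X_n$, and put $B(x):=B(\xi_x,2^{-n})$. Let $X_0$ be a singleton, with $B(x):=Z$ for its element. Put $X:=\bigsqcup_{n\ge 0}X_n$ and $|x|:=n$ for $x\in X_n$. Write $x\sim x'$ if $x\ne x'$, $\big||x|-|x'|\big|\le 1$ and $B(x)\cap B(x')\ne\emptyset$. For $u:X\to\mathbb C$ let $|du|(x):=\big(\sum_{y\sim x}|u(y)-u(x)|^2\big)^{1/2}$. Triebel–Lizorkin spaces. For $f:Z\to\mathbb C$ integrable on bounded measurable sets let $Pf(x):=\frac1{\mu(B(x))}\int_{B(x)}f\,d\mu$. For $s>0$, $Q/(Q+s)<p<\infty$ and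 $Q/(Q+s)<q\le\infty$ let $$\|f\|_{\dot F^s_{p,q}(Z)}:=\Big(\int_Z\Big(\sum_{x\in X:\ \xi\in B(x)}\big[2^{|x|s}|d(Pf)|(x)\big]^q\Big)^{p/q}d\mu(\xi)\Big)^{1/p},$$ with the sum replaced by a supremum in the usual way when $q=\infty$, and let $\dot F^s_{p,q}(Z)$ be the space of all such $f$ with $\|f\|_{\dot F^s_{p,q}(Z)}<\infty$. Discrete approximations. Fix non-negative Lipschitz functions $(\psi_x)_{x\in X}$ on $Z$ such that $\psi_x$ vanishes outside $B(x)$, $\sum_{x\in X_n}\psi_x\equiv 1$ for every $n\ge 0$, and for some constant $L$ each $\psi_x$ is $L2^{|x|}$-Lipschitz. For $u:X\to\mathbb C$ and $n\ge 0$ let $T_nu:=\sum_{x\in X_n}u(x)\psi_x$. (i) Suppose that $0<s<1$, $Q/(Q+s)<p<\infty$ and $Q/(Q+s)<q\le\infty$, or that $s=1$, $Q/(Q+1)<p<\infty$ and $q=\infty$. Then there is a finite constant $C$ such that for all $f\in\dot F^s_{p,q}(Z)$ and all integers $n\ge 0$ one has $T_n(Pf)\in\dot F^s_{p,q}(Z)$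 and $$\|T_n(Pf)\|_{\dot F^s_{p,q}(Z)}\le C\,\|f\|_{\dot F^s_{p,q}(Z)}.$$ (ii) Suppose that $0<s<1$, $Q/(Q+s)<p<\infty$ and $Q/(Q+s)<q<\infty$, and let $f\in\dot F^s_{p,q}(Z)$. Then $T_n(Pf)\in\dot F^s_{p,q}(Z)$ for all $n$, and $\|T_n(Pf)-f\|_{\dot F^s_{p,q}(Z)}\to 0$ as $n\to\infty$. -/

import Mathlib

open MeasureTheory Filter Topology
open scoped ENNReal NNReal

noncomputable section

/-- Standing assumptions on the measure: every open ball has positive finite measure, and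
`μ (B(ξ, λ r)) ≤ C λ ^ Q μ (B(ξ, r))` for all `ξ`, `r > 0`, `λ ≥ 1`, with constants
`Q > 0`, `C ≥ 1`.  (The case `λ = 2` is the doubling property.) -/
structure IsDoublingOfDimension {Z : Type*} [MetricSpace Z] [MeasurableSpace Z]
    (μ : Measure Z) (Q : ℝ) : Prop where
  Q_pos : 0 < Q
  ball_pos : ∀ (ξ : Z) (r : ℝ), 0 < r → 0 < μ (Metric.ball ξ r)
  ball_lt_top : ∀ (ξ : Z) (r : ℝ), 0 < r → μ (Metric.ball ξ r) < ∞
  doubling : ∃ C : ℝ, 1 ≤ C ∧ ∀ (ξ : Z) (r l : ℝ), 0 < r → 1 ≤ l →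
    μ (Metric.ball ξ (l * r)) ≤ ENNReal.ofReal (C * l ^ Q) * μ (Metric.ball ξ r)

/-- The choice of points that determines a hyperbolic filling of a bounded metric space `Z`:
for `n ≥ 1`, `net n` is a maximal set of points with mutual distances at least `2 ^ (-n-1)`;
`net 0` is a singleton, whose only element serves as the index of the root vertex. -/
structure HyperbolicFilling (Z : Type*) [MetricSpace Z] where
  net : ℕ → Set Z
  net_zero : ∃ z, net 0 = {z}
  net_maximal : ∀ n : ℕ, 1 ≤ n →
    Maximal (fun S : Set Z => S.Pairwise fun a b => (1 / 2 : ℝ) ^ (n + 1) ≤ dist a b) (net n)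

namespace HyperbolicFilling

variable {Z : Type*} [MetricSpace Z]

/-- The vertex set `X`, the disjoint union of the levels `X_n`. -/
abbrev Vertex (X : HyperbolicFilling Z) : Type _ := Σ n : ℕ, X.net n

/-- The level `|x|` of a vertex. -/
abbrev level (X : HyperbolicFilling Z) (x : X.Vertex) : ℕ := x.1

/-- `B(x) = B(ξ_x, 2 ^ (-n))` for `|x| = n ≥ 1`, and `B(x) = Z` for the root `x`. -/
def ball (X : HyperbolicFilling Z) (x : X.Vertex) : Set Z :=
  if X.level x = 0 then Set.univ else Metric.ball (x.2 : Z) ((1 / 2 : ℝ) ^ X.level x)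

/-- Two distinct vertices are joined by an edge iff their levels differ by at most one
and their balls intersect. -/
def graph (X : HyperbolicFilling Z) : SimpleGraph X.Vertex where
  Adj x y := x ≠ y ∧ (X.level x ≤ X.level y + 1 ∧ X.level y ≤ X.level x + 1) ∧
    (X.ball x ∩ X.ball y).Nonempty
  symm := ⟨fun _ _ h => ⟨h.1.symm, h.2.1.symm, by rw [Set.inter_comm]; exact h.2.2⟩⟩
  loopless := ⟨fun _ h => h.1 rfl⟩

/-- The cone `Γ_ξ` (of width one) at `ξ`. -/
def cone (X : HyperbolicFilling Z) (ξ : Z) : Set X.Vertex := {x | ξ ∈ X.ball x}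

/-- The pointwise norm `|du|(x) = (∑_{y ∼ x} |u y - u x| ^ 2) ^ (1 / 2)` of the discrete
derivative. -/
def normD (X : HyperbolicFilling Z) (u : X.Vertex → ℂ) (x : X.Vertex) : ℝ≥0∞ :=
  (∑' y : X.graph.neighborSet x, ‖u y - u x‖ₑ ^ (2 : ℝ)) ^ (1 / 2 : ℝ)

/-- The `ℓ^q` quasi-norm, `0 < q ≤ ∞`, of a family of elements of `[0, ∞]`. -/
def lqNorm {ι : Type*} (q : ℝ≥0∞) (a : ι → ℝ≥0∞) : ℝ≥0∞ :=
  if q = ∞ then ⨆ i, a i else (∑' i, a i ^ q.toReal) ^ (1 / q.toReal)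

/-- A family `(ψ_x)` of nonnegative Lipschitz functions on `Z` with `ψ_x` supported on `B(x)`,
which is a partition of unity on every level, with Lipschitz constants `≲ 2 ^ |x|`. -/
structure LipschitzPartition (X : HyperbolicFilling Z) where
  toFun : X.Vertex → Z → ℝ
  nonneg : ∀ x ξ, 0 ≤ toFun x ξ
  support_subset : ∀ x, Function.support (toFun x) ⊆ X.ball x
  hasSum_one : ∀ (n : ℕ) (ξ : Z), HasSum (fun x : X.net n => toFun ⟨n, x⟩ ξ) 1
  lipschitz : ∃ L : ℝ≥0, ∀ x, LipschitzWith (L * 2 ^ X.level x) (toFun x)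

/-- `T_n u = ∑_{x ∈ X_n} u(x) ψ_x`. -/
def LipschitzPartition.T {X : HyperbolicFilling Z} (ψ : X.LipschitzPartition) (n : ℕ)
    (u : X.Vertex → ℂ) (ξ : Z) : ℂ :=
  ∑' x : X.net n, u ⟨n, x⟩ * (ψ.toFun ⟨n, x⟩ ξ : ℂ)

variable [MeasurableSpace Z]

/-- The quasi-norm of the sequence space `J^s_{p,q}(X)`, as a function of the moduli
`a x = |u x|`, with values in `[0, ∞]`. -/
def jNorm (X : HyperbolicFilling Z) (μ : Measure Z) (s p : ℝ) (q : ℝ≥0∞)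
    (a : X.Vertex → ℝ≥0∞) : ℝ≥0∞ :=
  (∫⁻ ξ, lqNorm q (fun x : X.cone ξ => (2 : ℝ≥0∞) ^ ((X.level x : ℝ) * s) * a x) ^ p ∂μ)
    ^ (1 / p)

/-- The Poisson extension `Pf(x)`, the average of `f` over `B(x)`. -/
def poisson (X : HyperbolicFilling Z) (μ : Measure Z) (f : Z → ℂ) (x : X.Vertex) : ℂ :=
  ⨍ ξ in X.ball x, f ξ ∂μ

/-- The quasi-norm `‖f‖ = ‖d(Pf)‖_{J^s_{p,q}(X)}` of the Triebel-Lizorkin space. -/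
def fNorm (X : HyperbolicFilling Z) (μ : Measure Z) (s p : ℝ) (q : ℝ≥0∞)
    (f : Z → ℂ) : ℝ≥0∞ :=
  X.jNorm μ s p q (X.normD (X.poisson μ f))

/-- Membership in the Triebel-Lizorkin space: `f` is integrable on bounded measurable sets
and its quasi-norm is finite. -/
def MemF (X : HyperbolicFilling Z) (μ : Measure Z) (s p : ℝ) (q : ℝ≥0∞)
    (f : Z → ℂ) : Prop :=
  (∀ A : Set Z, Bornology.IsBounded A → MeasurableSet A → IntegrableOn f A μ) ∧
    X.fNorm μ s p q f < ∞

end HyperbolicFilling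

end

/-! ### Volumes, packing and overlap of the balls of the filling -/

noncomputable section

/-! Write u = Pf and let g = T_n u - f be the error. Everything follows from
`exists_fNorm_T_poisson_sub_le`: the quasi-norm of g is at most a constant, independent of n, times
the sequence quasi-norm of |du| cut off to the levels from n on. Cutting off only decreases a
quasi-norm, so (i) follows by the quasi-triangle inequality; for finite q the cut-off part tends to
zero by dominated convergence, which is (ii).

The error is estimated vertex by vertex, according to the level of x. If |x| ≥ n + c, then B(x) and
its neighbours lie in one ball of level n, on which T_n u has Lipschitz constant at most about 2^n
|du|. Hence |dP(T_n u)|(x) is at most about 2^(-(|x|-n)) times |du| on level n, while |d(Pf)|(x)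
itself belongs to the tail. With the weight 2^(|x|s) this gives a geometric sequence of ratio
2^(s-1), summable in every ℓ^q for s < 1 but only bounded for s = 1; this is why q = ∞ there. If |x|
≤ n + c, no cancellation is needed. Since T_k u tends to f in L^1, telescoping dominates |g| by the
level sums of |du| over k ≥ n. A function made of constants on balls of radius about 2^(-k) has its
mean at the coarser scale 2^(-|x|) bounded by its r-mean, r ≤ 1, at the cost of 2^((k-|x|)Q(1/r-1)).
Against the weights there remains a decay of ratio 2^(-(s-Q(1/r-1))), which is less than 1 exactly
when r > Q/(Q+s). The hypotheses on p and q leave room for such an r below p and q.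

The r-means are then summed in L^(p/r)(ℓ^(q/r)), where both exponents exceed 1, by an inequality of
Fefferman-Stein type (`IsAveragingFamily.fefferman_stein`; for q = ∞ the scalar maximal theorem is
enough). It is deduced from the scalar maximal theorem for symmetric positive kernels: by
self-adjointness if p ≥ q, and by a weighted Hölder inequality if p < q. -/

theorem IsDoublingOfDimension.exists_measure_closedBall_le {Z : Type*} [MetricSpace Z]
    [MeasurableSpace Z] {μ : Measure Z} {Q : ℝ} (hμ : IsDoublingOfDimension μ Q) :
    ∃ C : ℝ, 1 ≤ C ∧ ∀ (x y : Z) (a r l : ℝ), 0 < r → 1 ≤ l → dist x y + a < l * r →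
      μ (Metric.closedBall x a) ≤ ENNReal.ofReal (C * l ^ Q) * μ (Metric.ball y r) := by
  obtain ⟨C, hC, h⟩ := hμ.doubling
  refine ⟨C, hC, fun x y a r l hr hl hd => (measure_mono ?_).trans (h y r l hr hl)⟩
  exact Metric.closedBall_subset_ball' (by linarith)

/-- The form in which bounded overlap and bounded degree are used throughout. -/
theorem ENNReal.tsum_le_mul_of_encard_le {ι : Type*} {S : Set ι} {N : ℕ} (hS : S.encard ≤ N)
    {a : ι → ℝ≥0∞} {A : ℝ≥0∞} (h0 : ∀ i, i ∉ S → a i = 0) (hA : ∀ i ∈ S, a i ≤ A) :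
    ∑' i, a i ≤ N * A := by
  have hfin : S.Finite := Set.finite_of_encard_le_coe hS
  rw [tsum_eq_sum (s := hfin.toFinset) (fun i hi => h0 i (by simpa using hi))]
  have hcard : hfin.toFinset.card ≤ N := by
    rw [hfin.encard_eq_coe_toFinset_card] at hS
    exact_mod_cast hS
  calc ∑ i ∈ hfin.toFinset, a i ≤ hfin.toFinset.card • A :=
        Finset.sum_le_card_nsmul _ _ _ (fun i hi => hA i (by simpa using hi))
    _ ≤ N * A := by rw [nsmul_eq_mul]; gcongr

namespace HyperbolicFilling

variable {Z : Type*} [MetricSpace Z]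

/-- The closed ball of radius `R 2 ^ (-|x|)` around the centre of `B(x)`. -/
def bigBall (X : HyperbolicFilling Z) (R : ℝ) (x : X.Vertex) : Set Z :=
  Metric.closedBall (x.2 : Z) (R * (1 / 2 : ℝ) ^ x.1)

theorem nonempty (X : HyperbolicFilling Z) : Nonempty Z :=
  let ⟨z, _⟩ := X.net_zero; ⟨z⟩

theorem net_pairwise (X : HyperbolicFilling Z) (m : ℕ) :
    (X.net m).Pairwise fun a b => (1 / 2 : ℝ) ^ (m + 1) ≤ dist a b := by
  rcases Nat.eq_zero_or_pos m with rfl | hm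
  · obtain ⟨z, hz⟩ := X.net_zero
    rw [hz]
    exact Set.pairwise_singleton _ _
  · exact (X.net_maximal m hm).prop

/-- By maximality, a point far from the whole net could be added to it. The distance is half the
radius of the balls of level m; the spare half is used in `exists_bigBall_subset_ball`. -/
theorem exists_dist_lt (X : HyperbolicFilling Z) {m : ℕ} (hm : 1 ≤ m) (ξ : Z) :
    ∃ x : X.net m, dist ξ (x : Z) < (1 / 2 : ℝ) ^ (m + 1) := by
  by_contra! hcon
  have hmax := X.net_maximal m hm
  have hins : (insert ξ (X.net m)).Pairwise fun a b => (1 / 2 : ℝ) ^ (m + 1) ≤ dist a b := by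
    refine hmax.prop.insert fun b hb _ => ?_
    have := hcon ⟨b, hb⟩
    exact ⟨this, by rwa [dist_comm]⟩
  have hmem : ξ ∈ X.net m := hmax.le_of_ge hins (Set.subset_insert _ _) (Set.mem_insert _ _)
  have := hcon ⟨ξ, hmem⟩
  rw [dist_self] at this
  exact absurd this (not_le.2 (by positivity))

theorem ball_zero (X : HyperbolicFilling Z) (x : X.net 0) : X.ball ⟨0, x⟩ = Set.univ := by
  simp [ball]

theorem ball_of_pos (X : HyperbolicFilling Z) (x : X.Vertex) (h : 1 ≤ x.1) :
    X.ball x = Metric.ball (x.2 : Z) ((1 / 2 : ℝ) ^ x.1) := by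
  rw [ball, if_neg (by simp only [level]; omega)]

theorem measurableSet_ball [MeasurableSpace Z] [BorelSpace Z] (X : HyperbolicFilling Z)
    (x : X.Vertex) : MeasurableSet (X.ball x) := by
  unfold ball
  split_ifs
  · exact MeasurableSet.univ
  · exact Metric.isOpen_ball.measurableSet

theorem measurableSet_bigBall [MeasurableSpace Z] [BorelSpace Z] (X : HyperbolicFilling Z) (R : ℝ)
    (x : X.Vertex) : MeasurableSet (X.bigBall R x) :=
  Metric.isClosed_closedBall.measurableSet

theorem metricBall_subset_ball (X : HyperbolicFilling Z) (x : X.Vertex) :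
    Metric.ball (x.2 : Z) ((1 / 2 : ℝ) ^ x.1) ⊆ X.ball x := by
  unfold ball
  split_ifs
  · exact Set.subset_univ _
  · exact subset_rfl

theorem center_mem_ball (X : HyperbolicFilling Z) (x : X.Vertex) : (x.2 : Z) ∈ X.ball x :=
  X.metricBall_subset_ball x (Metric.mem_ball_self (by positivity))

/-- The root carries all of Z rather than a ball of radius 1, so the dilation factor has to absorb
the diameter. -/
theorem ball_subset_bigBall [BoundedSpace Z] (X : HyperbolicFilling Z) {R : ℝ}
    (hR : Metric.diam (Set.univ : Set Z) + 1 ≤ R) (x : X.Vertex) : X.ball x ⊆ X.bigBall R x := by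
  have h1 : (1 : ℝ) ≤ R := le_trans (by linarith [Metric.diam_nonneg (s := (Set.univ : Set Z))]) hR
  unfold ball bigBall
  split_ifs with h
  · intro ξ _
    have h' : x.1 = 0 := h
    have hp : (1 / 2 : ℝ) ^ x.1 = 1 := by simp only [h', pow_zero]
    rw [Metric.mem_closedBall, hp, mul_one]
    have := Metric.dist_le_diam_of_mem (Bornology.isBounded_univ.2 ‹BoundedSpace Z›)
      (Set.mem_univ ξ) (Set.mem_univ (x.2 : Z))
    linarith
  · refine Metric.ball_subset_closedBall.trans (Metric.closedBall_subset_closedBall ?_)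
    exact le_mul_of_one_le_left (by positivity) h1

theorem exists_mem_ball (X : HyperbolicFilling Z) (m : ℕ) (ξ : Z) :
    ∃ x : X.net m, ξ ∈ X.ball ⟨m, x⟩ := by
  rcases Nat.eq_zero_or_pos m with rfl | hm
  · obtain ⟨z, hz⟩ := X.net_zero
    exact ⟨⟨z, by rw [hz]; rfl⟩, by rw [ball_zero]; trivial⟩
  · obtain ⟨x, hx⟩ := X.exists_dist_lt hm ξ
    refine ⟨x, X.metricBall_subset_ball _ (Metric.mem_ball.2 (hx.trans ?_))⟩
    rw [pow_succ]
    have : (0 : ℝ) < (1 / 2) ^ m := by positivity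
    linarith

/-- The radius of y is at most twice that of x. Two radii of y and one of x lead from a point of
B(y) to the centre of x, whence 5 = 2 + 2 + 1. -/
theorem ball_subset_bigBall_of_adj [BoundedSpace Z] (X : HyperbolicFilling Z) {R : ℝ}
    (hR : 5 * (Metric.diam (Set.univ : Set Z) + 1) ≤ R) {x y : X.Vertex} (h : X.graph.Adj x y) :
    X.ball y ⊆ X.bigBall R x := by
  obtain ⟨_, ⟨_, h2⟩, ζ, hζx, hζy⟩ := h
  set D := Metric.diam (Set.univ : Set Z) + 1 with hD
  have hD0 : 0 < D := by linarith [Metric.diam_nonneg (s := (Set.univ : Set Z))]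
  have h2' : x.1 ≤ y.1 + 1 := by assumption
  intro η hη
  have e1 := X.ball_subset_bigBall le_rfl _ hζx
  have e2 := X.ball_subset_bigBall le_rfl _ hζy
  have e3 := X.ball_subset_bigBall le_rfl _ hη
  simp only [bigBall, Metric.mem_closedBall] at e1 e2 e3 ⊢
  have hp : (1 / 2 : ℝ) ^ y.1 ≤ 2 * (1 / 2) ^ x.1 := by
    have : (1 / 2 : ℝ) ^ (y.1 + 1) ≤ (1 / 2) ^ x.1 :=
      pow_le_pow_of_le_one (by norm_num) (by norm_num) h2'
    rw [pow_succ] at this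
    linarith
  have t1 : dist η (x.2 : Z) ≤ dist η (y.2 : Z) + dist ζ (y.2 : Z) + dist ζ (x.2 : Z) := by
    have := dist_triangle4 η (y.2 : Z) ζ (x.2 : Z)
    rwa [dist_comm (y.2 : Z) ζ] at this
  have hpx : (0 : ℝ) < (1 / 2) ^ x.1 := by positivity
  calc dist η (x.2 : Z) ≤ D * (1 / 2) ^ y.1 + D * (1 / 2) ^ y.1 + D * (1 / 2) ^ x.1 := by linarith
    _ ≤ D * (2 * (1 / 2) ^ x.1) + D * (2 * (1 / 2) ^ x.1) + D * (1 / 2) ^ x.1 := by gcongr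
    _ = 5 * D * (1 / 2) ^ x.1 := by ring
    _ ≤ R * (1 / 2) ^ x.1 := by gcongr

variable [MeasurableSpace Z] {μ : Measure Z} {Q : ℝ}

theorem isFiniteMeasure [BoundedSpace Z] (X : HyperbolicFilling Z)
    (hμ : IsDoublingOfDimension μ Q) : IsFiniteMeasure μ := by
  obtain ⟨z⟩ := X.nonempty
  refine ⟨lt_of_le_of_lt (measure_mono ?_)
    (hμ.ball_lt_top z (Metric.diam (Set.univ : Set Z) + 1)
      (by linarith [Metric.diam_nonneg (s := (Set.univ : Set Z))]))⟩
  intro ξ _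
  have := Metric.dist_le_diam_of_mem (Bornology.isBounded_univ.2 ‹BoundedSpace Z›)
      (Set.mem_univ ξ) (Set.mem_univ z)
  rw [Metric.mem_ball]
  linarith

theorem measure_ball_pos (X : HyperbolicFilling Z) (hμ : IsDoublingOfDimension μ Q)
    (x : X.Vertex) : 0 < μ (X.ball x) :=
  (hμ.ball_pos (x.2 : Z) ((1 / 2 : ℝ) ^ x.1) (by positivity)).trans_le
    (measure_mono (X.metricBall_subset_ball x))

/-- The volumes of a ball of the filling and of the dilate of a ball of a possibly lower level
that contains its centre. -/
theorem exists_measure_bigBall_le [BoundedSpace Z] (X : HyperbolicFilling Z)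
    (hμ : IsDoublingOfDimension μ Q) (R : ℝ) (c : ℕ) :
    ∃ C : ℝ≥0∞, C ≠ ∞ ∧ ∀ x z : X.Vertex, x.1 ≤ z.1 + c → (z.2 : Z) ∈ X.bigBall R x →
      μ (X.bigBall R x) ≤ C * ENNReal.ofReal (2 ^ (((z.1 : ℝ) - x.1) * Q)) * μ (X.ball z) := by
  obtain ⟨C, hC, hvol⟩ := hμ.exists_measure_closedBall_le
  -- Up to the factor 2^(|z|-|x|), this is the ratio of radii that doubling is applied with. The
  -- power 2^c keeps the ratio at least 1 when z lies up to c levels below x; 2 max(R, 0) + 1 covers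
  -- the offset of the centres and the radius.
  set b : ℝ := 2 ^ c * (2 * max R 0 + 1) with hb
  have hm0 : 0 ≤ max R 0 := le_max_right _ _
  have hb0 : 0 < b := by positivity
  refine ⟨ENNReal.ofReal (C * b ^ Q), ENNReal.ofReal_ne_top, fun x z hxz hz => ?_⟩
  have hl1 : (2 : ℝ) ^ ((z.1 : ℝ) - x.1) * (1 / 2) ^ z.1 = (1 / 2) ^ x.1 := by
    rw [Real.rpow_sub (by norm_num), Real.rpow_natCast, Real.rpow_natCast, one_div, inv_pow,
      inv_pow]
    field_simp
  have hl2 : 1 ≤ (2 : ℝ) ^ c * (2 : ℝ) ^ ((z.1 : ℝ) - x.1) := by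
    rw [← Real.rpow_natCast, ← Real.rpow_add (by norm_num)]
    refine Real.one_le_rpow (by norm_num) ?_
    have : (x.1 : ℝ) ≤ z.1 + c := by exact_mod_cast hxz
    linarith
  set l : ℝ := b * 2 ^ ((z.1 : ℝ) - x.1) with hl
  have hl3 : 1 ≤ l := by
    rw [hl, hb]
    have : (1 : ℝ) * 1 ≤ ((2 : ℝ) ^ c * (2 : ℝ) ^ ((z.1 : ℝ) - x.1)) * (2 * max R 0 + 1) := by
      gcongr; linarith
    linarith
  have hzd : dist (x.2 : Z) (z.2 : Z) ≤ R * (1 / 2) ^ x.1 := by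
    rw [dist_comm]; exact hz
  have hpx : (0 : ℝ) < (1 / 2) ^ x.1 := by positivity
  have hkey := hvol (x.2 : Z) (z.2 : Z) (R * (1 / 2) ^ x.1) ((1 / 2) ^ z.1) l (by positivity) hl3
    (by
      rw [hl, mul_assoc, hl1, hb]
      have h2c : (1 : ℝ) ≤ 2 ^ c := one_le_pow₀ (by norm_num)
      have hR : R * (1 / 2) ^ x.1 ≤ max R 0 * (1 / 2) ^ x.1 := by gcongr; exact le_max_left _ _
      have : 1 * ((2 * max R 0 + 1) * (1 / 2 : ℝ) ^ x.1) ≤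
          2 ^ c * ((2 * max R 0 + 1) * (1 / 2 : ℝ) ^ x.1) := by gcongr
      nlinarith)
  refine hkey.trans ?_
  rw [← ENNReal.ofReal_mul (by positivity)]
  refine mul_le_mul' (ENNReal.ofReal_le_ofReal (le_of_eq ?_)) (measure_mono ?_)
  · rw [hl, Real.mul_rpow hb0.le (by positivity), ← Real.rpow_mul (by norm_num)]
    exact (mul_assoc _ _ _).symm
  · exact X.metricBall_subset_ball z

variable [BorelSpace Z]

/-- Packing: the balls of radius 2^(-m-2) about net points are disjoint, those near ξ lie in one
ball of radius about 2^(-m), and by doubling each takes up a fixed fraction of its volume. -/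
theorem exists_encard_near_le (X : HyperbolicFilling Z) (hμ : IsDoublingOfDimension μ Q) (ρ : ℝ) :
    ∃ N : ℕ, ∀ (m : ℕ) (ξ : Z),
      {x : X.net m | dist ξ (x : Z) ≤ ρ * (1 / 2 : ℝ) ^ m}.encard ≤ N := by
  obtain ⟨C, hC, hvol⟩ := hμ.exists_measure_closedBall_le
  set ρ' := max ρ 0 with hρ'
  -- In units of 2^(-m), the small ball enlarged by l has radius 2ρ' + 2, just more than the
  -- distance ρ' plus the radius ρ' + 1.
  set l : ℝ := 8 * (ρ' + 1) with hl
  have hρ0 : 0 ≤ ρ' := le_max_right _ _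
  refine ⟨⌈C * l ^ Q⌉₊, fun m ξ => ?_⟩
  by_contra! hcon
  set N := ⌈C * l ^ Q⌉₊ with hN
  have hcon' : ((N + 1 : ℕ) : ℕ∞) ≤
      {x : X.net m | dist ξ (x : Z) ≤ ρ * (1 / 2 : ℝ) ^ m}.encard := by
    push_cast
    exact Order.add_one_le_of_lt hcon
  obtain ⟨t, hts, htc⟩ := Set.exists_subset_encard_eq hcon'
  have htf : t.Finite := Set.finite_of_encard_eq_coe htc
  have hcard : htf.toFinset.card = N + 1 := by
    rw [htf.encard_eq_coe_toFinset_card] at htc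
    exact_mod_cast htc
  have hpm : (0 : ℝ) < (1 / 2) ^ m := by positivity
  set V := μ (Metric.closedBall ξ ((ρ' + 1) * (1 / 2 : ℝ) ^ m)) with hV
  have hpow : (1 / 2 : ℝ) ^ (m + 2) = (1 / 4) * (1 / 2) ^ m := by ring
  have hpow1 : (1 / 2 : ℝ) ^ (m + 1) = (1 / 2) * (1 / 2) ^ m := by ring
  have hle : ∀ x ∈ htf.toFinset, V ≤ ENNReal.ofReal (C * l ^ Q) *
      μ (Metric.ball (x : Z) ((1 / 2 : ℝ) ^ (m + 2))) := by
    intro x hx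
    have hx' : dist ξ (x : Z) ≤ ρ * (1 / 2 : ℝ) ^ m := hts (by simpa using hx)
    refine hvol _ _ _ _ _ (by positivity) (by rw [hl]; linarith) ?_
    have : ρ * (1 / 2 : ℝ) ^ m ≤ ρ' * (1 / 2) ^ m := by gcongr; exact le_max_left _ _
    rw [hpow, hl]
    nlinarith
  have hdisj : (htf.toFinset : Set (X.net m)).PairwiseDisjoint
      fun x => Metric.ball (x : Z) ((1 / 2 : ℝ) ^ (m + 2)) := by
    intro x _ y _ hxy
    refine Metric.ball_disjoint_ball ?_
    have := X.net_pairwise m x.2 y.2 (fun h => hxy (Subtype.ext h))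
    rw [hpow1] at this
    rw [hpow]
    linarith
  have hsum : ∑ x ∈ htf.toFinset, μ (Metric.ball (x : Z) ((1 / 2 : ℝ) ^ (m + 2))) ≤ V := by
    rw [← measure_biUnion_finset hdisj fun x _ => Metric.isOpen_ball.measurableSet]
    refine measure_mono (Set.iUnion₂_subset fun x hx => ?_)
    have hx' : dist ξ (x : Z) ≤ ρ * (1 / 2 : ℝ) ^ m := hts (by simpa using hx)
    have : ρ * (1 / 2 : ℝ) ^ m ≤ ρ' * (1 / 2) ^ m := by gcongr; exact le_max_left _ _
    refine Metric.ball_subset_closedBall.trans (Metric.closedBall_subset_closedBall' ?_)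
    rw [dist_comm, hpow]
    linarith
  have hV0 : V ≠ 0 := by
    refine ((hμ.ball_pos ξ ((ρ' + 1) * (1 / 2 : ℝ) ^ m) (by positivity)).trans_le
      (measure_mono Metric.ball_subset_closedBall)).ne'
  have hVt : V ≠ ∞ := by
    refine ((measure_mono (Metric.closedBall_subset_ball ?_)).trans_lt
      (hμ.ball_lt_top ξ ((ρ' + 2) * (1 / 2 : ℝ) ^ m) (by positivity))).ne
    linarith
  have h1 : ((N + 1 : ℕ) : ℝ≥0∞) * V ≤ N * V := by
    calc ((N + 1 : ℕ) : ℝ≥0∞) * V = ∑ _x ∈ htf.toFinset, V := by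
          rw [Finset.sum_const, hcard, nsmul_eq_mul]
      _ ≤ ∑ x ∈ htf.toFinset, ENNReal.ofReal (C * l ^ Q) *
          μ (Metric.ball (x : Z) ((1 / 2 : ℝ) ^ (m + 2))) := Finset.sum_le_sum hle
      _ ≤ ENNReal.ofReal (C * l ^ Q) * V := by rw [← Finset.mul_sum]; gcongr
      _ ≤ N * V := by
          gcongr
          rw [← ENNReal.ofReal_natCast]
          exact ENNReal.ofReal_le_ofReal (Nat.le_ceil _)
  rw [ENNReal.mul_le_mul_iff_left hV0 hVt] at h1
  norm_cast at h1
  omega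

theorem finite_net [BoundedSpace Z] (X : HyperbolicFilling Z) (hμ : IsDoublingOfDimension μ Q)
    (m : ℕ) : Finite (X.net m) := by
  obtain ⟨z⟩ := X.nonempty
  obtain ⟨N, hN⟩ := X.exists_encard_near_le hμ (Metric.diam (Set.univ : Set Z) * 2 ^ m)
  have huniv : {x : X.net m | dist z (x : Z) ≤
      Metric.diam (Set.univ : Set Z) * 2 ^ m * (1 / 2 : ℝ) ^ m} = Set.univ := by
    refine Set.eq_univ_of_forall fun x => ?_
    have := Metric.dist_le_diam_of_mem (Bornology.isBounded_univ.2 ‹BoundedSpace Z›)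
      (Set.mem_univ z) (Set.mem_univ (x : Z))
    have h2 : (2 : ℝ) ^ m * (1 / 2) ^ m = 1 := by rw [← mul_pow]; norm_num
    show dist z (x : Z) ≤ _
    rwa [mul_assoc, h2, mul_one]
  have := hN m z
  rw [huniv] at this
  exact Set.finite_univ_iff.1 (Set.finite_of_encard_le_coe this)

theorem exists_encard_bigBall_le (X : HyperbolicFilling Z) (hμ : IsDoublingOfDimension μ Q)
    (R : ℝ) : ∃ N : ℕ, ∀ (m : ℕ) (ξ : Z), {x : X.net m | ξ ∈ X.bigBall R ⟨m, x⟩}.encard ≤ N :=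
  X.exists_encard_near_le hμ R

theorem exists_encard_cone_le [BoundedSpace Z] (X : HyperbolicFilling Z)
    (hμ : IsDoublingOfDimension μ Q) :
    ∃ N : ℕ, ∀ (m : ℕ) (ξ : Z), {x : X.net m | ξ ∈ X.ball ⟨m, x⟩}.encard ≤ N := by
  obtain ⟨N, hN⟩ := X.exists_encard_bigBall_le hμ (Metric.diam (Set.univ : Set Z) + 1)
  exact ⟨N, fun m ξ => (Set.encard_le_encard (fun x hx =>
    X.ball_subset_bigBall le_rfl ⟨m, x⟩ hx)).trans (hN m ξ)⟩

theorem exists_encard_neighborSet_le [BoundedSpace Z] (X : HyperbolicFilling Z)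
    (hμ : IsDoublingOfDimension μ Q) :
    ∃ N : ℕ, ∀ x : X.Vertex, (X.graph.neighborSet x).encard ≤ N := by
  set R := 5 * (Metric.diam (Set.univ : Set Z) + 1) with hR
  have hR0 : 0 < R := by linarith [Metric.diam_nonneg (s := (Set.univ : Set Z))]
  obtain ⟨N, hN⟩ := X.exists_encard_near_le hμ (2 * R)
  refine ⟨3 * N, fun x => ?_⟩
  have hsub : X.graph.neighborSet x ⊆ ⋃ m ∈ ({x.1 - 1, x.1, x.1 + 1} : Finset ℕ),
      (fun y : X.net m => (⟨m, y⟩ : X.Vertex)) '' {y : X.net m | dist (x.2 : Z) (y : Z) ≤ 2 * R * (1 / 2 : ℝ) ^ m} := by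
    intro y hy
    have hy' : X.graph.Adj x y := hy
    obtain ⟨_, ⟨h1, h2⟩, _⟩ := id hy'
    have h1' : x.1 ≤ y.1 + 1 := by assumption
    have h2' : y.1 ≤ x.1 + 1 := by assumption
    have hm := X.ball_subset_bigBall_of_adj le_rfl hy' (X.center_mem_ball y)
    simp only [Set.mem_iUnion]
    refine ⟨y.1, ?_, ⟨y.2, ?_, rfl⟩⟩
    · simp only [Finset.mem_insert, Finset.mem_singleton]; omega
    · have hm' : dist (y.2 : Z) (x.2 : Z) ≤ R * (1 / 2) ^ x.1 := hm
      show dist (x.2 : Z) (y.2 : Z) ≤ _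
      have : (1 / 2 : ℝ) ^ (x.1 + 1) ≤ (1 / 2) ^ y.1 :=
        pow_le_pow_of_le_one (by norm_num) (by norm_num) h2'
      rw [pow_succ] at this
      rw [dist_comm]
      nlinarith
  refine (Set.encard_le_encard hsub).trans ?_
  rw [Finset.set_biUnion_insert, Finset.set_biUnion_insert, Finset.set_biUnion_singleton]
  have himg : ∀ m : ℕ, ((fun y : X.net m => (⟨m, y⟩ : X.Vertex)) ''
      {y : X.net m | dist (x.2 : Z) (y : Z) ≤ 2 * R * (1 / 2 : ℝ) ^ m}).encard ≤ N :=
    fun m => (Set.encard_image_le _ _).trans (hN m _)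
  calc _ ≤ (N : ℕ∞) + (N + N) := (Set.encard_union_le _ _).trans
        (add_le_add (himg _) ((Set.encard_union_le _ _).trans (add_le_add (himg _) (himg _))))
    _ = _ := by push_cast; ring

end HyperbolicFilling

/-! ### The maximal theorem for a countable family of balls -/

/-- The averages of `h` over the closed balls of a family containing a given point, and their
supremum: the maximal function of `h` relative to the family. -/
def ballMaximal {Z ι : Type*} [MetricSpace Z] [MeasurableSpace Z] (μ : Measure Z)
    (c : ι → Z) (ρ : ι → ℝ) (h : Z → ℝ≥0∞) (ξ : Z) : ℝ≥0∞ :=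
  ⨆ i, (Metric.closedBall (c i) (ρ i)).indicator
    (fun _ => (μ (Metric.closedBall (c i) (ρ i)))⁻¹ *
      ∫⁻ η in Metric.closedBall (c i) (ρ i), h η ∂μ) ξ

section maximal

variable {Z ι : Type*} [MetricSpace Z] [MeasurableSpace Z] [BorelSpace Z] [Countable ι]
  {μ : Measure Z} {c : ι → Z} {ρ : ι → ℝ}

theorem measurable_ballMaximal (h : Z → ℝ≥0∞) : Measurable (ballMaximal μ c ρ h) :=
  Measurable.iSup fun _ => measurable_const.indicator Metric.isClosed_closedBall.measurableSet

/-- Vitali's covering lemma, applied to the balls on which the average exceeds t: a disjoint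
subfamily has 5-fold enlargements covering the superlevel set, and disjointness lets the integrals
over its members add up to at most the whole. -/
theorem ballMaximal_weak_type {R : ℝ} (hρ : ∀ i, ρ i ≤ R) {A : ℝ≥0∞}
    (hA : ∀ i, μ (Metric.closedBall (c i) (5 * ρ i)) ≤ A * μ (Metric.closedBall (c i) (ρ i)))
    (h : Z → ℝ≥0∞) (t : ℝ≥0∞) :
    t * μ {ξ | t < ballMaximal μ c ρ h ξ} ≤ A * ∫⁻ ξ, h ξ ∂μ := by
  set S : ι → Set Z := fun i => Metric.closedBall (c i) (ρ i) with hS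
  set T : Set ι := {i | t < (μ (S i))⁻¹ * ∫⁻ η in S i, h η ∂μ} with hT
  obtain ⟨u, huT, hdisj, hcov⟩ :=
    Vitali.exists_disjoint_subfamily_covering_enlargement_closedBall T c ρ R (fun i _ => hρ i)
      5 (by norm_num)
  have hsub : {ξ | t < ballMaximal μ c ρ h ξ} ⊆
      ⋃ i ∈ u, Metric.closedBall (c i) (5 * ρ i) := by
    intro ξ hξ
    obtain ⟨i, hi⟩ := lt_iSup_iff.1 (show t < ballMaximal μ c ρ h ξ from hξ)
    have hmem : ξ ∈ S i := by
      by_contra hn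
      rw [Set.indicator_of_notMem hn] at hi
      exact not_lt_bot hi
    rw [Set.indicator_of_mem hmem] at hi
    obtain ⟨b, hb, hib⟩ := hcov i hi
    exact Set.mem_biUnion hb (hib hmem)
  have hone : ∀ i ∈ u, t * μ (S i) ≤ ∫⁻ η in S i, h η ∂μ := by
    intro i hi
    calc t * μ (S i) ≤ ((μ (S i))⁻¹ * ∫⁻ η in S i, h η ∂μ) * μ (S i) := by
          gcongr; exact (huT hi).le
      _ = ((μ (S i))⁻¹ * μ (S i)) * ∫⁻ η in S i, h η ∂μ := by ring
      _ ≤ 1 * ∫⁻ η in S i, h η ∂μ := by gcongr; exact ENNReal.inv_mul_le_one _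
      _ = _ := one_mul _
  have hu : u.Countable := Set.to_countable u
  calc t * μ {ξ | t < ballMaximal μ c ρ h ξ}
      ≤ t * ∑' i : u, μ (Metric.closedBall (c i) (5 * ρ i)) := by
        gcongr
        exact (measure_mono hsub).trans (measure_biUnion_le μ hu _)
    _ ≤ t * ∑' i : u, A * μ (S i) := by
        gcongr with i
        exact hA i
    _ = A * ∑' i : u, t * μ (S i) := by
        rw [ENNReal.tsum_mul_left, ENNReal.tsum_mul_left]; ring
    _ ≤ A * ∑' i : u, ∫⁻ η in S i, h η ∂μ := by
        gcongr with i
        exact hone i i.2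
    _ = A * ∫⁻ η in ⋃ i ∈ u, S i, h η ∂μ := by
        rw [lintegral_biUnion hu (fun i _ => Metric.isClosed_closedBall.measurableSet) hdisj]
    _ ≤ A * ∫⁻ ξ, h ξ ∂μ := by
        exact mul_le_mul_right (setLIntegral_le_lintegral _ _) _

end maximal

/-- The splitting behind Marcinkiewicz interpolation: the part of h below height t contributes at
most t to every average. -/
theorem ballMaximal_le_add {Z ι : Type*} [MetricSpace Z] [MeasurableSpace Z]
    {μ : Measure Z} {c : ι → Z} {ρ : ι → ℝ} (h : Z → ℝ≥0∞) (t : ℝ≥0∞) (ξ : Z) :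
    ballMaximal μ c ρ h ξ ≤ ballMaximal μ c ρ ({η | t < h η}.indicator h) ξ + t := by
  refine iSup_le fun i => ?_
  set S := Metric.closedBall (c i) (ρ i) with hS
  by_cases hξ : ξ ∈ S
  · have h1 : (μ S)⁻¹ * ∫⁻ η in S, {η | t < h η}.indicator h η ∂μ ≤
        ballMaximal μ c ρ ({η | t < h η}.indicator h) ξ := by
      refine le_trans (le_of_eq ?_) (le_iSup _ i)
      rw [Set.indicator_of_mem hξ]
    rw [Set.indicator_of_mem hξ]
    calc (μ S)⁻¹ * ∫⁻ η in S, h η ∂μ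
        ≤ (μ S)⁻¹ * ∫⁻ η in S, ({η | t < h η}.indicator h η + t) ∂μ := by
          gcongr with η
          by_cases hη : t < h η
          · rw [Set.indicator_of_mem (show η ∈ {η | t < h η} from hη)]
            exact le_self_add
          · exact (not_lt.1 hη).trans le_add_self
      _ = (μ S)⁻¹ * ∫⁻ η in S, {η | t < h η}.indicator h η ∂μ + ((μ S)⁻¹ * μ S) * t := by
          rw [lintegral_add_right _ measurable_const, setLIntegral_const]; ring
      _ ≤ _ + 1 * t := by gcongr; exact ENNReal.inv_mul_le_one _
      _ ≤ _ := by rw [one_mul]; gcongr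
  · rw [Set.indicator_of_notMem hξ]; exact zero_le

theorem lintegral_rpow_sub_one_Ioo {t : ℝ} (ht : 0 < t) (y : ℝ≥0) :
    ∫⁻ l in Set.Ioo (0 : ℝ) y, ENNReal.ofReal (l ^ (t - 1)) = ENNReal.ofReal t⁻¹ * (y : ℝ≥0∞) ^ t := by
  have hint : IntervalIntegrable (fun l : ℝ => l ^ (t - 1)) volume 0 y :=
    intervalIntegral.intervalIntegrable_rpow' (by linarith)
  rw [setLIntegral_congr Ioo_ae_eq_Ioc, ← ofReal_integral_eq_lintegral_ofReal]
  · rw [← intervalIntegral.integral_of_le y.coe_nonneg, integral_rpow (Or.inl (by linarith)),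
      sub_add_cancel, Real.zero_rpow ht.ne', sub_zero, div_eq_inv_mul,
      ENNReal.ofReal_mul (by positivity), ← ENNReal.ofReal_rpow_of_nonneg y.coe_nonneg ht.le,
      ENNReal.ofReal_coe_nnreal]
  · exact (intervalIntegrable_iff_integrableOn_Ioc_of_le y.coe_nonneg).1 hint
  · filter_upwards [ae_restrict_mem measurableSet_Ioc] with l hl
    exact Real.rpow_nonneg hl.1.le _

/-- The layer-cake integral of a single value y. The value ∞ is reached as a limit of integer
heights. -/
theorem lintegral_layer_rpow {t : ℝ} (ht : 0 < t) (y : ℝ≥0∞) :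
    ∫⁻ l in Set.Ioi (0 : ℝ), {l : ℝ | ENNReal.ofReal l < y}.indicator
      (fun l => ENNReal.ofReal (l ^ (t - 1))) l = ENNReal.ofReal t⁻¹ * y ^ t := by
  have hmeas : ∀ y : ℝ≥0∞, MeasurableSet {l : ℝ | ENNReal.ofReal l < y} := fun y =>
    measurableSet_lt ENNReal.measurable_ofReal measurable_const
  have hfin : ∀ y : ℝ≥0, ∫⁻ l in Set.Ioi (0 : ℝ), {l : ℝ | ENNReal.ofReal l < y}.indicator
      (fun l => ENNReal.ofReal (l ^ (t - 1))) l = ENNReal.ofReal t⁻¹ * (y : ℝ≥0∞) ^ t := by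
    intro y
    rw [← lintegral_rpow_sub_one_Ioo ht y, lintegral_indicator (hmeas _),
      Measure.restrict_restrict (hmeas _)]
    congr 2
    ext l
    simp only [Set.mem_inter_iff, Set.mem_ofPred_eq, Set.mem_Ioi, Set.mem_Ioo]
    constructor
    · rintro ⟨h1, h2⟩
      refine ⟨h2, ?_⟩
      rwa [← ENNReal.ofReal_coe_nnreal, ENNReal.ofReal_lt_ofReal_iff_of_nonneg h2.le] at h1
    · rintro ⟨h1, h2⟩
      refine ⟨?_, h1⟩
      rwa [← ENNReal.ofReal_coe_nnreal, ENNReal.ofReal_lt_ofReal_iff_of_nonneg h1.le]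
  induction y with
  | coe y => exact hfin y
  | top =>
    have hc : ENNReal.ofReal t⁻¹ ≠ 0 := by simpa using ht
    rw [ENNReal.top_rpow_of_pos ht, ENNReal.mul_top hc, eq_top_iff]
    have hlim : Tendsto (fun n : ℕ => ENNReal.ofReal t⁻¹ * (n : ℝ≥0∞) ^ t) atTop (𝓝 ⊤) := by
      have : Tendsto (fun n : ℕ => (n : ℝ≥0∞) ^ t) atTop (𝓝 ((⊤ : ℝ≥0∞) ^ t)) :=
        (ENNReal.continuous_rpow_const.tendsto _).comp ENNReal.tendsto_nat_nhds_top
      have h2 := ENNReal.Tendsto.const_mul (a := ENNReal.ofReal t⁻¹) this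
        (Or.inr ENNReal.ofReal_ne_top)
      rwa [ENNReal.top_rpow_of_pos ht, ENNReal.mul_top hc] at h2
    refine le_of_tendsto hlim (Eventually.of_forall fun n => ?_)
    have := hfin n
    rw [show ((n : ℝ≥0) : ℝ≥0∞) = n by simp] at this
    rw [← this]
    refine lintegral_mono fun l => ?_
    exact Set.indicator_le_indicator_of_subset
      (fun l (hl : ENNReal.ofReal l < n) => hl.trans_le le_top) (fun _ => zero_le) l

theorem lintegral_rpow_eq_layer {Z : Type*} [MeasurableSpace Z] {μ : Measure Z} [SFinite μ]
    {t : ℝ} (ht : 0 < t) {F : Z → ℝ≥0∞} (hF : Measurable F) :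
    ∫⁻ ξ, F ξ ^ t ∂μ = ENNReal.ofReal t * ∫⁻ l in Set.Ioi (0 : ℝ),
      ENNReal.ofReal (l ^ (t - 1)) * μ {ξ | ENNReal.ofReal l < F ξ} := by
  have hm : MeasurableSet {z : Z × ℝ | ENNReal.ofReal z.2 < F z.1} :=
    measurableSet_lt (ENNReal.measurable_ofReal.comp measurable_snd) (hF.comp measurable_fst)
  have hmeas : Measurable (fun z : Z × ℝ => {z : Z × ℝ | ENNReal.ofReal z.2 < F z.1}.indicator
      (fun z => ENNReal.ofReal (z.2 ^ (t - 1))) z) :=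
    (by fun_prop : Measurable fun z : Z × ℝ => ENNReal.ofReal (z.2 ^ (t - 1))).indicator hm
  have h1 : ∀ ξ, F ξ ^ t = ENNReal.ofReal t * ∫⁻ l in Set.Ioi (0 : ℝ),
      {z : Z × ℝ | ENNReal.ofReal z.2 < F z.1}.indicator
      (fun z => ENNReal.ofReal (z.2 ^ (t - 1))) (ξ, l) := by
    intro ξ
    have := lintegral_layer_rpow ht (F ξ)
    rw [show (∫⁻ l in Set.Ioi (0 : ℝ),
      {z : Z × ℝ | ENNReal.ofReal z.2 < F z.1}.indicator
      (fun z => ENNReal.ofReal (z.2 ^ (t - 1))) (ξ, l)) = _ from this, ← mul_assoc,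
      ← ENNReal.ofReal_mul ht.le, mul_inv_cancel₀ ht.ne', ENNReal.ofReal_one, one_mul]
  simp_rw [h1]
  rw [lintegral_const_mul _ hmeas.lintegral_prod_right',
    lintegral_lintegral_swap (f := fun ξ l => {z : Z × ℝ | ENNReal.ofReal z.2 < F z.1}.indicator
      (fun z => ENNReal.ofReal (z.2 ^ (t - 1))) (ξ, l)) hmeas.aemeasurable]
  congr 1
  refine lintegral_congr fun l => ?_
  have hml : MeasurableSet {ξ | ENNReal.ofReal l < F ξ} := measurableSet_lt measurable_const hF
  rw [← setLIntegral_const, ← lintegral_indicator hml]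
  rfl

/-- The Hardy-Littlewood maximal theorem for a countable family of closed balls. -/
theorem ballMaximal_strong_type {Z ι : Type*} [MetricSpace Z] [MeasurableSpace Z] [BorelSpace Z]
    [Countable ι] {μ : Measure Z} [SFinite μ] {c : ι → Z} {ρ : ι → ℝ} {R : ℝ}
    (hρ : ∀ i, ρ i ≤ R) {A : ℝ≥0∞} (hAt : A ≠ ∞)
    (hA : ∀ i, μ (Metric.closedBall (c i) (5 * ρ i)) ≤ A * μ (Metric.closedBall (c i) (ρ i)))
    {t : ℝ} (ht : 1 < t) :
    ∃ C : ℝ≥0∞, C ≠ ∞ ∧ ∀ h : Z → ℝ≥0∞, Measurable h →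
      ∫⁻ ξ, ballMaximal μ c ρ h ξ ^ t ∂μ ≤ C * ∫⁻ ξ, h ξ ^ t ∂μ := by
  refine ⟨ENNReal.ofReal t * (2 * A) * (ENNReal.ofReal (t - 1)⁻¹ * 2 ^ (t - 1)), ?_, ?_⟩
  · exact ENNReal.mul_ne_top (ENNReal.mul_ne_top ENNReal.ofReal_ne_top
      (ENNReal.mul_ne_top (by simp) hAt)) (ENNReal.mul_ne_top ENNReal.ofReal_ne_top
      (ENNReal.rpow_ne_top_of_nonneg (by linarith) (by simp)))
  intro h hh
  -- At height l, half of l is given to the bounded part of h and the weak-type bound at height l/2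
  -- is applied to the part of h above l/2.
  have hkey : ∀ l : ℝ, 0 < l → ENNReal.ofReal (l ^ (t - 1)) *
      μ {ξ | ENNReal.ofReal l < ballMaximal μ c ρ h ξ} ≤ (2 * A) * ∫⁻ ξ, h ξ *
        {ξ | ENNReal.ofReal l < 2 * h ξ}.indicator (fun _ => ENNReal.ofReal (l ^ (t - 1 - 1))) ξ ∂μ := by
    intro l hl
    have hset : {η | ENNReal.ofReal l < 2 * h η} = {η | ENNReal.ofReal (l / 2) < h η} := by
      ext η
      simp only [Set.mem_ofPred_eq]
      have h2 : ENNReal.ofReal l = 2 * ENNReal.ofReal (l / 2) := by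
        rw [← ENNReal.ofReal_ofNat, ← ENNReal.ofReal_mul (by norm_num)]; congr 1; ring
      rw [h2, ENNReal.mul_lt_mul_iff_right (by simp) (by simp)]
    have hm : MeasurableSet {η | ENNReal.ofReal l < 2 * h η} :=
      measurableSet_lt measurable_const (hh.const_mul _)
    have hsplit : ENNReal.ofReal l = ENNReal.ofReal (l / 2) + ENNReal.ofReal (l / 2) := by
      rw [← ENNReal.ofReal_add (by positivity) (by positivity)]; congr 1; ring
    have hw := ballMaximal_weak_type (μ := μ) (c := c) hρ hA
      ({η | ENNReal.ofReal (l / 2) < h η}.indicator h) (ENNReal.ofReal (l / 2))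
    have hsub : {ξ | ENNReal.ofReal l < ballMaximal μ c ρ h ξ} ⊆ {ξ | ENNReal.ofReal (l / 2) <
        ballMaximal μ c ρ ({η | ENNReal.ofReal (l / 2) < h η}.indicator h) ξ} := by
      intro ξ hξ
      have h1 := lt_of_lt_of_le (show ENNReal.ofReal l < ballMaximal μ c ρ h ξ from hξ)
        (ballMaximal_le_add h (ENNReal.ofReal (l / 2)) ξ)
      rw [hsplit] at h1
      exact lt_of_add_lt_add_right h1
    have hpow : ENNReal.ofReal (l ^ (t - 1)) =
        2 * ENNReal.ofReal (l ^ (t - 1 - 1)) * ENNReal.ofReal (l / 2) := by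
      rw [← ENNReal.ofReal_ofNat, ← ENNReal.ofReal_mul (by norm_num),
        ← ENNReal.ofReal_mul (by positivity)]
      congr 1
      rw [Real.rpow_sub_one hl.ne' (t - 1)]
      field_simp
    calc _ ≤ 2 * ENNReal.ofReal (l ^ (t - 1 - 1)) * (ENNReal.ofReal (l / 2) *
          μ {ξ | ENNReal.ofReal (l / 2) <
        ballMaximal μ c ρ ({η | ENNReal.ofReal (l / 2) < h η}.indicator h) ξ}) := by
          rw [hpow, mul_assoc]; gcongr
      _ ≤ 2 * ENNReal.ofReal (l ^ (t - 1 - 1)) *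
          (A * ∫⁻ ξ, {η | ENNReal.ofReal (l / 2) < h η}.indicator h ξ ∂μ) := by gcongr
      _ = (2 * A) * ∫⁻ ξ, {η | ENNReal.ofReal (l / 2) < h η}.indicator h ξ *
          ENNReal.ofReal (l ^ (t - 1 - 1)) ∂μ := by
          rw [lintegral_mul_const _ (hh.indicator (hset ▸ hm))]; ring
      _ = _ := by
          rw [hset]
          congr 1
          refine lintegral_congr fun ξ => ?_
          by_cases hξ : ξ ∈ {η | ENNReal.ofReal (l / 2) < h η}
          · rw [Set.indicator_of_mem hξ, Set.indicator_of_mem hξ]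
          · rw [Set.indicator_of_notMem hξ, Set.indicator_of_notMem hξ, zero_mul, mul_zero]
  have hm : MeasurableSet {z : ℝ × Z | ENNReal.ofReal z.1 < 2 * h z.2} :=
    measurableSet_lt (ENNReal.measurable_ofReal.comp measurable_fst)
      ((hh.comp measurable_snd).const_mul _)
  have hmeas : Measurable (fun z : ℝ × Z => h z.2 * {z : ℝ × Z | ENNReal.ofReal z.1 < 2 * h z.2}.indicator
      (fun z => ENNReal.ofReal (z.1 ^ (t - 1 - 1))) z) :=
    (hh.comp measurable_snd).mul
    ((by fun_prop : Measurable fun z : ℝ × Z => ENNReal.ofReal (z.1 ^ (t - 1 - 1))).indicator hm)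
  rw [lintegral_rpow_eq_layer (by linarith) (measurable_ballMaximal h)]
  calc _ ≤ ENNReal.ofReal t * ∫⁻ l in Set.Ioi (0 : ℝ), (2 * A) * ∫⁻ ξ, h ξ *
        {ξ | ENNReal.ofReal l < 2 * h ξ}.indicator
          (fun _ => ENNReal.ofReal (l ^ (t - 1 - 1))) ξ ∂μ := by
        exact mul_le_mul_right (setLIntegral_mono' measurableSet_Ioi hkey) _
    _ = ENNReal.ofReal t * (2 * A) * ∫⁻ ξ, (∫⁻ l in Set.Ioi (0 : ℝ), h ξ *
        {z : ℝ × Z | ENNReal.ofReal z.1 < 2 * h z.2}.indicator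
          (fun z => ENNReal.ofReal (z.1 ^ (t - 1 - 1))) (l, ξ)) ∂μ := by
        rw [mul_assoc, ← lintegral_lintegral_swap (f := fun l ξ => h ξ *
          {z : ℝ × Z | ENNReal.ofReal z.1 < 2 * h z.2}.indicator
          (fun z => ENNReal.ofReal (z.1 ^ (t - 1 - 1))) (l, ξ)) hmeas.aemeasurable]
        congr 1
        rw [← lintegral_const_mul _ hmeas.lintegral_prod_right']
        rfl
    -- The inner integral of l^(t-2) over 0 < l < 2h converges at 0 because t > 1, with value
    -- (2h)^(t-1)/(t-1).
    _ = ENNReal.ofReal t * (2 * A) * ∫⁻ ξ, (ENNReal.ofReal (t - 1)⁻¹ * 2 ^ (t - 1)) * h ξ ^ t ∂μ := by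
        congr 1
        refine lintegral_congr fun ξ => ?_
        have hmξ : Measurable (fun l : ℝ => {z : ℝ × Z | ENNReal.ofReal z.1 < 2 * h z.2}.indicator
          (fun z => ENNReal.ofReal (z.1 ^ (t - 1 - 1))) (l, ξ)) :=
          ((by fun_prop : Measurable fun z : ℝ × Z =>
            ENNReal.ofReal (z.1 ^ (t - 1 - 1))).indicator hm).comp measurable_prodMk_right
        rw [lintegral_const_mul _ hmξ]
        have := lintegral_layer_rpow (t := t - 1) (by linarith) (2 * h ξ)
        rw [show (∫⁻ l in Set.Ioi (0 : ℝ), {z : ℝ × Z | ENNReal.ofReal z.1 < 2 * h z.2}.indicator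
          (fun z => ENNReal.ofReal (z.1 ^ (t - 1 - 1))) (l, ξ)) = _ from this,
          ENNReal.mul_rpow_of_nonneg _ _ (by linarith)]
        have h3 : h ξ ^ t = h ξ * h ξ ^ (t - 1) := by
          conv_rhs => rw [← ENNReal.rpow_one (h ξ), ← ENNReal.rpow_mul, one_mul]
          rw [← ENNReal.rpow_add_of_nonneg _ _ (by norm_num) (by linarith)]
          congr 1; ring
        rw [h3]; ring
    _ = _ := by rw [lintegral_const_mul _ (hh.pow_const t)]; ring

/-! ### Symmetric averaging operators and the vector-valued maximal inequality -/

/-- The positive integral operator with kernel `K`. -/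
def kernelOp {Z : Type*} [MeasurableSpace Z] (μ : Measure Z) (K : Z → Z → ℝ≥0∞)
    (h : Z → ℝ≥0∞) (ξ : Z) : ℝ≥0∞ :=
  ∫⁻ η, K ξ η * h η ∂μ

/-- A sequence of symmetric positive kernels of bounded total mass whose maximal operator is
bounded on `L^t` for all `t > 1`. -/
structure IsAveragingFamily {Z : Type*} [MeasurableSpace Z] (μ : Measure Z)
    (K : ℕ → Z → Z → ℝ≥0∞) (N : ℝ≥0∞) : Prop where
  measurable : ∀ m, Measurable (Function.uncurry (K m))
  symm : ∀ m ξ η, K m ξ η = K m η ξ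
  total_le : ∀ m ξ, ∫⁻ η, K m ξ η ∂μ ≤ N
  ne_top : N ≠ ∞
  maximal : ∀ t : ℝ, 1 < t → ∃ C : ℝ≥0∞, C ≠ ∞ ∧ ∀ h : Z → ℝ≥0∞, Measurable h →
    ∫⁻ ξ, (⨆ m, kernelOp μ (K m) h ξ) ^ t ∂μ ≤ C * ∫⁻ ξ, h ξ ^ t ∂μ

/-- Absorption of a power of I into the left side. It needs I finite, and so forces a truncation
where it is applied. -/
theorem ENNReal.le_rpow_of_le_mul_rpow {I B : ℝ≥0∞} {t : ℝ}
    (ht : 1 < t) (hI : I ≠ ∞) (h : I ≤ B * I ^ (1 - 1 / t)) : I ≤ B ^ t := by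
  rcases eq_or_ne I 0 with rfl | h0
  · exact zero_le
  have ht0 : 0 < t := by linarith
  have h1 : I ^ (1 / t) ≤ B := by
    have hne : I ^ (1 - 1 / t) ≠ 0 := by simp [ENNReal.rpow_eq_zero_iff, h0, hI]
    have hnt : I ^ (1 - 1 / t) ≠ ∞ := by simp [ENNReal.rpow_eq_top_iff, h0, hI]
    have h2 : I ^ (1 / t) * I ^ (1 - 1 / t) ≤ B * I ^ (1 - 1 / t) := by
      rw [← ENNReal.rpow_add _ _ h0 hI]
      simpa using h
    rwa [ENNReal.mul_le_mul_iff_left hne hnt] at h2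
  calc I = (I ^ (1 / t)) ^ t := by
        rw [← ENNReal.rpow_mul, one_div, inv_mul_cancel₀ ht0.ne', ENNReal.rpow_one]
    _ ≤ B ^ t := ENNReal.rpow_le_rpow h1 ht0.le

namespace IsAveragingFamily

variable {Z : Type*} [MeasurableSpace Z] {μ : Measure Z} {K : ℕ → Z → Z → ℝ≥0∞}
  {N : ℝ≥0∞}

theorem measurable_right (hK : IsAveragingFamily μ K N) (m : ℕ) (ξ : Z) : Measurable (K m ξ) :=
  (hK.measurable m).comp measurable_prodMk_left

theorem kernelOp_one_le (hK : IsAveragingFamily μ K N) (m : ℕ) (ξ : Z) :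
    kernelOp μ (K m) (fun _ => 1) ξ ≤ N := by
  simpa [kernelOp] using hK.total_le m ξ

theorem kernelOp_mul_le (hK : IsAveragingFamily μ K N) (m : ℕ) {q q' : ℝ}
    (hq : q.HolderConjugate q') {f g : Z → ℝ≥0∞} (hf : Measurable f) (hg : Measurable g) (ξ : Z) :
    kernelOp μ (K m) (fun η => f η * g η) ξ ≤ kernelOp μ (K m) (fun η => f η ^ q) ξ ^ (1 / q) *
      kernelOp μ (K m) (fun η => g η ^ q') ξ ^ (1 / q') := by
  have h1 : ∀ h : Z → ℝ≥0∞, Measurable h →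
      kernelOp μ (K m) h ξ = ∫⁻ η, h η ∂(μ.withDensity (K m ξ)) := fun h hh => by
    rw [lintegral_withDensity_eq_lintegral_mul _ (hK.measurable_right m ξ) hh]; rfl
  rw [h1 _ (show Measurable fun η => f η * g η from hf.mul hg), h1 _ (hf.pow_const q), h1 _ (hg.pow_const q')]
  exact ENNReal.lintegral_mul_le_Lp_mul_Lq _ hq hf.aemeasurable hg.aemeasurable

/-- Jensen's inequality for kernels whose total mass is at most N instead of 1. -/
theorem kernelOp_rpow_le (hK : IsAveragingFamily μ K N) (m : ℕ) {q : ℝ} (hq : 1 < q)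
    {f : Z → ℝ≥0∞} (hf : Measurable f) (ξ : Z) :
    kernelOp μ (K m) f ξ ^ q ≤ N ^ (q - 1) * kernelOp μ (K m) (fun η => f η ^ q) ξ := by
  have hc := Real.HolderConjugate.conjExponent hq
  have h1 := hK.kernelOp_mul_le m hc hf (measurable_const (a := (1 : ℝ≥0∞))) ξ
  simp only [mul_one, ENNReal.one_rpow] at h1
  have hq0 : 0 < q := by linarith
  calc kernelOp μ (K m) f ξ ^ q
      ≤ (kernelOp μ (K m) (fun η => f η ^ q) ξ ^ (1 / q) * N ^ (1 / q.conjExponent)) ^ q := by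
        refine ENNReal.rpow_le_rpow (h1.trans ?_) hq0.le
        gcongr
        · exact one_div_nonneg.2 hc.symm.nonneg
        · exact hK.kernelOp_one_le m ξ
    _ = _ := by
        rw [ENNReal.mul_rpow_of_nonneg _ _ hq0.le, ← ENNReal.rpow_mul, ← ENNReal.rpow_mul,
          one_div_mul_cancel hq0.ne', ENNReal.rpow_one, mul_comm]
        congr 2
        have := hc.sub_one_mul_conj
        have h3 : q.conjExponent ≠ 0 := hc.symm.ne_zero
        field_simp
        linarith

theorem double_tsum_rpow_le (hK : IsAveragingFamily μ K N) (w : ℕ → ℕ → ℝ≥0∞)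
    {G : ℕ → Z → ℝ≥0∞} (hG : ∀ k, Measurable (G k)) {q : ℝ} (hq : 1 < q) (ξ : Z) :
    ∑' k, ∑' m, w k m * kernelOp μ (K m) (G k) ξ ^ q ≤
      N ^ (q - 1) * ∑' k, ∑' m, w k m * kernelOp μ (K m) (fun η => G k η ^ q) ξ := by
  simp_rw [← ENNReal.tsum_mul_left]
  refine ENNReal.tsum_le_tsum fun k => ENNReal.tsum_le_tsum fun m => ?_
  calc w k m * kernelOp μ (K m) (G k) ξ ^ q
      ≤ w k m * (N ^ (q - 1) * kernelOp μ (K m) (fun η => G k η ^ q) ξ) := by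
        gcongr
        exact hK.kernelOp_rpow_le m hq (hG k) ξ
    _ = _ := by ring

variable [SFinite μ]

theorem measurable_kernelOp (hK : IsAveragingFamily μ K N) (m : ℕ) {h : Z → ℝ≥0∞}
    (hh : Measurable h) : Measurable (kernelOp μ (K m) h) :=
  ((hK.measurable m).mul (hh.comp measurable_snd)).lintegral_prod_right'

theorem lintegral_mul_kernelOp (hK : IsAveragingFamily μ K N) (m : ℕ) {φ ψ : Z → ℝ≥0∞}
    (hφ : Measurable φ) (hψ : Measurable ψ) :
    ∫⁻ ξ, ψ ξ * kernelOp μ (K m) φ ξ ∂μ = ∫⁻ ξ, φ ξ * kernelOp μ (K m) ψ ξ ∂μ := by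
  have h1 : ∀ φ ψ : Z → ℝ≥0∞, Measurable φ → ∀ ξ, ψ ξ * kernelOp μ (K m) φ ξ =
      ∫⁻ η, ψ ξ * (K m ξ η * φ η) ∂μ := fun φ ψ hφ ξ =>
    (lintegral_const_mul _ ((hK.measurable_right m ξ).mul hφ)).symm
  simp_rw [h1 φ ψ hφ, h1 ψ φ hψ]
  rw [lintegral_lintegral_swap]
  · refine lintegral_congr fun ξ => lintegral_congr fun η => ?_
    rw [hK.symm]; ring
  · exact ((hψ.comp measurable_fst).mul
      ((hK.measurable m).mul (hφ.comp measurable_snd))).aemeasurable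

/-- By symmetry of the kernels each operator moves onto ψ. There it is dominated by the maximal
function of ψ, which depends on neither k nor m, so the sum over m costs only W. -/
theorem lintegral_mul_tsum_kernelOp_le (hK : IsAveragingFamily μ K N) {w : ℕ → ℕ → ℝ≥0∞}
    {W : ℝ≥0∞} (hw : ∀ k, ∑' m, w k m ≤ W) {φ : ℕ → Z → ℝ≥0∞} (hφ : ∀ k, Measurable (φ k))
    {ψ : Z → ℝ≥0∞} (hψ : Measurable ψ) :
    ∫⁻ ξ, ψ ξ * ∑' k, ∑' m, w k m * kernelOp μ (K m) (φ k) ξ ∂μ ≤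
      W * ∫⁻ ξ, (∑' k, φ k ξ) * ⨆ m, kernelOp μ (K m) ψ ξ ∂μ := by
  have hM : Measurable fun ξ => ⨆ m, kernelOp μ (K m) ψ ξ :=
    Measurable.iSup fun m => hK.measurable_kernelOp m hψ
  calc ∫⁻ ξ, ψ ξ * ∑' k, ∑' m, w k m * kernelOp μ (K m) (φ k) ξ ∂μ
      = ∫⁻ ξ, ∑' k, ∑' m, w k m * (ψ ξ * kernelOp μ (K m) (φ k) ξ) ∂μ := by
        refine lintegral_congr fun ξ => ?_
        simp_rw [← ENNReal.tsum_mul_left]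
        exact tsum_congr fun k => tsum_congr fun m => by ring
    _ = ∑' k, ∑' m, w k m * ∫⁻ ξ, φ k ξ * kernelOp μ (K m) ψ ξ ∂μ := by
        have hmeas : ∀ k m, Measurable fun ξ => w k m * (ψ ξ * kernelOp μ (K m) (φ k) ξ) :=
          fun k m => (hψ.mul (hK.measurable_kernelOp m (hφ k))).const_mul _
        rw [lintegral_tsum fun k => (Measurable.tsum fun m => hmeas k m).aemeasurable]
        refine tsum_congr fun k => ?_
        rw [lintegral_tsum fun m => (hmeas k m).aemeasurable]
        refine tsum_congr fun m => ?_
        rw [lintegral_const_mul _ (show Measurable fun ξ => ψ ξ * kernelOp μ (K m) (φ k) ξ from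
            hψ.mul (hK.measurable_kernelOp m (hφ k))),
          hK.lintegral_mul_kernelOp m (hφ k) hψ]
    _ ≤ ∑' k, ∑' m, w k m * ∫⁻ ξ, φ k ξ * ⨆ m, kernelOp μ (K m) ψ ξ ∂μ := by
        gcongr with k m ξ
        exact le_iSup (fun m => kernelOp μ (K m) ψ ξ) m
    _ ≤ ∑' k, W * ∫⁻ ξ, φ k ξ * ⨆ m, kernelOp μ (K m) ψ ξ ∂μ := by
        gcongr with k
        rw [ENNReal.tsum_mul_right]
        gcongr
        exact hw k
    _ = W * ∫⁻ ξ, (∑' k, φ k ξ) * ⨆ m, kernelOp μ (K m) ψ ξ ∂μ := by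
        rw [ENNReal.tsum_mul_left, ← lintegral_tsum fun k => (show Measurable fun ξ => φ k ξ *
          ⨆ m, kernelOp μ (K m) ψ ξ from (hφ k).mul hM).aemeasurable]
        simp_rw [ENNReal.tsum_mul_right]

theorem lintegral_tsum_kernelOp_le (hK : IsAveragingFamily μ K N) {w : ℕ → ℕ → ℝ≥0∞}
    {W : ℝ≥0∞} (hw : ∀ k, ∑' m, w k m ≤ W) {φ : ℕ → Z → ℝ≥0∞} (hφ : ∀ k, Measurable (φ k)) :
    ∫⁻ ξ, ∑' k, ∑' m, w k m * kernelOp μ (K m) (φ k) ξ ∂μ ≤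
      W * N * ∫⁻ ξ, ∑' k, φ k ξ ∂μ := by
  have h := hK.lintegral_mul_tsum_kernelOp_le hw hφ (measurable_const (a := (1 : ℝ≥0∞)))
  simp only [one_mul] at h
  refine h.trans ?_
  rw [mul_assoc]
  gcongr
  rw [← lintegral_const_mul _ (Measurable.tsum hφ)]
  refine lintegral_mono fun ξ => ?_
  rw [mul_comm]
  gcongr
  exact iSup_le fun m => hK.kernelOp_one_le m ξ

theorem measurable_double_tsum (hK : IsAveragingFamily μ K N) (w : ℕ → ℕ → ℝ≥0∞)
    {φ : ℕ → Z → ℝ≥0∞} (hφ : ∀ k, Measurable (φ k)) (q : ℝ) :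
    Measurable fun ξ => ∑' k, ∑' m, w k m * kernelOp μ (K m) (φ k) ξ ^ q :=
  Measurable.tsum fun k => Measurable.tsum fun m =>
    ((hK.measurable_kernelOp m (hφ k)).pow_const q).const_mul _

/-- Duality: the double sum U is tested against V^(t-1), where V is U truncated at height n. The
maximal inequality in the conjugate exponent bounds the result by a power of ∫ V^t, which is finite
since μ is, and can be absorbed. Monotone convergence removes the truncation. -/
theorem lintegral_rpow_tsum_kernelOp_le [IsFiniteMeasure μ] (hK : IsAveragingFamily μ K N)
    {w : ℕ → ℕ → ℝ≥0∞} {W : ℝ≥0∞} (hW : W ≠ ∞) (hw : ∀ k, ∑' m, w k m ≤ W) {t : ℝ} (ht : 1 < t) :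
    ∃ C : ℝ≥0∞, C ≠ ∞ ∧ ∀ φ : ℕ → Z → ℝ≥0∞, (∀ k, Measurable (φ k)) →
      ∫⁻ ξ, (∑' k, ∑' m, w k m * kernelOp μ (K m) (φ k) ξ) ^ t ∂μ ≤
        C * ∫⁻ ξ, (∑' k, φ k ξ) ^ t ∂μ := by
  have hc := Real.HolderConjugate.conjExponent ht
  set t' := t.conjExponent with ht'
  obtain ⟨C, hC, hmax⟩ := hK.maximal t' hc.symm.lt
  have ht0 : 0 < t := by linarith
  have ht'0 : 0 < t' := hc.symm.pos
  refine ⟨(W * C ^ (1 / t')) ^ t, ENNReal.rpow_ne_top_of_nonneg ht0.le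
    (ENNReal.mul_ne_top hW (ENNReal.rpow_ne_top_of_nonneg (by positivity) hC)), fun φ hφ => ?_⟩
  set U : Z → ℝ≥0∞ := fun ξ => ∑' k, ∑' m, w k m * kernelOp μ (K m) (φ k) ξ with hU
  have hUm : Measurable U := by simpa using hK.measurable_double_tsum w hφ 1
  have hΦm : Measurable fun ξ => ∑' k, φ k ξ := Measurable.tsum hφ
  have htrunc : ∀ n : ℕ, ∫⁻ ξ, (min (U ξ) n) ^ t ∂μ ≤
      (W * C ^ (1 / t')) ^ t * ∫⁻ ξ, (∑' k, φ k ξ) ^ t ∂μ := by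
    intro n
    set V : Z → ℝ≥0∞ := fun ξ => min (U ξ) n with hV
    have hVm : Measurable V := hUm.min measurable_const
    have hψm : Measurable fun ξ => V ξ ^ (t - 1) := hVm.pow_const _
    have hfin : ∫⁻ ξ, V ξ ^ t ∂μ ≠ ∞ := by
      refine ((lintegral_mono (g := fun _ => (n : ℝ≥0∞) ^ t) fun ξ =>
        ENNReal.rpow_le_rpow (min_le_right _ _) ht0.le).trans_lt ?_).ne
      rw [lintegral_const]
      exact ENNReal.mul_lt_top (ENNReal.rpow_lt_top_of_nonneg ht0.le (by simp))
        (measure_lt_top _ _)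
    have hMm : Measurable fun ξ => ⨆ m, kernelOp μ (K m) (fun η => V η ^ (t - 1)) ξ :=
      Measurable.iSup fun m => hK.measurable_kernelOp m hψm
    have hexp : 1 / t' = 1 - 1 / t := by
      have := hc.inv_add_inv_eq_one
      rw [one_div, one_div]; linarith
    have hpow : ∀ ξ, (V ξ ^ (t - 1)) ^ t' = V ξ ^ t := fun ξ => by
      rw [← ENNReal.rpow_mul, hc.sub_one_mul_conj]
    have hVV : ∀ ξ, V ξ ^ t = V ξ ^ (t - 1) * V ξ := fun ξ => by
      conv_rhs => rw [← ENNReal.rpow_one (V ξ), ← ENNReal.rpow_mul, one_mul]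
      rw [← ENNReal.rpow_add_of_nonneg _ _ (by linarith) (by norm_num)]
      congr 1; ring
    have hmain : ∫⁻ ξ, V ξ ^ t ∂μ ≤
        (W * C ^ (1 / t') * (∫⁻ ξ, (∑' k, φ k ξ) ^ t ∂μ) ^ (1 / t)) *
          (∫⁻ ξ, V ξ ^ t ∂μ) ^ (1 - 1 / t) := by
      calc ∫⁻ ξ, V ξ ^ t ∂μ ≤ ∫⁻ ξ, V ξ ^ (t - 1) * U ξ ∂μ := by
            refine lintegral_mono fun ξ => ?_
            rw [hVV]
            gcongr
            exact min_le_left _ _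
        _ ≤ W * ∫⁻ ξ, (∑' k, φ k ξ) * ⨆ m, kernelOp μ (K m) (fun η => V η ^ (t - 1)) ξ ∂μ :=
            hK.lintegral_mul_tsum_kernelOp_le hw hφ hψm
        _ ≤ W * ((∫⁻ ξ, (∑' k, φ k ξ) ^ t ∂μ) ^ (1 / t) *
            (∫⁻ ξ, (⨆ m, kernelOp μ (K m) (fun η => V η ^ (t - 1)) ξ) ^ t' ∂μ) ^ (1 / t')) := by
            gcongr
            exact ENNReal.lintegral_mul_le_Lp_mul_Lq _ hc hΦm.aemeasurable hMm.aemeasurable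
        _ ≤ W * ((∫⁻ ξ, (∑' k, φ k ξ) ^ t ∂μ) ^ (1 / t) *
            (C * ∫⁻ ξ, (V ξ ^ (t - 1)) ^ t' ∂μ) ^ (1 / t')) := by
            gcongr
            exact hmax _ hψm
        _ = _ := by
            rw [lintegral_congr hpow, ENNReal.mul_rpow_of_nonneg _ _ (by positivity), ← hexp]
            ring
    refine (ENNReal.le_rpow_of_le_mul_rpow ht hfin hmain).trans_eq ?_
    rw [ENNReal.mul_rpow_of_nonneg _ _ ht0.le, ← ENNReal.rpow_mul, one_div_mul_cancel ht0.ne',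
      ENNReal.rpow_one]
  have hlim : ∀ ξ, U ξ ^ t = ⨆ n : ℕ, (min (U ξ) n) ^ t := by
    intro ξ
    have h1 : Tendsto (fun n : ℕ => (min (U ξ) n) ^ t) atTop (𝓝 (min (U ξ) ⊤ ^ t)) :=
      (ENNReal.continuous_rpow_const.tendsto _).comp
        (tendsto_const_nhds.min ENNReal.tendsto_nat_nhds_top)
    rw [min_eq_left le_top] at h1
    refine tendsto_nhds_unique h1 (tendsto_atTop_iSup fun a b hab => ?_)
    exact ENNReal.rpow_le_rpow (min_le_min le_rfl (by exact_mod_cast hab)) ht0.le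
  change ∫⁻ ξ, U ξ ^ t ∂μ ≤ _
  rw [lintegral_congr hlim]
  rw [lintegral_iSup (fun n => (hUm.min measurable_const).pow_const t)
    (fun a b hab ξ => ENNReal.rpow_le_rpow (min_le_min le_rfl (by exact_mod_cast hab)) ht0.le)]
  exact iSup_le htrunc

/-- With F the ℓ^q norm of (G_k), factor G_k = (G_k F^(-a/q)) F^(a/q), a = q - p, and apply Hölder
to the kernel. The q-th power of the average of G_k is at most the average of φ_k = G_k^q F^(-a)
times the maximal function of F^b to the power q - 1, where b = a/(q-1). The choice of a makes the
φ_k sum to F^p, so the first factor is controlled in L^1 and the second in L^τ, with bτ = p; Hölder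
with exponents q/p and q/a recombines them. -/
theorem fefferman_stein_of_lt (hK : IsAveragingFamily μ K N)
    {w : ℕ → ℕ → ℝ≥0∞} {W : ℝ≥0∞} (hW : W ≠ ∞) (hw : ∀ k, ∑' m, w k m ≤ W) {p q : ℝ}
    (hp : 1 < p) (hpq : p < q) :
    ∃ C : ℝ≥0∞, C ≠ ∞ ∧ ∀ G : ℕ → Z → ℝ≥0∞, (∀ k, Measurable (G k)) →
      ∫⁻ ξ, (∑' k, ∑' m, w k m * kernelOp μ (K m) (G k) ξ ^ q) ^ (p / q) ∂μ ≤
        C * ∫⁻ ξ, (∑' k, G k ξ ^ q) ^ (p / q) ∂μ := by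
  have hp0 : 0 < p := by linarith
  have hq : 1 < q := by linarith
  have hq0 : 0 < q := by linarith
  have hd : 0 < q - p := by linarith
  have hd1 : 0 < q - 1 := by linarith
  set a := q - p with ha
  set b := a / (q - 1) with hb
  have hb0 : 0 < b := by positivity
  set τ := p / b with hτ
  -- τ > 1 says p(q-1) > q - p, that is, p > 1.
  have hτ1 : 1 < τ := by
    rw [hτ, hb, one_lt_div (by positivity), div_lt_iff₀ hd1]
    nlinarith
  obtain ⟨C, hC, hmax⟩ := hK.maximal τ hτ1
  -- The summand 1 keeps the constant nonzero, so that the right side is ∞ when the integral of F^p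
  -- is.
  refine ⟨C ^ (a / q) * (W * N) ^ (p / q) + 1, ENNReal.add_ne_top.2 ⟨ENNReal.mul_ne_top
    (ENNReal.rpow_ne_top_of_nonneg (by positivity) hC) (ENNReal.rpow_ne_top_of_nonneg
    (by positivity) (ENNReal.mul_ne_top hW hK.ne_top)), by simp⟩, fun G hG => ?_⟩
  set F : Z → ℝ≥0∞ := fun ξ => (∑' k, G k ξ ^ q) ^ (1 / q) with hF
  have hFm : Measurable F :=
    (Measurable.tsum fun k => (hG k).pow_const q).pow_const _
  have hFp : ∀ ξ, (∑' k, G k ξ ^ q) ^ (p / q) = F ξ ^ p := fun ξ => by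
    rw [hF, ← ENNReal.rpow_mul]; congr 1; ring
  have hFq : ∀ ξ, F ξ ^ q = ∑' k, G k ξ ^ q := fun ξ => by
    rw [hF, ← ENNReal.rpow_mul, one_div_mul_cancel hq0.ne', ENNReal.rpow_one]
  simp_rw [hFp]
  by_cases htop : ∫⁻ ξ, F ξ ^ p ∂μ = ∞
  · rw [htop, ENNReal.mul_top (by simp)]; exact le_top
  have hFfin : ∀ᵐ ξ ∂μ, F ξ < ∞ := by
    filter_upwards [ae_lt_top (hFm.pow_const p) htop] with ξ hξ
    by_contra hn
    rw [not_lt_top_iff.1 hn, ENNReal.top_rpow_of_pos hp0] at hξ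
    exact lt_irrefl _ hξ
  -- Where F vanishes, F^(-a/q) is ∞; the factorisation survives because G_k vanishes there too.
  have hG0 : ∀ k ξ, F ξ = 0 → G k ξ = 0 := by
    intro k ξ h0
    have h1 : ∑' k, G k ξ ^ q = 0 := by rw [← hFq, h0, ENNReal.zero_rpow_of_pos hq0]
    have h2 := ENNReal.tsum_eq_zero.1 h1 k
    exact (ENNReal.rpow_eq_zero_iff_of_pos hq0).1 h2
  set φ : ℕ → Z → ℝ≥0∞ := fun k ξ => (G k ξ * F ξ ^ (-(a / q))) ^ q with hφ
  have hφm : ∀ k, Measurable (φ k) := fun k => ((hG k).mul (hFm.pow_const _)).pow_const q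
  have hφsum : ∀ᵐ ξ ∂μ, ∑' k, φ k ξ = F ξ ^ p := by
    filter_upwards [hFfin] with ξ hξ
    have h1 : ∀ k, φ k ξ = G k ξ ^ q * F ξ ^ (-a) := fun k => by
      rw [hφ]
      simp only
      rw [ENNReal.mul_rpow_of_nonneg _ _ hq0.le, ← ENNReal.rpow_mul]
      congr 2; field_simp
    simp_rw [h1]
    rw [ENNReal.tsum_mul_right, ← hFq]
    rcases eq_or_ne (F ξ) 0 with h0 | h0
    · rw [h0, ENNReal.zero_rpow_of_pos hq0, ENNReal.zero_rpow_of_pos hp0, zero_mul]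
    · rw [← ENNReal.rpow_add _ _ h0 hξ.ne]
      congr 1; rw [ha]; ring
  have hc := Real.HolderConjugate.conjExponent hq
  have hEG : ∀ k m ξ, kernelOp μ (K m) (G k) ξ ^ q ≤ kernelOp μ (K m) (φ k) ξ *
      kernelOp μ (K m) (fun η => F η ^ b) ξ ^ (q - 1) := by
    intro k m ξ
    have h1 : kernelOp μ (K m) (G k) ξ =
        kernelOp μ (K m) (fun η => (G k η * F η ^ (-(a / q))) * F η ^ (a / q)) ξ := by
      refine lintegral_congr_ae ?_
      filter_upwards [hFfin] with η hη
      congr 1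
      rcases eq_or_ne (F η) 0 with h0 | h0
      · rw [hG0 k η h0, zero_mul, zero_mul]
      · rw [mul_assoc, ← ENNReal.rpow_add _ _ h0 hη.ne, neg_add_cancel, ENNReal.rpow_zero, mul_one]
    have h2 := hK.kernelOp_mul_le m hc (show Measurable fun η => G k η * F η ^ (-(a / q)) from
      (hG k).mul (hFm.pow_const (-(a / q))))
      (hFm.pow_const (a / q)) ξ
    rw [h1]
    refine (ENNReal.rpow_le_rpow h2 hq0.le).trans_eq ?_
    rw [ENNReal.mul_rpow_of_nonneg _ _ hq0.le, ← ENNReal.rpow_mul, ← ENNReal.rpow_mul,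
      one_div_mul_cancel hq0.ne', ENNReal.rpow_one]
    have h3 : q.conjExponent ≠ 0 := hc.symm.ne_zero
    have h4 := hc.sub_one_mul_conj
    have h5 : 1 / q.conjExponent * q = q - 1 := by field_simp; linarith
    have h6 : a / q * q.conjExponent = b := by
      rw [hb]
      field_simp
      linarith
    simp_rw [← ENNReal.rpow_mul]
    rw [h5, h6]
  set M : Z → ℝ≥0∞ := fun ξ => ⨆ m, kernelOp μ (K m) (fun η => F η ^ b) ξ with hM
  have hMm : Measurable M := Measurable.iSup fun m => hK.measurable_kernelOp m (hFm.pow_const b)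
  set Y : Z → ℝ≥0∞ := fun ξ => ∑' k, ∑' m, w k m * kernelOp μ (K m) (φ k) ξ with hY
  have hYm : Measurable Y := by simpa using hK.measurable_double_tsum w hφm 1
  have hpt : ∀ ξ, ∑' k, ∑' m, w k m * kernelOp μ (K m) (G k) ξ ^ q ≤ M ξ ^ (q - 1) * Y ξ := by
    intro ξ
    simp_rw [hY, ← ENNReal.tsum_mul_left]
    refine ENNReal.tsum_le_tsum fun k => ENNReal.tsum_le_tsum fun m => ?_
    calc w k m * kernelOp μ (K m) (G k) ξ ^ q
        ≤ w k m * (kernelOp μ (K m) (φ k) ξ * M ξ ^ (q - 1)) := by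
          gcongr
          refine (hEG k m ξ).trans ?_
          gcongr
          exact le_iSup (fun m => kernelOp μ (K m) (fun η => F η ^ b) ξ) m
      _ = _ := by ring
  have hhold : (q / a).HolderConjugate (q / p) := by
    rw [Real.holderConjugate_iff]
    refine ⟨by rw [one_lt_div hd]; rw [ha]; linarith, ?_⟩
    rw [inv_div, inv_div, ha]
    field_simp
    ring
  have hYint : ∫⁻ ξ, Y ξ ∂μ ≤ W * N * ∫⁻ ξ, F ξ ^ p ∂μ := by
    refine (hK.lintegral_tsum_kernelOp_le hw hφm).trans_eq ?_
    rw [lintegral_congr_ae hφsum]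
  calc ∫⁻ ξ, (∑' k, ∑' m, w k m * kernelOp μ (K m) (G k) ξ ^ q) ^ (p / q) ∂μ
      ≤ ∫⁻ ξ, (M ξ ^ (q - 1)) ^ (p / q) * Y ξ ^ (p / q) ∂μ := by
        refine lintegral_mono fun ξ => ?_
        rw [← ENNReal.mul_rpow_of_nonneg _ _ (by positivity)]
        exact ENNReal.rpow_le_rpow (hpt ξ) (by positivity)
    _ ≤ (∫⁻ ξ, ((M ξ ^ (q - 1)) ^ (p / q)) ^ (q / a) ∂μ) ^ (1 / (q / a)) *
        (∫⁻ ξ, (Y ξ ^ (p / q)) ^ (q / p) ∂μ) ^ (1 / (q / p)) :=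
        ENNReal.lintegral_mul_le_Lp_mul_Lq _ hhold ((hMm.pow_const _).pow_const _).aemeasurable
          (hYm.pow_const _).aemeasurable
    _ = (∫⁻ ξ, M ξ ^ τ ∂μ) ^ (a / q) * (∫⁻ ξ, Y ξ ∂μ) ^ (p / q) := by
        have e1 : (q - 1) * (p / q) * (q / a) = τ := by rw [hτ, hb]; field_simp
        have e2 : p / q * (q / p) = 1 := by field_simp
        simp_rw [← ENNReal.rpow_mul, e1, e2, ENNReal.rpow_one, one_div_div]
    _ ≤ (C * ∫⁻ ξ, F ξ ^ p ∂μ) ^ (a / q) * (W * N * ∫⁻ ξ, F ξ ^ p ∂μ) ^ (p / q) := by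
        gcongr
        refine (hmax _ (hFm.pow_const b)).trans_eq ?_
        have e3 : b * τ = p := by rw [hτ]; field_simp
        simp_rw [← ENNReal.rpow_mul, e3]
    _ = C ^ (a / q) * (W * N) ^ (p / q) * ∫⁻ ξ, F ξ ^ p ∂μ := by
        rw [ENNReal.mul_rpow_of_nonneg _ _ (by positivity),
          ENNReal.mul_rpow_of_nonneg _ _ (by positivity)]
        have e4 : (∫⁻ ξ, F ξ ^ p ∂μ) = (∫⁻ ξ, F ξ ^ p ∂μ) ^ (a / q) *
            (∫⁻ ξ, F ξ ^ p ∂μ) ^ (p / q) := by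
          rw [← ENNReal.rpow_add_of_nonneg _ _ (by positivity) (by positivity)]
          rw [show a / q + p / q = 1 by rw [ha]; field_simp; ring, ENNReal.rpow_one]
        conv_rhs => rw [e4]
        ring
    _ ≤ _ := by gcongr; exact le_self_add

/-- A weighted vector-valued maximal inequality of Fefferman-Stein type. -/
theorem fefferman_stein [IsFiniteMeasure μ] (hK : IsAveragingFamily μ K N)
    {w : ℕ → ℕ → ℝ≥0∞} {W : ℝ≥0∞} (hW : W ≠ ∞) (hw : ∀ k, ∑' m, w k m ≤ W) {p q : ℝ}
    (hp : 1 < p) (hq : 1 < q) :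
    ∃ C : ℝ≥0∞, C ≠ ∞ ∧ ∀ G : ℕ → Z → ℝ≥0∞, (∀ k, Measurable (G k)) →
      ∫⁻ ξ, (∑' k, ∑' m, w k m * kernelOp μ (K m) (G k) ξ ^ q) ^ (p / q) ∂μ ≤
        C * ∫⁻ ξ, (∑' k, G k ξ ^ q) ^ (p / q) ∂μ := by
  have hNq : N ^ (q - 1) ≠ ∞ := ENNReal.rpow_ne_top_of_nonneg (by linarith) hK.ne_top
  rcases lt_trichotomy p q with h | h | h
  · exact hK.fefferman_stein_of_lt hW hw hp h
  · subst h
    refine ⟨N ^ (p - 1) * (W * N), ENNReal.mul_ne_top hNq (ENNReal.mul_ne_top hW hK.ne_top),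
      fun G hG => ?_⟩
    rw [div_self (by linarith)]
    simp_rw [ENNReal.rpow_one]
    have hGq : ∀ k, Measurable fun η => G k η ^ p := fun k => (hG k).pow_const p
    calc _ ≤ ∫⁻ ξ, N ^ (p - 1) *
          ∑' k, ∑' m, w k m * kernelOp μ (K m) (fun η => G k η ^ p) ξ ∂μ :=
          lintegral_mono fun ξ => hK.double_tsum_rpow_le w hG hp ξ
      _ = N ^ (p - 1) * ∫⁻ ξ,
          ∑' k, ∑' m, w k m * kernelOp μ (K m) (fun η => G k η ^ p) ξ ∂μ :=
          lintegral_const_mul _ (by simpa using hK.measurable_double_tsum w hGq 1)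
      _ ≤ N ^ (p - 1) * (W * N * ∫⁻ ξ, ∑' k, G k ξ ^ p ∂μ) := by
          gcongr
          exact hK.lintegral_tsum_kernelOp_le hw hGq
      _ = _ := by ring
  -- For p > q, Jensen replaces the q-th power of an average by the average of the q-th power, and
  -- the duality bound applies with t = p/q.
  · have ht : 1 < p / q := by rw [one_lt_div (by linarith)]; exact h
    obtain ⟨C, hC, hCφ⟩ := hK.lintegral_rpow_tsum_kernelOp_le hW hw ht
    refine ⟨(N ^ (q - 1)) ^ (p / q) * C, ENNReal.mul_ne_top
      (ENNReal.rpow_ne_top_of_nonneg (by linarith) hNq) hC, fun G hG => ?_⟩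
    have hGq : ∀ k, Measurable fun η => G k η ^ q := fun k => (hG k).pow_const q
    calc _ ≤ ∫⁻ ξ, (N ^ (q - 1) *
          ∑' k, ∑' m, w k m * kernelOp μ (K m) (fun η => G k η ^ q) ξ) ^ (p / q) ∂μ :=
          lintegral_mono fun ξ =>
            ENNReal.rpow_le_rpow (hK.double_tsum_rpow_le w hG hq ξ) (by linarith)
      _ = (N ^ (q - 1)) ^ (p / q) * ∫⁻ ξ,
          (∑' k, ∑' m, w k m * kernelOp μ (K m) (fun η => G k η ^ q) ξ) ^ (p / q) ∂μ := by
          simp_rw [ENNReal.mul_rpow_of_nonneg _ _ (show 0 ≤ p / q by linarith)]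
          exact lintegral_const_mul _ ((by simpa using hK.measurable_double_tsum w hGq 1 :
            Measurable fun ξ => ∑' k, ∑' m, w k m *
              kernelOp μ (K m) (fun η => G k η ^ q) ξ).pow_const _)
      _ ≤ (N ^ (q - 1)) ^ (p / q) * (C * ∫⁻ ξ, (∑' k, G k ξ ^ q) ^ (p / q) ∂μ) := by
          gcongr
          exact hCφ _ hGq
      _ = _ := by ring

end IsAveragingFamily

/-! ### Quasi-norms in ℓ^q and geometrically decaying sums -/

theorem ENNReal.add_rpow_le_two_rpow_mul (a b : ℝ≥0∞) {e : ℝ} (he : 0 ≤ e) :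
    (a + b) ^ e ≤ 2 ^ e * (a ^ e + b ^ e) := by
  have h1 : a + b ≤ 2 * max a b := by
    rw [two_mul]; exact add_le_add (le_max_left _ _) (le_max_right _ _)
  calc (a + b) ^ e ≤ (2 * max a b) ^ e := ENNReal.rpow_le_rpow h1 he
    _ = 2 ^ e * (max a b) ^ e := ENNReal.mul_rpow_of_nonneg _ _ he
    _ ≤ 2 ^ e * (a ^ e + b ^ e) := by
        gcongr
        rcases max_cases a b with h | h
        · rw [h.1]; exact le_self_add
        · rw [h.1]; exact le_add_self

theorem ENNReal.rpow_one_div_rpow {q : ℝ} (hq : 0 < q) (a : ℝ≥0∞) : (a ^ q) ^ (1 / q) = a := by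
  rw [← ENNReal.rpow_mul, mul_one_div_cancel hq.ne', ENNReal.rpow_one]

namespace HyperbolicFilling

section lqNorm

variable {ι : Type*} {q : ℝ≥0∞}

theorem lqNorm_top (a : ι → ℝ≥0∞) : lqNorm ∞ a = ⨆ i, a i := if_pos rfl

theorem lqNorm_of_ne_top (hq : q ≠ ∞) (a : ι → ℝ≥0∞) :
    lqNorm q a = (∑' i, a i ^ q.toReal) ^ (1 / q.toReal) := if_neg hq

theorem lqNorm_mono {a b : ι → ℝ≥0∞} (h : ∀ i, a i ≤ b i) : lqNorm q a ≤ lqNorm q b := by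
  unfold lqNorm
  split_ifs
  · exact iSup_mono h
  · exact ENNReal.rpow_le_rpow (ENNReal.tsum_le_tsum fun i =>
      ENNReal.rpow_le_rpow (h i) ENNReal.toReal_nonneg) (by positivity)

theorem le_lqNorm (hq : 0 < q) (a : ι → ℝ≥0∞) (i : ι) : a i ≤ lqNorm q a := by
  by_cases h : q = ∞
  · subst h; rw [lqNorm_top]; exact le_iSup a i
  · have hq' := ENNReal.toReal_pos hq.ne' h
    rw [lqNorm_of_ne_top h]
    calc a i = (a i ^ q.toReal) ^ (1 / q.toReal) := (ENNReal.rpow_one_div_rpow hq' _).symm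
      _ ≤ _ := ENNReal.rpow_le_rpow (ENNReal.le_tsum i) (by positivity)

theorem lqNorm_const_mul (hq : 0 < q) (c : ℝ≥0∞) (a : ι → ℝ≥0∞) :
    lqNorm q (fun i => c * a i) = c * lqNorm q a := by
  by_cases h : q = ∞
  · subst h; simp_rw [lqNorm_top, ENNReal.mul_iSup]
  · have hq' := ENNReal.toReal_pos hq.ne' h
    simp_rw [lqNorm_of_ne_top h, ENNReal.mul_rpow_of_nonneg _ _ hq'.le]
    rw [ENNReal.tsum_mul_left, ENNReal.mul_rpow_of_nonneg _ _ (by positivity),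
      ENNReal.rpow_one_div_rpow hq']

/-- The crude bound (a + b)^e ≤ 2^e (a^e + b^e) needs no convexity and so also covers exponents
below 1. The constant does not depend on the index set, which later varies with ξ. -/
theorem exists_lqNorm_add_le (q : ℝ≥0∞) : ∃ C : ℝ≥0∞, C ≠ ∞ ∧ ∀ {ι : Type*} (a b : ι → ℝ≥0∞),
    lqNorm q (fun i => a i + b i) ≤ C * (lqNorm q a + lqNorm q b) := by
  by_cases h : q = ∞
  · subst h
    refine ⟨1, by simp, fun a b => ?_⟩
    simp_rw [lqNorm_top, one_mul]
    exact iSup_le fun i => add_le_add (le_iSup a i) (le_iSup b i)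
  · set e := q.toReal with he
    have he0 : 0 ≤ e := ENNReal.toReal_nonneg
    have hei : 0 ≤ 1 / e := by positivity
    refine ⟨(2 ^ e) ^ (1 / e) * 2 ^ (1 / e), ENNReal.mul_ne_top
      (ENNReal.rpow_ne_top_of_nonneg hei (ENNReal.rpow_ne_top_of_nonneg he0 (by simp)))
      (ENNReal.rpow_ne_top_of_nonneg hei (by simp)), fun a b => ?_⟩
    simp_rw [lqNorm_of_ne_top h, ← he]
    calc (∑' i, (a i + b i) ^ e) ^ (1 / e)
        ≤ (2 ^ e * (∑' i, a i ^ e + ∑' i, b i ^ e)) ^ (1 / e) := by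
          refine ENNReal.rpow_le_rpow ?_ hei
          rw [← ENNReal.tsum_add, ← ENNReal.tsum_mul_left]
          exact ENNReal.tsum_le_tsum fun i => ENNReal.add_rpow_le_two_rpow_mul _ _ he0
      _ = (2 ^ e) ^ (1 / e) * (∑' i, a i ^ e + ∑' i, b i ^ e) ^ (1 / e) :=
          ENNReal.mul_rpow_of_nonneg _ _ hei
      _ ≤ (2 ^ e) ^ (1 / e) * (2 ^ (1 / e) *
          ((∑' i, a i ^ e) ^ (1 / e) + (∑' i, b i ^ e) ^ (1 / e))) := by
          gcongr
          exact ENNReal.add_rpow_le_two_rpow_mul _ _ hei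
      _ = _ := by ring

theorem measurable_lqNorm [Countable ι] {Z : Type*} [MeasurableSpace Z] {D : ι → Z → ℝ≥0∞}
    (hD : ∀ i, Measurable (D i)) : Measurable fun ξ => lqNorm q fun i => D i ξ := by
  unfold lqNorm
  split_ifs
  · exact Measurable.iSup hD
  · exact (Measurable.tsum fun i => (hD i).pow_const _).pow_const _

end lqNorm

theorem tsum_ite_comp_le {P : ℕ → Prop} [DecidablePred P] {f : ℕ → ℕ}
    (hf : Set.InjOn f {i | P i}) (F : ℕ → ℝ≥0∞) :
    ∑' i, (if P i then F (f i) else 0) ≤ ∑' j, F j := by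
  have h1 : ∑' i, (if P i then F (f i) else 0) = ∑' i : {i | P i}, F (f i) := by
    rw [tsum_subtype {i | P i} fun i => F (f i)]
    exact tsum_congr fun i => by simp [Set.indicator_apply]
  rw [h1]
  exact ENNReal.tsum_comp_le_tsum_of_injective (f := fun i : {i | P i} => f i)
    (fun a b hab => Subtype.ext (hf a.2 b.2 hab)) F

/-- Geometrically decaying weights, supported on `m ≤ k + c`. -/
def decay (ρ : ℝ≥0∞) (c k m : ℕ) : ℝ≥0∞ := if m ≤ k + c then ρ ^ (k + c - m) else 0

theorem tsum_decay_left_le (ρ : ℝ≥0∞) (c m : ℕ) : ∑' k, decay ρ c k m ≤ (1 - ρ)⁻¹ := by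
  rw [← ENNReal.tsum_geometric]
  refine tsum_ite_comp_le (f := fun k => k + c - m) (P := fun k => m ≤ k + c) ?_ _
  intro a ha b hb hab
  have ha' : m ≤ a + c := ha
  have hb' : m ≤ b + c := hb
  have : a + c - m = b + c - m := hab
  omega

theorem tsum_decay_right_le (ρ : ℝ≥0∞) (c k : ℕ) : ∑' m, decay ρ c k m ≤ (1 - ρ)⁻¹ := by
  rw [← ENNReal.tsum_geometric]
  refine tsum_ite_comp_le (f := fun m => k + c - m) (P := fun m => m ≤ k + c) ?_ _
  intro a ha b hb hab
  have ha' : a ≤ k + c := ha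
  have hb' : b ≤ k + c := hb
  have : k + c - a = k + c - b := hab
  omega

theorem decay_rpow (ρ : ℝ≥0∞) (c k m : ℕ) {q : ℝ} (hq : 0 < q) :
    decay ρ c k m ^ q = decay (ρ ^ q) c k m := by
  unfold decay
  split_ifs
  · rw [← ENNReal.rpow_natCast, ← ENNReal.rpow_mul, ← ENNReal.rpow_natCast, ← ENNReal.rpow_mul,
      mul_comm]
  · exact ENNReal.zero_rpow_of_pos hq

theorem inv_one_sub_ne_top {ρ : ℝ≥0∞} (hρ : ρ < 1) : (1 - ρ)⁻¹ ≠ ∞ := by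
  simpa [tsub_eq_zero_iff_le] using hρ

/-- Half of the decay is spent on the geometric series and half is kept in the supremum. A supremum
is below every ℓ^e norm, so no case distinction e ≤ 1 or e > 1 arises later. -/
theorem tsum_decay_mul_le (ρ : ℝ≥0∞) (c m : ℕ) (e : ℕ → ℝ≥0∞) :
    ∑' k, decay ρ c k m * e k ≤
      (1 - ρ ^ (1 / 2 : ℝ))⁻¹ * ⨆ k, decay (ρ ^ (1 / 2 : ℝ)) c k m * e k := by
  have hsq : ∀ k, decay ρ c k m =
      decay (ρ ^ (1 / 2 : ℝ)) c k m * decay (ρ ^ (1 / 2 : ℝ)) c k m := fun k => by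
    have : decay ρ c k m = decay (ρ ^ (1 / 2 : ℝ)) c k m ^ (2 : ℝ) := by
      rw [decay_rpow _ _ _ _ (by norm_num), ← ENNReal.rpow_mul]; norm_num
    rw [this, ENNReal.rpow_two, sq]
  calc ∑' k, decay ρ c k m * e k
      ≤ ∑' k, decay (ρ ^ (1 / 2 : ℝ)) c k m *
        ⨆ k, decay (ρ ^ (1 / 2 : ℝ)) c k m * e k := by
        refine ENNReal.tsum_le_tsum fun k => ?_
        rw [hsq, mul_assoc]
        gcongr
        exact le_iSup (fun k => decay (ρ ^ (1 / 2 : ℝ)) c k m * e k) k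
    _ ≤ _ := by
        rw [ENNReal.tsum_mul_right]
        gcongr
        exact tsum_decay_left_le _ _ _

/-- To be used with ratio 2^(s-1). At s = 1 the ratio is 1 and only the supremum survives. -/
theorem exists_lqNorm_geometric_le {q ρ : ℝ≥0∞} (hq : 0 < q) (hρ : ρ < 1 ∨ (ρ ≤ 1 ∧ q = ∞)) :
    ∃ C : ℝ≥0∞, C ≠ ∞ ∧ ∀ (n : ℕ) (g : ℝ≥0∞),
      lqNorm q (fun m => if n ≤ m then ρ ^ (m - n) * g else 0) ≤ C * g := by
  by_cases h : q = ∞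
  · subst h
    have hρ1 : ρ ≤ 1 := by rcases hρ with h | h; exacts [h.le, h.1]
    refine ⟨1, by simp, fun n g => ?_⟩
    rw [lqNorm_top]
    refine iSup_le fun m => ?_
    split_ifs
    · gcongr; exact pow_le_one' hρ1 _
    · exact zero_le
  · have hq' := ENNReal.toReal_pos hq.ne' h
    have hρ1 : ρ < 1 := by rcases hρ with h1 | h1; exacts [h1, absurd h1.2 h]
    refine ⟨((1 - ρ ^ q.toReal)⁻¹) ^ (1 / q.toReal), ENNReal.rpow_ne_top_of_nonneg (by positivity)
      (inv_one_sub_ne_top (ENNReal.rpow_lt_one hρ1 hq')), fun n g => ?_⟩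
    rw [lqNorm_of_ne_top h]
    conv_rhs => rw [← ENNReal.rpow_one_div_rpow hq' g]
    rw [← ENNReal.mul_rpow_of_nonneg _ _ (by positivity)]
    refine ENNReal.rpow_le_rpow ?_ (by positivity)
    rw [← ENNReal.tsum_geometric, ← ENNReal.tsum_mul_right]
    refine le_trans (le_of_eq (tsum_congr fun m => ?_))
      (tsum_ite_comp_le (f := fun m => m - n) (P := fun m => n ≤ m) ?_
        (fun j => (ρ ^ q.toReal) ^ j * g ^ q.toReal))
    · split_ifs
      · rw [ENNReal.mul_rpow_of_nonneg _ _ hq'.le, ← ENNReal.rpow_natCast, ← ENNReal.rpow_mul,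
          ← ENNReal.rpow_natCast, ← ENNReal.rpow_mul, mul_comm q.toReal]
      · exact ENNReal.zero_rpow_of_pos hq'
    · intro a ha b hb hab
      have ha' : n ≤ a := ha
      have hb' : n ≤ b := hb
      have : a - n = b - n := hab
      omega

/-- Bound of `L^p(ℓ^q)` type for decaying sums of `r`-averages over coarser scales. -/
theorem _root_.IsAveragingFamily.exists_lintegral_lqNorm_decay_le {Z : Type*} [MeasurableSpace Z]
    {μ : Measure Z} [IsFiniteMeasure μ] {K : ℕ → Z → Z → ℝ≥0∞} {N : ℝ≥0∞}
    (hK : IsAveragingFamily μ K N) {r p : ℝ} {q : ℝ≥0∞} (hr : 0 < r) (hrp : r < p)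
    (hrq : ENNReal.ofReal r < q) {ρ : ℝ≥0∞} (hρ : ρ < 1) (c : ℕ) :
    ∃ C : ℝ≥0∞, C ≠ ∞ ∧ ∀ G : ℕ → Z → ℝ≥0∞, (∀ k, Measurable (G k)) →
      ∫⁻ ξ, lqNorm q (fun m => ∑' k, decay ρ c k m *
        kernelOp μ (K m) (fun η => G k η ^ r) ξ ^ (1 / r)) ^ p ∂μ ≤
        C * ∫⁻ ξ, lqNorm q (fun k => G k ξ) ^ p ∂μ := by
  have hp0 : 0 < p := hr.trans hrp
  set σ := ρ ^ (1 / 2 : ℝ) with hσ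
  have hσ1 : σ < 1 := ENNReal.rpow_lt_one hρ (by norm_num)
  have hpr : 1 < p / r := by rwa [one_lt_div hr]
  by_cases h : q = ∞
  · subst h
    obtain ⟨C, hC, hmax⟩ := hK.maximal (p / r) hpr
    have hW := inv_one_sub_ne_top hρ
    refine ⟨((1 - ρ)⁻¹) ^ p * C, ENNReal.mul_ne_top (ENNReal.rpow_ne_top_of_nonneg hp0.le hW) hC,
      fun G hG => ?_⟩
    -- For q = ∞ all the G_k are replaced by their supremum, and the scalar maximal inequality in
    -- L^(p/r) suffices.
    set S : Z → ℝ≥0∞ := fun ξ => ⨆ k, G k ξ with hS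
    have hSm : Measurable S := Measurable.iSup hG
    set M : Z → ℝ≥0∞ := fun ξ => ⨆ m, kernelOp μ (K m) (fun η => S η ^ r) ξ with hM
    have hMm : Measurable M := Measurable.iSup fun m => hK.measurable_kernelOp m (hSm.pow_const r)
    have hpt : ∀ ξ, lqNorm ∞ (fun m => ∑' k, decay ρ c k m *
        kernelOp μ (K m) (fun η => G k η ^ r) ξ ^ (1 / r)) ≤ (1 - ρ)⁻¹ * M ξ ^ (1 / r) := by
      intro ξ
      rw [lqNorm_top]
      refine iSup_le fun m => ?_
      calc _ ≤ ∑' k, decay ρ c k m * M ξ ^ (1 / r) := by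
            refine ENNReal.tsum_le_tsum fun k => mul_le_mul_right (ENNReal.rpow_le_rpow ?_
              (by positivity)) _
            refine le_trans (lintegral_mono fun η => ?_)
              (le_iSup (fun m => kernelOp μ (K m) (fun η => S η ^ r) ξ) m)
            exact mul_le_mul_right (ENNReal.rpow_le_rpow (le_iSup (fun k => G k η) k) hr.le) _
        _ ≤ _ := by
            rw [ENNReal.tsum_mul_right]
            gcongr
            exact tsum_decay_left_le _ _ _
    calc _ ≤ ∫⁻ ξ, ((1 - ρ)⁻¹) ^ p * M ξ ^ (p / r) ∂μ := by
          refine lintegral_mono fun ξ => (ENNReal.rpow_le_rpow (hpt ξ) hp0.le).trans_eq ?_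
          rw [ENNReal.mul_rpow_of_nonneg _ _ hp0.le, ← ENNReal.rpow_mul]
          congr 2; ring
      _ = ((1 - ρ)⁻¹) ^ p * ∫⁻ ξ, M ξ ^ (p / r) ∂μ := lintegral_const_mul _ (hMm.pow_const _)
      _ ≤ ((1 - ρ)⁻¹) ^ p * (C * ∫⁻ ξ, (S ξ ^ r) ^ (p / r) ∂μ) := by
          gcongr
          exact hmax _ (hSm.pow_const r)
      _ = _ := by
          rw [mul_assoc]
          congr 2
          refine lintegral_congr fun ξ => ?_
          rw [lqNorm_top, ← ENNReal.rpow_mul, mul_div_cancel₀ _ hr.ne']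
  · have hq0 : 0 < q := (ENNReal.ofReal_pos.2 hr).trans hrq
    set e := q.toReal with he
    have he0 : 0 < e := ENNReal.toReal_pos hq0.ne' h
    have hre : r < e := by
      rwa [ENNReal.ofReal_lt_iff_lt_toReal hr.le h] at hrq
    have her : 1 < e / r := by rwa [one_lt_div hr]
    set W := (1 - σ)⁻¹ with hW
    have hWt : W ≠ ∞ := inv_one_sub_ne_top hσ1
    -- The inequality is used for G_k^r with exponents p/r and e/r, both above 1. The weights are
    -- e-th powers of the half of the decay kept by `tsum_decay_mul_le`.
    obtain ⟨C, hC, hfs⟩ := hK.fefferman_stein (w := fun k m => decay (σ ^ e) c k m)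
      (inv_one_sub_ne_top (ENNReal.rpow_lt_one hσ1 he0)) (fun k => tsum_decay_right_le _ _ _)
      hpr her
    refine ⟨(W ^ e) ^ (p / e) * C, ENNReal.mul_ne_top (ENNReal.rpow_ne_top_of_nonneg
      (by positivity) (ENNReal.rpow_ne_top_of_nonneg he0.le hWt)) hC, fun G hG => ?_⟩
    have hGr : ∀ k, Measurable fun η => G k η ^ r := fun k => (hG k).pow_const r
    have hexp : p / r / (e / r) = p / e := by field_simp
    have hfsG := hfs (fun k η => G k η ^ r) hGr
    simp_rw [hexp, ← ENNReal.rpow_mul, mul_div_cancel₀ _ hr.ne'] at hfsG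
    simp_rw [lqNorm_of_ne_top h, ← he, ← ENNReal.rpow_mul, one_div_mul_eq_div]
    calc _ ≤ ∫⁻ ξ, (W ^ e * ∑' k, ∑' m, decay (σ ^ e) c k m *
          kernelOp μ (K m) (fun η => G k η ^ r) ξ ^ (e / r)) ^ (p / e) ∂μ := by
          refine lintegral_mono fun ξ => ENNReal.rpow_le_rpow ?_ (by positivity)
          rw [ENNReal.tsum_comm, ← ENNReal.tsum_mul_left]
          refine ENNReal.tsum_le_tsum fun m => ?_
          refine (ENNReal.rpow_le_rpow (tsum_decay_mul_le ρ c m _) he0.le).trans ?_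
          rw [ENNReal.mul_rpow_of_nonneg _ _ he0.le]
          gcongr
          have h1 : (⨆ k, decay σ c k m * kernelOp μ (K m) (fun η => G k η ^ r) ξ ^ (1 / r)) ≤
              (∑' k, decay (σ ^ e) c k m *
                kernelOp μ (K m) (fun η => G k η ^ r) ξ ^ (e / r)) ^ (1 / e) := by
            refine iSup_le fun k => ?_
            calc _ = ((decay σ c k m *
                  kernelOp μ (K m) (fun η => G k η ^ r) ξ ^ (1 / r)) ^ e) ^ (1 / e) :=
                  (ENNReal.rpow_one_div_rpow he0 _).symm
              _ = (decay (σ ^ e) c k m *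
                  kernelOp μ (K m) (fun η => G k η ^ r) ξ ^ (e / r)) ^ (1 / e) := by
                  rw [ENNReal.mul_rpow_of_nonneg _ _ he0.le, decay_rpow _ _ _ _ he0,
                    ← ENNReal.rpow_mul _ (1 / r) e, one_div_mul_eq_div]
              _ ≤ _ := ENNReal.rpow_le_rpow (ENNReal.le_tsum k) (by positivity)
          refine (ENNReal.rpow_le_rpow h1 he0.le).trans_eq ?_
          rw [← ENNReal.rpow_mul, one_div_mul_cancel he0.ne', ENNReal.rpow_one]
      _ = (W ^ e) ^ (p / e) * ∫⁻ ξ, (∑' k, ∑' m, decay (σ ^ e) c k m *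
          kernelOp μ (K m) (fun η => G k η ^ r) ξ ^ (e / r)) ^ (p / e) ∂μ := by
          simp_rw [ENNReal.mul_rpow_of_nonneg _ _ (show 0 ≤ p / e by positivity)]
          exact lintegral_const_mul _ ((hK.measurable_double_tsum _ hGr _).pow_const _)
      _ ≤ _ := by
          rw [mul_assoc, ENNReal.rpow_mul]
          gcongr

end HyperbolicFilling

/-- Subadditivity of the r-th power for r ≤ 1: the ℓ^1 norm is at most the ℓ^r quasi-norm. -/
theorem ENNReal.tsum_le_tsum_rpow_rpow {ι : Type*} (t : ι → ℝ≥0∞) {r : ℝ} (hr : 0 < r)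
    (hr1 : r ≤ 1) : ∑' i, t i ≤ (∑' i, t i ^ r) ^ (1 / r) := by
  classical
  rw [ENNReal.tsum_eq_iSup_sum]
  refine iSup_le fun F => ?_
  have h1 : (∑ i ∈ F, t i) ^ r ≤ ∑ i ∈ F, t i ^ r := by
    induction F using Finset.induction_on with
    | empty => simp [ENNReal.zero_rpow_of_pos hr]
    | insert i F hi ih =>
      rw [Finset.sum_insert hi, Finset.sum_insert hi]
      exact (ENNReal.rpow_add_le_add_rpow _ _ hr.le hr1).trans (by gcongr)
  calc ∑ i ∈ F, t i = ((∑ i ∈ F, t i) ^ r) ^ (1 / r) := (ENNReal.rpow_one_div_rpow hr _).symm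
    _ ≤ _ := ENNReal.rpow_le_rpow (h1.trans (ENNReal.sum_le_tsum F)) (by positivity)

/-! ### Level sums and the averaging kernels of the filling -/

namespace HyperbolicFilling

variable {Z : Type*} [MetricSpace Z]

/-- The sum of `a x` over the vertices `x` of level `m` with `ξ ∈ B(x)`. -/
def levelSum (X : HyperbolicFilling Z) (a : X.Vertex → ℝ≥0∞) (m : ℕ) (ξ : Z) : ℝ≥0∞ :=
  ∑' x : X.net m, (X.ball ⟨m, x⟩).indicator (fun _ => a ⟨m, x⟩) ξ

theorem le_levelSum (X : HyperbolicFilling Z) (a : X.Vertex → ℝ≥0∞) {x : X.Vertex} {ξ : Z}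
    (hξ : ξ ∈ X.ball x) : a x ≤ X.levelSum a x.1 ξ := by
  refine le_trans (le_of_eq ?_) (ENNReal.le_tsum x.2)
  exact (Set.indicator_of_mem (s := X.ball ⟨x.1, x.2⟩) hξ (fun _ => a x)).symm

theorem levelSum_const_mul (X : HyperbolicFilling Z) (a : X.Vertex → ℝ≥0∞) (c : ℕ → ℝ≥0∞) (m : ℕ)
    (ξ : Z) : X.levelSum (fun x => c x.1 * a x) m ξ = c m * X.levelSum a m ξ := by
  unfold levelSum
  rw [← ENNReal.tsum_mul_left]
  refine tsum_congr fun x => ?_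
  by_cases hξ : ξ ∈ X.ball ⟨m, x⟩ <;> simp [hξ]

variable [MeasurableSpace Z]

/-- The symmetric kernel of the averages over the dilated balls of level `m`. -/
def kernel (X : HyperbolicFilling Z) (μ : Measure Z) (R : ℝ) (m : ℕ) (ξ η : Z) : ℝ≥0∞ :=
  ∑' x : X.net m, (μ (X.bigBall R ⟨m, x⟩))⁻¹ * (X.bigBall R ⟨m, x⟩).indicator 1 ξ *
    (X.bigBall R ⟨m, x⟩).indicator 1 η

variable [BorelSpace Z] {μ : Measure Z} {Q : ℝ}

theorem measurable_indicator_bigBall (X : HyperbolicFilling Z) (R : ℝ) (x : X.Vertex) :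
    Measurable ((X.bigBall R x).indicator (1 : Z → ℝ≥0∞)) :=
  measurable_one.indicator (X.measurableSet_bigBall R x)

variable [BoundedSpace Z]

theorem countable_vertex (X : HyperbolicFilling Z) (hμ : IsDoublingOfDimension μ Q) :
    Countable X.Vertex := by
  have := X.finite_net hμ
  infer_instance

theorem kernelOp_kernel (X : HyperbolicFilling Z) (hμ : IsDoublingOfDimension μ Q) (R : ℝ) (m : ℕ)
    {h : Z → ℝ≥0∞} (hh : Measurable h) (ξ : Z) :
    kernelOp μ (X.kernel μ R m) h ξ = ∑' x : X.net m, (X.bigBall R ⟨m, x⟩).indicator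
      (fun _ => (μ (X.bigBall R ⟨m, x⟩))⁻¹ * ∫⁻ η in X.bigBall R ⟨m, x⟩, h η ∂μ) ξ := by
  have := X.finite_net hμ m
  unfold kernelOp kernel
  simp_rw [← ENNReal.tsum_mul_right]
  rw [lintegral_tsum fun x => (show Measurable fun η => (μ (X.bigBall R ⟨m, x⟩))⁻¹ *
    (X.bigBall R ⟨m, x⟩).indicator 1 ξ * (X.bigBall R ⟨m, x⟩).indicator 1 η * h η from
    ((X.measurable_indicator_bigBall R ⟨m, x⟩).const_mul _).mul hh).aemeasurable]
  refine tsum_congr fun x => ?_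
  have h1 : ∀ η, (X.bigBall R ⟨m, x⟩).indicator (1 : Z → ℝ≥0∞) η * h η =
      (X.bigBall R ⟨m, x⟩).indicator h η := fun η => by
    by_cases hη : η ∈ X.bigBall R ⟨m, x⟩ <;> simp [hη]
  simp_rw [mul_assoc, h1]
  have hm := hh.indicator (X.measurableSet_bigBall R ⟨m, x⟩)
  rw [lintegral_const_mul _ (hm.const_mul _), lintegral_const_mul _ hm,
    lintegral_indicator (X.measurableSet_bigBall R ⟨m, x⟩)]
  by_cases hξ : ξ ∈ X.bigBall R ⟨m, x⟩ <;> simp [hξ]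

theorem average_le_kernelOp (X : HyperbolicFilling Z) (hμ : IsDoublingOfDimension μ Q) (R : ℝ)
    {h : Z → ℝ≥0∞} (hh : Measurable h) (x : X.Vertex) {ξ : Z} (hξ : ξ ∈ X.bigBall R x) :
    (μ (X.bigBall R x))⁻¹ * ∫⁻ η in X.bigBall R x, h η ∂μ ≤
      kernelOp μ (X.kernel μ R x.1) h ξ := by
  rw [X.kernelOp_kernel hμ R x.1 hh]
  refine le_trans (le_of_eq ?_) (ENNReal.le_tsum x.2)
  exact (Set.indicator_of_mem (s := X.bigBall R ⟨x.1, x.2⟩) hξ (fun _ => (μ (X.bigBall R x))⁻¹ *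
    ∫⁻ η in X.bigBall R x, h η ∂μ)).symm

/-- Bounded overlap N bounds the total mass, and it bounds every average by N times the maximal
function over the countable family of all dilated balls. -/
theorem exists_isAveragingFamily (X : HyperbolicFilling Z) (hμ : IsDoublingOfDimension μ Q)
    {R : ℝ} (hR : 0 < R) : ∃ N : ℝ≥0∞, IsAveragingFamily μ (X.kernel μ R) N := by
  have := X.isFiniteMeasure hμ
  have := X.countable_vertex hμ
  have := X.finite_net hμ
  obtain ⟨N, hN⟩ := X.exists_encard_bigBall_le hμ R
  refine ⟨N, ?_, ?_, ?_, by simp, ?_⟩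
  · intro m
    refine Measurable.tsum fun x => ?_
    exact (((X.measurable_indicator_bigBall R ⟨m, x⟩).comp measurable_fst).const_mul _).mul
      ((X.measurable_indicator_bigBall R ⟨m, x⟩).comp measurable_snd)
  · intro m ξ η
    exact tsum_congr fun x => by ring
  · intro m ξ
    have h1 := X.kernelOp_kernel hμ R m (measurable_const (a := (1 : ℝ≥0∞))) ξ
    simp only [kernelOp, mul_one] at h1
    rw [h1, ← mul_one (N : ℝ≥0∞)]
    refine ENNReal.tsum_le_mul_of_encard_le (hN m ξ)
      (fun x hx => Set.indicator_of_notMem (s := X.bigBall R ⟨m, x⟩) hx _) fun x hx => ?_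
    refine (Set.indicator_le_self' (fun _ _ => zero_le) ξ).trans ?_
    rw [lintegral_one, Measure.restrict_apply_univ]
    exact ENNReal.inv_mul_le_one _
  · intro t ht
    obtain ⟨C₀, -, hvol⟩ := hμ.exists_measure_closedBall_le
    obtain ⟨C, hC, hmax⟩ := ballMaximal_strong_type (μ := μ) (c := fun x : X.Vertex => (x.2 : Z))
      (ρ := fun x => R * (1 / 2 : ℝ) ^ x.1) (R := R)
      (fun x => mul_le_of_le_one_right hR.le (pow_le_one₀ (by norm_num) (by norm_num)))
      -- A closed 5-fold enlargement fits in the open 6-fold one.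
      (A := ENNReal.ofReal (C₀ * 6 ^ Q)) ENNReal.ofReal_ne_top
      (fun x => by
        have hpos : 0 < R * (1 / 2 : ℝ) ^ x.1 := by positivity
        refine (hvol (x.2 : Z) (x.2 : Z) _ _ 6 hpos (by norm_num) ?_).trans ?_
        · rw [dist_self]; linarith
        · gcongr; exact Metric.ball_subset_closedBall) ht
    refine ⟨(N : ℝ≥0∞) ^ t * C, ENNReal.mul_ne_top (ENNReal.rpow_ne_top_of_nonneg (by linarith)
      (by simp)) hC, fun h hh => ?_⟩
    set M := ballMaximal μ (fun x : X.Vertex => (x.2 : Z)) (fun x => R * (1 / 2 : ℝ) ^ x.1) h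
    have hpt : ∀ ξ, (⨆ m, kernelOp μ (X.kernel μ R m) h ξ) ≤ N * M ξ := by
      intro ξ
      refine iSup_le fun m => ?_
      rw [X.kernelOp_kernel hμ R m hh]
      refine ENNReal.tsum_le_mul_of_encard_le (hN m ξ)
        (fun x hx => Set.indicator_of_notMem (s := X.bigBall R ⟨m, x⟩) hx _) fun x hx => ?_
      exact le_iSup (fun x : X.Vertex => (X.bigBall R x).indicator
        (fun _ => (μ (X.bigBall R x))⁻¹ * ∫⁻ η in X.bigBall R x, h η ∂μ) ξ) ⟨m, x⟩
    calc _ ≤ ∫⁻ ξ, (N : ℝ≥0∞) ^ t * M ξ ^ t ∂μ := by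
          refine lintegral_mono fun ξ =>
            (ENNReal.rpow_le_rpow (hpt ξ) (by linarith)).trans_eq ?_
          exact ENNReal.mul_rpow_of_nonneg _ _ (by linarith)
      _ = (N : ℝ≥0∞) ^ t * ∫⁻ ξ, M ξ ^ t ∂μ :=
          lintegral_const_mul _ ((measurable_ballMaximal h).pow_const t)
      _ ≤ _ := by
          rw [mul_assoc]
          gcongr
          exact hmax h hh

theorem measurable_levelSum (X : HyperbolicFilling Z) (hμ : IsDoublingOfDimension μ Q)
    (a : X.Vertex → ℝ≥0∞) (m : ℕ) : Measurable (X.levelSum a m) := by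
  have := X.finite_net hμ m
  exact Measurable.tsum fun x => measurable_const.indicator (X.measurableSet_ball _)

theorem exists_levelSum_rpow_le (X : HyperbolicFilling Z) (hμ : IsDoublingOfDimension μ Q) :
    ∃ N : ℕ, ∀ {r : ℝ}, 0 ≤ r → ∀ (a : X.Vertex → ℝ≥0∞) (m : ℕ) (ξ : Z),
      X.levelSum (fun x => a x ^ r) m ξ ≤ N * X.levelSum a m ξ ^ r := by
  obtain ⟨N, hN⟩ := X.exists_encard_cone_le hμ
  refine ⟨N, fun hr a m ξ => ENNReal.tsum_le_mul_of_encard_le (hN m ξ)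
    (fun x hx => Set.indicator_of_notMem (s := X.ball ⟨m, x⟩) hx _) fun x hx => ?_⟩
  rw [Set.indicator_of_mem (s := X.ball ⟨m, x⟩) hx]
  exact ENNReal.rpow_le_rpow (X.le_levelSum a (x := ⟨m, x⟩) hx) hr

theorem lintegral_levelSum (X : HyperbolicFilling Z) (hμ : IsDoublingOfDimension μ Q)
    (a : X.Vertex → ℝ≥0∞) (m : ℕ) (S : Set Z) : ∫⁻ ξ in S, X.levelSum a m ξ ∂μ =
      ∑' x : X.net m, a ⟨m, x⟩ * μ (X.ball ⟨m, x⟩ ∩ S) := by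
  have := X.finite_net hμ m
  unfold levelSum
  rw [lintegral_tsum fun x =>
    (measurable_const.indicator (X.measurableSet_ball ⟨m, x⟩)).aemeasurable]
  refine tsum_congr fun x => ?_
  rw [lintegral_indicator_const (X.measurableSet_ball _),
    Measure.restrict_apply (X.measurableSet_ball _)]

/-- With `exists_lqNorm_levelSum_le` for the converse direction, bounded overlap allows sequences
over the cone at ξ to be exchanged for sequences over the levels, whose index set no longer depends
on ξ. -/
theorem exists_lqNorm_cone_le (X : HyperbolicFilling Z) (hμ : IsDoublingOfDimension μ Q)
    {q : ℝ≥0∞} (hq : 0 < q) : ∃ C : ℝ≥0∞, C ≠ ∞ ∧ ∀ (ξ : Z) (b : X.cone ξ → ℝ≥0∞)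
      (D : ℕ → ℝ≥0∞), (∀ x : X.cone ξ, b x ≤ D (X.level x)) → lqNorm q b ≤ C * lqNorm q D := by
  by_cases h : q = ∞
  · subst h
    refine ⟨1, by simp, fun ξ b D hb => ?_⟩
    rw [lqNorm_top, lqNorm_top, one_mul]
    exact iSup_le fun x => (hb x).trans (le_iSup D _)
  · have hq' := ENNReal.toReal_pos hq.ne' h
    obtain ⟨N, hN⟩ := X.exists_encard_cone_le hμ
    refine ⟨(N : ℝ≥0∞) ^ (1 / q.toReal), ENNReal.rpow_ne_top_of_nonneg (by positivity) (by simp),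
      fun ξ b D hb => ?_⟩
    refine (lqNorm_mono hb).trans ?_
    rw [lqNorm_of_ne_top h, lqNorm_of_ne_top h, ← ENNReal.mul_rpow_of_nonneg _ _ (by positivity)]
    refine ENNReal.rpow_le_rpow ?_ (by positivity)
    rw [tsum_subtype (X.cone ξ) fun x => D (X.level x) ^ q.toReal, ENNReal.tsum_sigma',
      ← ENNReal.tsum_mul_left]
    refine ENNReal.tsum_le_tsum fun m => ENNReal.tsum_le_mul_of_encard_le (hN m ξ)
      (fun x hx => Set.indicator_of_notMem (s := X.cone ξ) hx _) fun x hx => ?_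
    exact (Set.indicator_of_mem (s := X.cone ξ) hx _).le

theorem exists_lqNorm_levelSum_le (X : HyperbolicFilling Z) (hμ : IsDoublingOfDimension μ Q)
    {q : ℝ≥0∞} (hq : 0 < q) : ∃ C : ℝ≥0∞, C ≠ ∞ ∧ ∀ (ξ : Z) (b : X.Vertex → ℝ≥0∞),
      lqNorm q (fun m => X.levelSum b m ξ) ≤ C * lqNorm q (fun x : X.cone ξ => b x) := by
  obtain ⟨N, hN⟩ := X.exists_encard_cone_le hμ
  by_cases h : q = ∞
  · subst h
    refine ⟨N, by simp, fun ξ b => ?_⟩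
    rw [lqNorm_top, lqNorm_top]
    refine iSup_le fun m => ENNReal.tsum_le_mul_of_encard_le (hN m ξ)
      (fun x hx => Set.indicator_of_notMem (s := X.ball ⟨m, x⟩) hx _) fun x hx => ?_
    rw [Set.indicator_of_mem (s := X.ball ⟨m, x⟩) hx]
    exact le_iSup (fun x : X.cone ξ => b x) ⟨⟨m, x⟩, hx⟩
  · have hq' := ENNReal.toReal_pos hq.ne' h
    refine ⟨N, by simp, fun ξ b => ?_⟩
    conv_rhs => rw [← ENNReal.rpow_one_div_rpow hq' (N : ℝ≥0∞)]
    rw [lqNorm_of_ne_top h, lqNorm_of_ne_top h, ← ENNReal.mul_rpow_of_nonneg _ _ (by positivity)]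
    refine ENNReal.rpow_le_rpow ?_ (by positivity)
    rw [tsum_subtype (X.cone ξ) fun x => b x ^ q.toReal, ENNReal.tsum_sigma',
      ← ENNReal.tsum_mul_left]
    refine ENNReal.tsum_le_tsum fun m => ?_
    have h1 : X.levelSum b m ξ ≤ N * (∑' x : X.net m, (X.cone ξ).indicator
        (fun x => b x ^ q.toReal) ⟨m, x⟩) ^ (1 / q.toReal) := by
      refine ENNReal.tsum_le_mul_of_encard_le (hN m ξ)
        (fun x hx => Set.indicator_of_notMem (s := X.ball ⟨m, x⟩) hx _) fun x hx => ?_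
      rw [Set.indicator_of_mem (s := X.ball ⟨m, x⟩) hx, ← ENNReal.rpow_one_div_rpow hq' (b ⟨m, x⟩)]
      refine ENNReal.rpow_le_rpow ?_ (by positivity)
      refine le_trans (le_of_eq ?_) (ENNReal.le_tsum x)
      exact (Set.indicator_of_mem (s := X.cone ξ) hx fun x => b x ^ q.toReal).symm
    refine (ENNReal.rpow_le_rpow h1 hq'.le).trans_eq ?_
    rw [ENNReal.mul_rpow_of_nonneg _ _ hq'.le, ← ENNReal.rpow_mul _ (1 / q.toReal),
      one_div_mul_cancel hq'.ne', ENNReal.rpow_one]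

/-- An average at scale `|x|` of a function that lives at a finer scale `k` is controlled by its
`r`-average, with a loss that grows geometrically in `k - |x|`. -/
theorem exists_lintegral_levelSum_le (X : HyperbolicFilling Z) (hμ : IsDoublingOfDimension μ Q)
    {r : ℝ} (hr : 0 < r) (hr1 : r ≤ 1) (c : ℕ) {R R' : ℝ}
    (hR'0 : 0 < R') (hR' : R + 2 * (Metric.diam (Set.univ : Set Z) + 1) * 2 ^ c ≤ R') :
    ∃ C : ℝ≥0∞, C ≠ ∞ ∧ ∀ (a : X.Vertex → ℝ≥0∞) (x : X.Vertex) (k : ℕ), x.1 ≤ k + c →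
      ∫⁻ ξ in X.bigBall R x, X.levelSum a k ξ ∂μ ≤
        C * ENNReal.ofReal (2 ^ (((k : ℝ) - x.1) * Q)) ^ (1 / r - 1) * μ (X.bigBall R' x) *
        ((μ (X.bigBall R' x))⁻¹ * ∫⁻ ξ in X.bigBall R' x, X.levelSum a k ξ ^ r ∂μ) ^ (1 / r) := by
  have hfin := X.isFiniteMeasure hμ
  obtain ⟨C₁, hC₁, hvol⟩ := X.exists_measure_bigBall_le hμ R' c
  obtain ⟨N, hN⟩ := X.exists_levelSum_rpow_le hμ
  have hr1' : 0 ≤ 1 - r := by linarith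
  have hrr : 0 ≤ 1 / r - 1 := by rw [sub_nonneg, le_div_iff₀ hr]; linarith
  refine ⟨C₁ ^ (1 / r - 1) * (N : ℝ≥0∞) ^ (1 / r), ENNReal.mul_ne_top
    (ENNReal.rpow_ne_top_of_nonneg hrr hC₁) (ENNReal.rpow_ne_top_of_nonneg (by positivity)
    (by simp)), fun a x k hk => ?_⟩
  set D := Metric.diam (Set.univ : Set Z) + 1 with hD
  have hD0 : 0 < D := by linarith [Metric.diam_nonneg (s := (Set.univ : Set Z))]
  set S := X.bigBall R x with hS
  set S' := X.bigBall R' x with hS'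
  set E := ENNReal.ofReal (2 ^ (((k : ℝ) - x.1) * Q)) with hE
  have hsub : ∀ z : X.net k, (X.ball ⟨k, z⟩ ∩ S).Nonempty → X.ball ⟨k, z⟩ ⊆ S' := by
    rintro z ⟨ζ, hζz, hζ⟩ η hη
    have e1 := X.ball_subset_bigBall le_rfl _ hζz
    have e2 := X.ball_subset_bigBall le_rfl _ hη
    simp only [hS, hS', bigBall, Metric.mem_closedBall] at e1 e2 hζ ⊢
    have t1 : dist η (x.2 : Z) ≤ dist η (z : Z) + dist ζ (z : Z) + dist ζ (x.2 : Z) := by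
      have := dist_triangle4 η (z : Z) ζ (x.2 : Z)
      rwa [dist_comm (z : Z) ζ] at this
    have hp : (1 / 2 : ℝ) ^ k ≤ 2 ^ c * (1 / 2) ^ x.1 := by
      have h1 : (1 / 2 : ℝ) ^ (k + c) ≤ (1 / 2) ^ x.1 :=
        pow_le_pow_of_le_one (by norm_num) (by norm_num) hk
      have h2 : (2 : ℝ) ^ c * (1 / 2) ^ c = 1 := by rw [← mul_pow]; norm_num
      calc (1 / 2 : ℝ) ^ k = 2 ^ c * (1 / 2) ^ (k + c) := by
            rw [pow_add, mul_comm, mul_assoc, mul_comm _ ((2 : ℝ) ^ c), h2, mul_one]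
        _ ≤ _ := by gcongr
    calc dist η (x.2 : Z) ≤ D * (1 / 2) ^ k + D * (1 / 2) ^ k + R * (1 / 2) ^ x.1 := by linarith
      _ ≤ D * (2 ^ c * (1 / 2) ^ x.1) + D * (2 ^ c * (1 / 2) ^ x.1) + R * (1 / 2) ^ x.1 := by
          gcongr
      _ = (R + 2 * D * 2 ^ c) * (1 / 2) ^ x.1 := by ring
      _ ≤ R' * (1 / 2) ^ x.1 := by gcongr
  classical
  set t : X.net k → ℝ≥0∞ := fun z =>
    if (X.ball ⟨k, z⟩ ∩ S).Nonempty then a ⟨k, z⟩ * μ (X.ball ⟨k, z⟩) else 0 with ht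
  have hE0 : E ≠ 0 := by rw [hE]; simp; positivity
  have hEt : E ≠ ∞ := ENNReal.ofReal_ne_top
  set V := μ S' with hV
  have hVt : V ≠ ∞ := measure_ne_top _ _
  have hV0 : V ≠ 0 := ((hμ.ball_pos (x.2 : Z) _ (by positivity : 0 < R' * (1 / 2) ^ x.1)).trans_le
    (measure_mono Metric.ball_subset_closedBall)).ne'
  -- The source of the loss: μ(B)^r = μ(B)^(r-1) μ(B), and a ball of level k inside S' has volume at
  -- least V/(C₁E). For this t(z) carries the full volume of B(z), not just that of its part in S,
  -- and S is enlarged to S'.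
  have hterm : ∀ z, t z ^ r ≤ (C₁ * E * V⁻¹) ^ (1 - r) * (a ⟨k, z⟩ ^ r * μ (X.ball ⟨k, z⟩ ∩ S')) := by
    intro z
    rw [ht]
    simp only
    split_ifs with hz
    · have hzS := hsub z hz
      have hb0 := (X.measure_ball_pos hμ ⟨k, z⟩).ne'
      have hbt : μ (X.ball ⟨k, z⟩) ≠ ∞ := measure_ne_top _ _
      have hv := hvol x ⟨k, z⟩ hk (hzS (X.center_mem_ball ⟨k, z⟩))
      rw [Set.inter_eq_left.2 hzS, ENNReal.mul_rpow_of_nonneg _ _ hr.le]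
      have h1 : μ (X.ball ⟨k, z⟩) ^ r =
          (μ (X.ball ⟨k, z⟩))⁻¹ ^ (1 - r) * μ (X.ball ⟨k, z⟩) := by
        rw [← ENNReal.rpow_neg_one, ← ENNReal.rpow_mul]
        nth_rewrite 3 [← ENNReal.rpow_one (μ (X.ball ⟨k, z⟩))]
        rw [← ENNReal.rpow_add _ _ hb0 hbt]
        congr 1; ring
      have h2 : (μ (X.ball ⟨k, z⟩))⁻¹ ≤ C₁ * E * V⁻¹ := by
        rw [← div_eq_mul_inv, ENNReal.le_div_iff_mul_le (Or.inl hV0) (Or.inl hVt), mul_comm,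
          ← div_eq_mul_inv, ENNReal.div_le_iff_le_mul (Or.inl hb0) (Or.inl hbt)]
        exact hv
      rw [h1]
      calc a ⟨k, z⟩ ^ r * ((μ (X.ball ⟨k, z⟩))⁻¹ ^ (1 - r) * μ (X.ball ⟨k, z⟩))
          ≤ a ⟨k, z⟩ ^ r * ((C₁ * E * V⁻¹) ^ (1 - r) * μ (X.ball ⟨k, z⟩)) := by gcongr
        _ = _ := by ring
    · rw [ENNReal.zero_rpow_of_pos hr]; exact zero_le
  calc ∫⁻ ξ in S, X.levelSum a k ξ ∂μ ≤ ∑' z, t z := by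
        rw [X.lintegral_levelSum hμ]
        refine ENNReal.tsum_le_tsum fun z => ?_
        rw [ht]
        simp only
        split_ifs with hz
        · gcongr; exact Set.inter_subset_left
        · rw [Set.not_nonempty_iff_eq_empty.1 hz]; simp
    _ ≤ (∑' z, t z ^ r) ^ (1 / r) := ENNReal.tsum_le_tsum_rpow_rpow t hr hr1
    _ ≤ ((C₁ * E * V⁻¹) ^ (1 - r) * ∫⁻ ξ in S', N * X.levelSum a k ξ ^ r ∂μ) ^ (1 / r) := by
        refine ENNReal.rpow_le_rpow ?_ (by positivity)
        refine (ENNReal.tsum_le_tsum hterm).trans ?_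
        rw [ENNReal.tsum_mul_left]
        refine mul_le_mul_right ?_ _
        rw [← X.lintegral_levelSum hμ (fun x => a x ^ r) k S']
        exact lintegral_mono fun ξ => hN hr.le a k ξ
    _ = ((C₁ * E) ^ (1 - r) * N * V ^ r * (V⁻¹ * ∫⁻ ξ in S', X.levelSum a k ξ ^ r ∂μ)) ^ (1 / r) := by
        rw [lintegral_const_mul _ ((X.measurable_levelSum hμ a k).pow_const r),
          ENNReal.mul_rpow_of_nonneg _ _ hr1']
        have h1 : V⁻¹ ^ (1 - r) = V ^ r * V⁻¹ := by
          rw [← ENNReal.rpow_neg_one, ← ENNReal.rpow_mul, ← ENNReal.rpow_add _ _ hV0 hVt]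
          congr 1; ring
        rw [h1]
        congr 1
        ring
    _ = _ := by
        rw [ENNReal.mul_rpow_of_nonneg _ _ (by positivity : 0 ≤ 1 / r),
          ENNReal.mul_rpow_of_nonneg _ _ (by positivity : 0 ≤ 1 / r),
          ENNReal.mul_rpow_of_nonneg _ _ (by positivity : 0 ≤ 1 / r),
          ENNReal.rpow_one_div_rpow hr, ← ENNReal.rpow_mul,
          show (1 - r) * (1 / r) = 1 / r - 1 by field_simp,
          ENNReal.mul_rpow_of_nonneg _ _ hrr]
        ring

end HyperbolicFilling

/-! ### The discrete derivative, the operators T_n and telescoping -/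

namespace HyperbolicFilling

variable {Z : Type*} [MetricSpace Z]

theorem enorm_sub_le_normD (X : HyperbolicFilling Z) (u : X.Vertex → ℂ) {x y : X.Vertex}
    (h : X.graph.Adj x y) : ‖u y - u x‖ₑ ≤ X.normD u x := by
  unfold normD
  rw [← ENNReal.rpow_one_div_rpow (zero_lt_two (α := ℝ)) ‖u y - u x‖ₑ]
  refine ENNReal.rpow_le_rpow ?_ (by norm_num)
  exact ENNReal.le_tsum (f := fun y : X.graph.neighborSet x => ‖u y - u x‖ₑ ^ (2 : ℝ)) ⟨y, h⟩

theorem adj_of_mem_ball (X : HyperbolicFilling Z) {x y : X.Vertex} {ξ : Z} (hne : x ≠ y)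
    (h1 : x.1 ≤ y.1 + 1) (h2 : y.1 ≤ x.1 + 1) (hx : ξ ∈ X.ball x) (hy : ξ ∈ X.ball y) :
    X.graph.Adj x y :=
  ⟨hne, ⟨h1, h2⟩, ξ, hx, hy⟩

theorem enorm_sub_le_normD_of_mem (X : HyperbolicFilling Z) (u : X.Vertex → ℂ) {x y : X.Vertex}
    {ξ : Z} (h1 : x.1 ≤ y.1 + 1) (h2 : y.1 ≤ x.1 + 1) (hx : ξ ∈ X.ball x) (hy : ξ ∈ X.ball y) :
    ‖u y - u x‖ₑ ≤ X.normD u x := by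
  by_cases hne : x = y
  · subst hne; simp
  · exact X.enorm_sub_le_normD u (X.adj_of_mem_ball hne h1 h2 hx hy)

theorem LipschitzPartition.eq_zero_of_notMem {X : HyperbolicFilling Z} (ψ : X.LipschitzPartition)
    {x : X.Vertex} {ξ : Z} (h : ξ ∉ X.ball x) : ψ.toFun x ξ = 0 := by
  by_contra hne
  exact h (ψ.support_subset x hne)

section finite

variable {X : HyperbolicFilling Z} (ψ : X.LipschitzPartition) (n : ℕ) [Finite (X.net n)]

theorem LipschitzPartition.hasSum_T (u : X.Vertex → ℂ) (ξ : Z) :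
    HasSum (fun x : X.net n => u ⟨n, x⟩ * (ψ.toFun ⟨n, x⟩ ξ : ℂ)) (ψ.T n u ξ) := by
  have := Fintype.ofFinite (X.net n)
  exact (hasSum_fintype _).summable.hasSum

theorem LipschitzPartition.hasSum_T_sub (u : X.Vertex → ℂ) (c : ℂ) (ξ : Z) :
    HasSum (fun x : X.net n => (u ⟨n, x⟩ - c) * (ψ.toFun ⟨n, x⟩ ξ : ℂ)) (ψ.T n u ξ - c) := by
  have h1 := (ψ.hasSum_one n ξ)
  have h2 : HasSum (fun x : X.net n => ((ψ.toFun ⟨n, x⟩ ξ : ℝ) : ℂ)) ((1 : ℝ) : ℂ) :=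
    h1.map Complex.ofRealHom Complex.continuous_ofReal
  have h3 := (ψ.hasSum_T n u ξ).sub (h2.mul_left c)
  simpa [sub_mul] using h3

/-- The value of T_n u at ξ is a convex combination of the values u(x) with ξ in B(x). -/
theorem LipschitzPartition.enorm_T_sub_le (u : X.Vertex → ℂ) (c : ℂ) (ξ : Z) {A : ℝ≥0∞}
    (h : ∀ x : X.net n, ξ ∈ X.ball ⟨n, x⟩ → ‖u ⟨n, x⟩ - c‖ₑ ≤ A) : ‖ψ.T n u ξ - c‖ₑ ≤ A := by
  have hsum : ∑' x : X.net n, ‖((ψ.toFun ⟨n, x⟩ ξ : ℝ) : ℂ)‖ₑ = 1 := by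
    have h1 : ∀ x : X.net n, ‖((ψ.toFun ⟨n, x⟩ ξ : ℝ) : ℂ)‖ₑ =
        ENNReal.ofReal (ψ.toFun ⟨n, x⟩ ξ) := fun x => by
      rw [← ofReal_norm, Complex.norm_real, Real.norm_of_nonneg (ψ.nonneg _ _)]
    simp_rw [h1]
    rw [← ENNReal.ofReal_tsum_of_nonneg (fun x => ψ.nonneg _ _) (ψ.hasSum_one n ξ).summable,
      (ψ.hasSum_one n ξ).tsum_eq, ENNReal.ofReal_one]
  rw [← (ψ.hasSum_T_sub n u c ξ).tsum_eq]
  have := Fintype.ofFinite (X.net n)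
  rw [tsum_fintype]
  rw [tsum_fintype] at hsum
  calc _ ≤ ∑ x : X.net n, ‖(u ⟨n, x⟩ - c) * ((ψ.toFun ⟨n, x⟩ ξ : ℝ) : ℂ)‖ₑ := enorm_sum_le _ _
    _ ≤ ∑ x : X.net n, A * ‖((ψ.toFun ⟨n, x⟩ ξ : ℝ) : ℂ)‖ₑ := by
        refine Finset.sum_le_sum fun x _ => ?_
        rw [enorm_mul]
        by_cases hx : ξ ∈ X.ball ⟨n, x⟩
        · gcongr; exact h x hx
        · rw [ψ.eq_zero_of_notMem hx]; simp
    _ = A := by rw [← Finset.mul_sum, hsum, mul_one]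

theorem LipschitzPartition.continuous_T (u : X.Vertex → ℂ) : Continuous (ψ.T n u) := by
  have := Fintype.ofFinite (X.net n)
  have h : ψ.T n u = fun ξ => ∑ x : X.net n, u ⟨n, x⟩ * (ψ.toFun ⟨n, x⟩ ξ : ℂ) := by
    funext ξ
    exact tsum_fintype _
  rw [h]
  obtain ⟨L, hL⟩ := ψ.lipschitz
  exact continuous_finsetSum _ fun x _ =>
    continuous_const.mul (Complex.continuous_ofReal.comp (hL _).continuous)

theorem LipschitzPartition.exists_enorm_T_le (u : X.Vertex → ℂ) :
    ∃ M : ℝ≥0∞, M ≠ ∞ ∧ ∀ ξ, ‖ψ.T n u ξ‖ₑ ≤ M := by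
  have := Fintype.ofFinite (X.net n)
  refine ⟨∑ x : X.net n, ‖u ⟨n, x⟩‖ₑ, ENNReal.sum_ne_top.2 fun x _ => enorm_ne_top, fun ξ => ?_⟩
  have := ψ.enorm_T_sub_le n u 0 ξ (A := ∑ x : X.net n, ‖u ⟨n, x⟩‖ₑ) fun x _ => by
    rw [sub_zero]
    exact Finset.single_le_sum (f := fun x : X.net n => ‖u ⟨n, x⟩‖ₑ) (fun _ _ => zero_le)
      (Finset.mem_univ x)
  simpa using this

theorem LipschitzPartition.T_sub (u v : X.Vertex → ℂ) (ξ : Z) :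
    ψ.T n (fun x => u x - v x) ξ = ψ.T n u ξ - ψ.T n v ξ := by
  rw [← ((ψ.hasSum_T n u ξ).sub (ψ.hasSum_T n v ξ)).tsum_eq]
  exact tsum_congr fun x => by ring

theorem LipschitzPartition.integrable_T [MeasurableSpace Z] [BorelSpace Z] (μ : Measure Z)
    [IsFiniteMeasure μ] (u : X.Vertex → ℂ) : Integrable (ψ.T n u) μ := by
  obtain ⟨M, hM, hb⟩ := ψ.exists_enorm_T_le n u
  have : SecondCountableTopologyEither Z ℂ := inferInstance
  refine Integrable.of_bound (ψ.continuous_T n u).aestronglyMeasurable M.toReal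
    (Eventually.of_forall fun ξ => ?_)
  rw [← toReal_enorm]
  exact ENNReal.toReal_mono hM (hb ξ)

end finite

theorem poisson_sub [MeasurableSpace Z] {μ : Measure Z} (X : HyperbolicFilling Z) {f g : Z → ℂ} (hf : Integrable f μ)
    (hg : Integrable g μ) (x : X.Vertex) :
    X.poisson μ (fun ξ => f ξ - g ξ) x = X.poisson μ f x - X.poisson μ g x := by
  unfold poisson
  rw [setAverage_eq, setAverage_eq, setAverage_eq,
    integral_sub hf.integrableOn hg.integrableOn, smul_sub]

theorem enorm_poisson_le [MeasurableSpace Z] {μ : Measure Z} {Q : ℝ} [IsFiniteMeasure μ]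
    (X : HyperbolicFilling Z) (hμ : IsDoublingOfDimension μ Q) (f : Z → ℂ)
    (x : X.Vertex) : ‖X.poisson μ f x‖ₑ ≤ (μ (X.ball x))⁻¹ * ∫⁻ ξ in X.ball x, ‖f ξ‖ₑ ∂μ := by
  unfold poisson
  rw [setAverage_eq, enorm_smul]
  have h1 : ‖(μ.real (X.ball x))⁻¹‖ₑ = (μ (X.ball x))⁻¹ := by
    rw [Real.enorm_of_nonneg (by positivity), measureReal_def, ENNReal.ofReal_inv_of_pos
      (ENNReal.toReal_pos (X.measure_ball_pos hμ x).ne' (measure_ne_top _ _)),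
      ENNReal.ofReal_toReal (measure_ne_top _ _)]
  rw [h1]
  gcongr
  exact enorm_integral_le_lintegral_enorm _

theorem enorm_poisson_sub_le [MeasurableSpace Z] [BorelSpace Z] {μ : Measure Z} {Q : ℝ}
    [IsFiniteMeasure μ] (X : HyperbolicFilling Z) (hμ : IsDoublingOfDimension μ Q) {f : Z → ℂ}
    (hf : Integrable f μ) (x : X.Vertex) (c : ℂ) {A : ℝ≥0∞}
    (h : ∀ ξ ∈ X.ball x, ‖f ξ - c‖ₑ ≤ A) : ‖X.poisson μ f x - c‖ₑ ≤ A := by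
  have hb0 := (X.measure_ball_pos hμ x).ne'
  have hbt : μ (X.ball x) ≠ ∞ := measure_ne_top _ _
  have hc : X.poisson μ (fun _ => c) x = c := setAverage_const hb0 hbt c
  have h1 := X.poisson_sub hf (integrable_const c) x
  rw [hc] at h1
  rw [← h1]
  refine (X.enorm_poisson_le hμ _ x).trans ?_
  calc _ ≤ (μ (X.ball x))⁻¹ * ∫⁻ ξ in X.ball x, A ∂μ := by
        refine mul_le_mul_right (setLIntegral_mono' (X.measurableSet_ball x) h) _
    _ = (μ (X.ball x))⁻¹ * μ (X.ball x) * A := by rw [setLIntegral_const]; ring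
    _ ≤ 1 * A := by gcongr; exact ENNReal.inv_mul_le_one _
    _ = A := one_mul A

variable [BoundedSpace Z] [MeasurableSpace Z] [BorelSpace Z] {μ : Measure Z} {Q : ℝ}

/-- Bounded degree reduces |du|(x) to the largest difference along an edge at x. -/
theorem exists_normD_le (X : HyperbolicFilling Z) (hμ : IsDoublingOfDimension μ Q) :
    ∃ N : ℝ≥0∞, N ≠ ∞ ∧ ∀ (u : X.Vertex → ℂ) (x : X.Vertex) (A : ℝ≥0∞),
      (∀ y, X.graph.Adj x y → ‖u y - u x‖ₑ ≤ A) → X.normD u x ≤ N * A := by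
  obtain ⟨N, hN⟩ := X.exists_encard_neighborSet_le hμ
  refine ⟨(N : ℝ≥0∞) ^ (1 / 2 : ℝ), ENNReal.rpow_ne_top_of_nonneg (by norm_num) (by simp),
    fun u x A h => ?_⟩
  unfold normD
  rw [← ENNReal.rpow_one_div_rpow (zero_lt_two (α := ℝ)) A,
    ← ENNReal.mul_rpow_of_nonneg _ _ (by norm_num)]
  refine ENNReal.rpow_le_rpow ?_ (by norm_num)
  refine ENNReal.tsum_le_mul_of_encard_le (S := Set.univ) ?_ (fun i hi => absurd trivial hi)
    fun y _ => ENNReal.rpow_le_rpow (h y y.2) (by norm_num)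
  rw [Set.encard_univ, ENat.card_coe_set_eq]
  exact hN x

/-- Fix z of level k with ξ in B(z). All values of u entering either term sit at z or at neighbours
of z, hence differ from u(z) by at most |du|(z). -/
theorem LipschitzPartition.enorm_T_succ_sub_le {X : HyperbolicFilling Z}
    (ψ : X.LipschitzPartition) (hμ : IsDoublingOfDimension μ Q) (k : ℕ) (u : X.Vertex → ℂ)
    (ξ : Z) : ‖ψ.T (k + 1) u ξ - ψ.T k u ξ‖ₑ ≤ 2 * X.levelSum (X.normD u) k ξ := by
  have := X.finite_net hμ
  obtain ⟨z, hz⟩ := X.exists_mem_ball k ξ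
  have h1 := ψ.enorm_T_sub_le (k + 1) u (u ⟨k, z⟩) ξ fun x hx =>
    X.enorm_sub_le_normD_of_mem u (x := ⟨k, z⟩) (y := ⟨k + 1, x⟩) (by simp; omega) (by simp) hz hx
  have h2 := ψ.enorm_T_sub_le k u (u ⟨k, z⟩) ξ fun x hx =>
    X.enorm_sub_le_normD_of_mem u (x := ⟨k, z⟩) (y := ⟨k, x⟩) (by simp) (by simp) hz hx
  have h3 := X.le_levelSum (X.normD u) hz
  calc _ = ‖(ψ.T (k + 1) u ξ - u ⟨k, z⟩) - (ψ.T k u ξ - u ⟨k, z⟩)‖ₑ := by congr 1; ring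
    _ ≤ ‖ψ.T (k + 1) u ξ - u ⟨k, z⟩‖ₑ + ‖ψ.T k u ξ - u ⟨k, z⟩‖ₑ := enorm_sub_le
    _ ≤ _ := by rw [two_mul]; exact add_le_add (h1.trans h3) (h2.trans h3)

/-- Because the ψ_x sum to 1, u(z) may be subtracted from every coefficient. At most N functions are
nonzero at each of ξ and η, each has Lipschitz constant L 2^n, and the remaining coefficients are at
most |du|(z). -/
theorem LipschitzPartition.exists_enorm_T_sub_T_le {X : HyperbolicFilling Z}
    (ψ : X.LipschitzPartition) (hμ : IsDoublingOfDimension μ Q) :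
    ∃ C : ℝ≥0∞, C ≠ ∞ ∧ ∀ (n : ℕ) (u : X.Vertex → ℂ) (z : X.net n) (ξ η : Z),
      ξ ∈ X.ball ⟨n, z⟩ → η ∈ X.ball ⟨n, z⟩ →
      ‖ψ.T n u ξ - ψ.T n u η‖ₑ ≤ C * 2 ^ n * edist ξ η * X.normD u ⟨n, z⟩ := by
  have := X.finite_net hμ
  obtain ⟨N, hN⟩ := X.exists_encard_cone_le hμ
  obtain ⟨L, hL⟩ := ψ.lipschitz
  refine ⟨(N + N : ℕ) * L, ENNReal.mul_ne_top (by simp) (by simp), fun n u z ξ η hξ hη => ?_⟩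
  have hsum := (ψ.hasSum_T_sub n u (u ⟨n, z⟩) ξ).sub (ψ.hasSum_T_sub n u (u ⟨n, z⟩) η)
  have heq : ψ.T n u ξ - ψ.T n u η = ∑' x : X.net n, (u ⟨n, x⟩ - u ⟨n, z⟩) *
      ((ψ.toFun ⟨n, x⟩ ξ : ℂ) - (ψ.toFun ⟨n, x⟩ η : ℂ)) := by
    rw [show ψ.T n u ξ - ψ.T n u η = (ψ.T n u ξ - u ⟨n, z⟩) - (ψ.T n u η - u ⟨n, z⟩) by ring,
      ← hsum.tsum_eq]
    exact tsum_congr fun x => by ring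
  have hFt := Fintype.ofFinite (X.net n)
  rw [heq, tsum_fintype]
  refine (enorm_sum_le _ _).trans ?_
  rw [← tsum_fintype (L := SummationFilter.unconditional _)]
  refine (ENNReal.tsum_le_mul_of_encard_le (S := {x : X.net n | ξ ∈ X.ball ⟨n, x⟩} ∪
    {x : X.net n | η ∈ X.ball ⟨n, x⟩}) (N := N + N) (A := X.normD u ⟨n, z⟩ * (L * 2 ^ n * edist ξ η))
    ?_ ?_ ?_).trans_eq ?_
  · refine (Set.encard_union_le _ _).trans ?_
    push_cast
    exact add_le_add (hN n ξ) (hN n η)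
  · intro x hx
    have h1 : ξ ∉ X.ball ⟨n, x⟩ := fun h => hx (Or.inl h)
    have h2 : η ∉ X.ball ⟨n, x⟩ := fun h => hx (Or.inr h)
    rw [ψ.eq_zero_of_notMem h1, ψ.eq_zero_of_notMem h2]
    simp
  · intro x hx
    rw [enorm_mul]
    refine mul_le_mul' ?_ ?_
    · rcases hx with hx | hx
      · exact X.enorm_sub_le_normD_of_mem u (x := ⟨n, z⟩) (y := ⟨n, x⟩) (by simp) (by simp) hξ hx
      · exact X.enorm_sub_le_normD_of_mem u (x := ⟨n, z⟩) (y := ⟨n, x⟩) (by simp) (by simp) hη hx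
    · have h1 := hL ⟨n, x⟩ ξ η
      rw [← edist_eq_enorm_sub]
      have h2 : edist (ψ.toFun ⟨n, x⟩ ξ : ℂ) (ψ.toFun ⟨n, x⟩ η : ℂ) =
          edist (ψ.toFun ⟨n, x⟩ ξ) (ψ.toFun ⟨n, x⟩ η) := by
        rw [edist_dist, edist_dist, Complex.dist_eq, ← Complex.ofReal_sub, Complex.norm_real,
          Real.dist_eq, Real.norm_eq_abs]
      rw [h2]
      refine h1.trans_eq ?_
      push_cast
      rfl
  · push_cast; ring

section poisson

variable [IsFiniteMeasure μ]

/-- Uniform boundedness in L^1, which extends convergence from continuous functions to all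
integrable ones. -/
theorem LipschitzPartition.exists_lintegral_T_poisson_le {X : HyperbolicFilling Z}
    (ψ : X.LipschitzPartition) (hμ : IsDoublingOfDimension μ Q) :
    ∃ N : ℕ, ∀ (k : ℕ) (h : Z → ℂ), Integrable h μ →
      ∫⁻ ξ, ‖ψ.T k (X.poisson μ h) ξ‖ₑ ∂μ ≤ N * ∫⁻ ξ, ‖h ξ‖ₑ ∂μ := by
  have := X.finite_net hμ
  obtain ⟨N, hN⟩ := X.exists_encard_cone_le hμ
  refine ⟨N, fun k h hh => ?_⟩
  have hle : ∀ ξ, ‖ψ.T k (X.poisson μ h) ξ‖ₑ ≤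
      X.levelSum (fun x => ‖X.poisson μ h x‖ₑ) k ξ := fun ξ => by
    have := ψ.enorm_T_sub_le k (X.poisson μ h) 0 ξ
      (A := X.levelSum (fun x => ‖X.poisson μ h x‖ₑ) k ξ) fun x hx => by
        rw [sub_zero]
        exact X.le_levelSum (fun x => ‖X.poisson μ h x‖ₑ) (x := ⟨k, x⟩) hx
    simpa using this
  have hm : AEMeasurable (fun ξ => ‖h ξ‖ₑ) μ := hh.1.enorm
  have hind : ∀ x : X.net k, AEMeasurable ((X.ball ⟨k, x⟩).indicator fun ξ => ‖h ξ‖ₑ) μ := fun x =>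
    hm.indicator (X.measurableSet_ball _)
  calc ∫⁻ ξ, ‖ψ.T k (X.poisson μ h) ξ‖ₑ ∂μ
      ≤ ∫⁻ ξ in Set.univ, X.levelSum (fun x => ‖X.poisson μ h x‖ₑ) k ξ ∂μ := by
        rw [Measure.restrict_univ]; exact lintegral_mono hle
    _ = ∑' x : X.net k, ‖X.poisson μ h ⟨k, x⟩‖ₑ * μ (X.ball ⟨k, x⟩) := by
        rw [X.lintegral_levelSum hμ]
        simp
    _ ≤ ∑' x : X.net k, ∫⁻ ξ in X.ball ⟨k, x⟩, ‖h ξ‖ₑ ∂μ := by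
        refine ENNReal.tsum_le_tsum fun x => ?_
        calc _ ≤ ((μ (X.ball ⟨k, x⟩))⁻¹ * ∫⁻ ξ in X.ball ⟨k, x⟩, ‖h ξ‖ₑ ∂μ) * μ (X.ball ⟨k, x⟩) := by
              gcongr; exact X.enorm_poisson_le hμ h _
          _ = ((μ (X.ball ⟨k, x⟩))⁻¹ * μ (X.ball ⟨k, x⟩)) * ∫⁻ ξ in X.ball ⟨k, x⟩, ‖h ξ‖ₑ ∂μ := by
              ring
          _ ≤ 1 * ∫⁻ ξ in X.ball ⟨k, x⟩, ‖h ξ‖ₑ ∂μ := by gcongr; exact ENNReal.inv_mul_le_one _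
          _ = _ := one_mul _
    _ = ∫⁻ ξ, ∑' x : X.net k, (X.ball ⟨k, x⟩).indicator (fun ξ => ‖h ξ‖ₑ) ξ ∂μ := by
        rw [lintegral_tsum hind]
        exact tsum_congr fun x => (lintegral_indicator (X.measurableSet_ball _) _).symm
    _ ≤ ∫⁻ ξ, N * ‖h ξ‖ₑ ∂μ := by
        refine lintegral_mono fun ξ => ENNReal.tsum_le_mul_of_encard_le (hN k ξ)
          (fun x hx => Set.indicator_of_notMem (s := X.ball ⟨k, x⟩) hx _) fun x _ => ?_
        exact Set.indicator_le_self _ _ ξ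
    _ = _ := lintegral_const_mul' _ _ (by simp)

theorem LipschitzPartition.tendsto_lintegral_T_poisson_sub_of_continuous {X : HyperbolicFilling Z}
    (ψ : X.LipschitzPartition) (hμ : IsDoublingOfDimension μ Q)
    (g : BoundedContinuousFunction Z ℂ) (hg : Integrable g μ) :
    Tendsto (fun k => ∫⁻ ξ, ‖ψ.T k (X.poisson μ g) ξ - g ξ‖ₑ ∂μ) atTop (𝓝 0) := by
  have := X.finite_net hμ
  have hbound : ∀ k ξ, ‖ψ.T k (X.poisson μ g) ξ - g ξ‖ₑ ≤ ENNReal.ofReal (2 * ‖g‖) := by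
    intro k ξ
    refine ψ.enorm_T_sub_le k _ _ ξ fun x _ => X.enorm_poisson_sub_le hμ hg _ _ fun η _ => ?_
    rw [← ofReal_norm]
    refine ENNReal.ofReal_le_ofReal ?_
    rw [two_mul]
    exact (norm_sub_le _ _).trans (add_le_add (g.norm_coe_le_norm η) (g.norm_coe_le_norm ξ))
  have hlim : ∀ ξ, Tendsto (fun k => ‖ψ.T k (X.poisson μ g) ξ - g ξ‖ₑ) atTop (𝓝 0) := by
    intro ξ
    rw [ENNReal.tendsto_nhds_zero]
    intro ε hε
    obtain ⟨δ, hδ, hgδ⟩ := EMetric.continuousAt_iff.1 (g.continuous.continuousAt (x := ξ)) ε hε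
    have hpow : Tendsto (fun k : ℕ => ENNReal.ofReal (2 * (1 / 2 : ℝ) ^ k)) atTop (𝓝 0) := by
      have h1 := (tendsto_pow_atTop_nhds_zero_of_lt_one (r := (1 / 2 : ℝ)) (by norm_num)
        (by norm_num)).const_mul 2
      simpa using ENNReal.tendsto_ofReal h1
    -- Level 0 is excluded because the ball of the root is all of Z and need not be small.
    filter_upwards [hpow.eventually_lt_const hδ, eventually_ge_atTop 1] with k hk hk1
    refine ψ.enorm_T_sub_le k _ _ ξ fun x hx => X.enorm_poisson_sub_le hμ hg _ _ fun η hη => ?_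
    rw [X.ball_of_pos _ hk1, Metric.mem_ball] at hx hη
    rw [← edist_eq_enorm_sub]
    refine (hgδ (lt_of_le_of_lt ?_ hk)).le
    rw [edist_dist]
    refine ENNReal.ofReal_le_ofReal ?_
    have := dist_triangle_right η ξ (x : Z)
    linarith
  have := tendsto_lintegral_of_dominated_convergence' (μ := μ)
    (F := fun k ξ => ‖ψ.T k (X.poisson μ g) ξ - g ξ‖ₑ) (f := fun _ => 0)
    (fun _ => ENNReal.ofReal (2 * ‖g‖))
    (fun k => ((ψ.integrable_T k μ _).sub hg).1.enorm)
    (fun k => Eventually.of_forall (hbound k))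
    (by rw [lintegral_const]; exact ENNReal.mul_ne_top ENNReal.ofReal_ne_top (measure_ne_top _ _))
    (Eventually.of_forall hlim)
  simpa using this

theorem LipschitzPartition.tendsto_lintegral_T_poisson_sub {X : HyperbolicFilling Z}
    (ψ : X.LipschitzPartition) (hμ : IsDoublingOfDimension μ Q) {f : Z → ℂ}
    (hf : Integrable f μ) :
    Tendsto (fun k => ∫⁻ ξ, ‖ψ.T k (X.poisson μ f) ξ - f ξ‖ₑ ∂μ) atTop (𝓝 0) := by
  have := X.finite_net hμ
  obtain ⟨N, hN⟩ := ψ.exists_lintegral_T_poisson_le hμ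
  rw [ENNReal.tendsto_nhds_zero]
  intro ε hε
  -- The approximation error enters once directly and N times through the bound on T_k P, leaving
  -- ε/2 for the continuous function.
  have hδ0 : ε / (2 * (N + 1)) ≠ 0 :=
    (ENNReal.div_pos hε.ne' (by finiteness)).ne'
  obtain ⟨g, hg, hgi⟩ := hf.exists_boundedContinuous_lintegral_sub_le hδ0
  have hfg : Integrable (fun ξ => f ξ - g ξ) μ := hf.sub hgi
  filter_upwards [ENNReal.tendsto_nhds_zero.1
    (ψ.tendsto_lintegral_T_poisson_sub_of_continuous hμ g hgi) (ε / 2) (ENNReal.half_pos hε.ne')]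
    with k hk
  have hpt : ∀ ξ, ‖ψ.T k (X.poisson μ f) ξ - f ξ‖ₑ ≤
      ‖ψ.T k (X.poisson μ fun ξ => f ξ - g ξ) ξ‖ₑ +
        ‖ψ.T k (X.poisson μ g) ξ - g ξ‖ₑ + ‖f ξ - g ξ‖ₑ := by
    intro ξ
    have h1 : ψ.T k (X.poisson μ fun ξ => f ξ - g ξ) ξ =
        ψ.T k (X.poisson μ f) ξ - ψ.T k (X.poisson μ g) ξ := by
      rw [← ψ.T_sub]
      congr 1
      funext x
      exact X.poisson_sub hf hgi x
    rw [h1]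
    calc _ = ‖((ψ.T k (X.poisson μ f) ξ - ψ.T k (X.poisson μ g) ξ) +
          (ψ.T k (X.poisson μ g) ξ - g ξ)) - (f ξ - g ξ)‖ₑ := by congr 1; ring
      _ ≤ _ := enorm_sub_le.trans (add_le_add_left (enorm_add_le _ _) _)
  have hm1 : AEMeasurable (fun ξ => ‖f ξ - g ξ‖ₑ) μ := hfg.1.enorm
  have hm2 : AEMeasurable (fun ξ => ‖ψ.T k (X.poisson μ g) ξ - g ξ‖ₑ) μ :=
    ((ψ.integrable_T k μ _).sub hgi).1.enorm
  calc _ ≤ ∫⁻ ξ, ‖ψ.T k (X.poisson μ fun ξ => f ξ - g ξ) ξ‖ₑ ∂μ +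
        ∫⁻ ξ, ‖ψ.T k (X.poisson μ g) ξ - g ξ‖ₑ ∂μ + ∫⁻ ξ, ‖f ξ - g ξ‖ₑ ∂μ := by
        rw [← lintegral_add_right' _ hm2, ← lintegral_add_right' _ hm1]
        exact lintegral_mono hpt
    _ ≤ N * (ε / (2 * (N + 1))) + ε / 2 + ε / (2 * (N + 1)) := by
        gcongr
        exact (hN k _ hfg).trans (mul_le_mul_right hg _)
    _ = (N + 1) * (ε / (2 * (N + 1))) + ε / 2 := by ring
    _ = ε := by
        have : ((N : ℝ≥0∞) + 1) * (ε / (2 * (N + 1))) = ε / 2 := by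
          rw [← mul_div_assoc, mul_comm (2 : ℝ≥0∞), ENNReal.mul_div_mul_left _ _ (by simp)
            (by finiteness)]
        rw [this, ENNReal.add_halves]

/-- Telescoping from level n to n + j. The remainder need not vanish pointwise: its integral does in
the limit, so L^1 convergence is enough. -/
theorem LipschitzPartition.lintegral_T_poisson_sub_le {X : HyperbolicFilling Z}
    (ψ : X.LipschitzPartition) (hμ : IsDoublingOfDimension μ Q) {f : Z → ℂ}
    (hf : Integrable f μ) (n : ℕ) (S : Set Z) :
    ∫⁻ ξ in S, ‖ψ.T n (X.poisson μ f) ξ - f ξ‖ₑ ∂μ ≤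
      2 * ∑' k, if n ≤ k then ∫⁻ ξ in S, X.levelSum (X.normD (X.poisson μ f)) k ξ ∂μ else 0 := by
  have := X.finite_net hμ
  set u := X.poisson μ f with hu
  set B := 2 * ∑' k, if n ≤ k then ∫⁻ ξ in S, X.levelSum (X.normD u) k ξ ∂μ else 0 with hB
  have hlm : ∀ k, Measurable (X.levelSum (X.normD u) k) := X.measurable_levelSum hμ _
  have htel : ∀ j ξ, ‖ψ.T (n + j) u ξ - ψ.T n u ξ‖ₑ ≤
      ∑ i ∈ Finset.range j, 2 * X.levelSum (X.normD u) (n + i) ξ := by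
    intro j ξ
    induction j with
    | zero => simp
    | succ j ih =>
      rw [Finset.sum_range_succ]
      calc _ = ‖(ψ.T (n + j) u ξ - ψ.T n u ξ) + (ψ.T (n + j + 1) u ξ - ψ.T (n + j) u ξ)‖ₑ := by
            congr 1; rw [add_assoc n j 1]; ring
        _ ≤ _ := (enorm_add_le _ _).trans (add_le_add ih (ψ.enorm_T_succ_sub_le hμ _ u ξ))
  have hstep : ∀ j, ∫⁻ ξ in S, ‖ψ.T n u ξ - f ξ‖ₑ ∂μ ≤
      B + ∫⁻ ξ, ‖ψ.T (n + j) u ξ - f ξ‖ₑ ∂μ := by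
    intro j
    have hpt : ∀ ξ, ‖ψ.T n u ξ - f ξ‖ₑ ≤ (∑ i ∈ Finset.range j,
        2 * X.levelSum (X.normD u) (n + i) ξ) + ‖ψ.T (n + j) u ξ - f ξ‖ₑ := by
      intro ξ
      calc _ = ‖(ψ.T (n + j) u ξ - f ξ) - (ψ.T (n + j) u ξ - ψ.T n u ξ)‖ₑ := by congr 1; ring
        _ ≤ _ := by
            rw [add_comm (∑ i ∈ Finset.range j, _)]
            exact enorm_sub_le.trans (add_le_add_right (htel j ξ) _)
    calc _ ≤ ∫⁻ ξ in S, ((∑ i ∈ Finset.range j, 2 * X.levelSum (X.normD u) (n + i) ξ) +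
          ‖ψ.T (n + j) u ξ - f ξ‖ₑ) ∂μ := lintegral_mono hpt
      _ = (∑ i ∈ Finset.range j, 2 * ∫⁻ ξ in S, X.levelSum (X.normD u) (n + i) ξ ∂μ) +
          ∫⁻ ξ in S, ‖ψ.T (n + j) u ξ - f ξ‖ₑ ∂μ := by
          rw [lintegral_add_left (Finset.measurable_sum _ fun i _ => (hlm _).const_mul 2),
            lintegral_finsetSum _ fun i _ => (hlm _).const_mul 2]
          congr 1
          exact Finset.sum_congr rfl fun i _ => lintegral_const_mul _ (hlm _)
      _ ≤ B + ∫⁻ ξ, ‖ψ.T (n + j) u ξ - f ξ‖ₑ ∂μ := by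
          refine add_le_add ?_ (setLIntegral_le_lintegral _ _)
          rw [← Finset.mul_sum, hB]
          refine mul_le_mul_right ?_ _
          refine (ENNReal.sum_le_tsum _).trans ?_
          refine le_trans (le_of_eq (tsum_congr fun i => ?_))
            (ENNReal.tsum_comp_le_tsum_of_injective (add_right_injective n) _)
          exact (if_pos (Nat.le_add_right n i)).symm
  have hlim := (ψ.tendsto_lintegral_T_poisson_sub hμ hf).comp (tendsto_add_atTop_nat n)
  have hlim' : Tendsto (fun j => B + ∫⁻ ξ, ‖ψ.T (n + j) u ξ - f ξ‖ₑ ∂μ) atTop (𝓝 (B + 0)) := by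
    refine tendsto_const_nhds.add (hlim.congr fun j => ?_)
    simp only [Function.comp_apply]
    rw [add_comm j n]
  rw [add_zero] at hlim'
  exact ge_of_tendsto hlim' (Eventually.of_forall hstep)

end poisson

end HyperbolicFilling

/-! ### Pointwise bounds for the discrete derivative of the error -/

namespace HyperbolicFilling

variable {Z : Type*} [MetricSpace Z]

/-- Some net point of level n lies within half the radius 2^(-n) of the centre of x, and c is so
large that the dilated ball fits in the other half. -/
theorem exists_bigBall_subset_ball (X : HyperbolicFilling Z) {R : ℝ} {c : ℕ}
    (hc : R * (1 / 2 : ℝ) ^ c ≤ 1 / 2) {n : ℕ} {x : X.Vertex} (hx : n + c ≤ x.1) (hR : 0 ≤ R) :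
    ∃ z : X.net n, X.bigBall R x ⊆ X.ball ⟨n, z⟩ := by
  rcases Nat.eq_zero_or_pos n with rfl | hn
  · obtain ⟨z, -⟩ := X.exists_mem_ball 0 (x.2 : Z)
    exact ⟨z, by rw [ball_zero]; exact Set.subset_univ _⟩
  · obtain ⟨z, hz⟩ := X.exists_dist_lt hn (x.2 : Z)
    refine ⟨z, ?_⟩
    rw [X.ball_of_pos ⟨n, z⟩ hn]
    refine Metric.closedBall_subset_ball' ?_
    have h1 : (1 / 2 : ℝ) ^ x.1 ≤ (1 / 2) ^ (n + c) :=
      pow_le_pow_of_le_one (by norm_num) (by norm_num) hx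
    have h2 : R * (1 / 2) ^ x.1 ≤ (1 / 2) ^ n * (1 / 2) := by
      calc R * (1 / 2) ^ x.1 ≤ R * (1 / 2) ^ (n + c) := by gcongr
        _ = (1 / 2) ^ n * (R * (1 / 2) ^ c) := by rw [pow_add]; ring
        _ ≤ _ := by gcongr
    rw [pow_succ] at hz
    linarith

/-- The weight `2 ^ (m s)` as it enters the quasi-norms. -/
def weight (s : ℝ) (m : ℕ) : ℝ≥0∞ := (2 : ℝ≥0∞) ^ ((m : ℝ) * s)

theorem weight_ne_top (s : ℝ) (m : ℕ) : weight s m ≠ ∞ := by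
  simp [weight, ENNReal.rpow_eq_top_iff]

theorem two_rpow_add (a b : ℝ) : (2 : ℝ≥0∞) ^ (a + b) = 2 ^ a * 2 ^ b :=
  ENNReal.rpow_add _ _ (by simp) (by simp)

theorem weight_mul_inv_two_pow (s : ℝ) {n m : ℕ} (h : n ≤ m) :
    weight s m * 2⁻¹ ^ (m - n) = ((2 : ℝ≥0∞) ^ (s - 1)) ^ (m - n) * weight s n := by
  obtain ⟨j, rfl⟩ := Nat.exists_eq_add_of_le h
  have h1 : (2⁻¹ : ℝ≥0∞) = 2 ^ (-1 : ℝ) := by rw [ENNReal.rpow_neg_one]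
  rw [Nat.add_sub_cancel_left, h1, ← ENNReal.rpow_natCast, ← ENNReal.rpow_natCast,
    ← ENNReal.rpow_mul, ← ENNReal.rpow_mul, weight, weight, ← two_rpow_add, ← two_rpow_add]
  congr 1
  push_cast
  ring

/-- The weight at level m times the loss in passing from means to r-means equals the weight at level
k times a geometric factor. Its ratio is below 1 exactly when s > Q(1/r - 1). -/
theorem weight_mul_ofReal_rpow (s : ℝ) {Q r : ℝ} {c k m : ℕ} (h : m ≤ k + c) :
    weight s m * ENNReal.ofReal (2 ^ (((k : ℝ) - m) * Q)) ^ (1 / r - 1) =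
      (2 : ℝ≥0∞) ^ (c * (s - Q * (1 / r - 1))) *
        (decay ((2 : ℝ≥0∞) ^ (-(s - Q * (1 / r - 1)))) c k m * weight s k) := by
  rw [← ENNReal.ofReal_rpow_of_pos (by norm_num), ENNReal.ofReal_ofNat, decay, if_pos h,
    ← ENNReal.rpow_natCast, ← ENNReal.rpow_mul, ← ENNReal.rpow_mul, weight, weight,
    ← two_rpow_add, ← two_rpow_add, ← two_rpow_add]
  congr 1
  rw [Nat.cast_sub h]
  push_cast
  ring

/-- The level sums of `|du|` on the levels from `n` on, with the weights `2 ^ (k s)`. -/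
def tailSum (X : HyperbolicFilling Z) (s : ℝ) (u : X.Vertex → ℂ) (n k : ℕ) (ξ : Z) : ℝ≥0∞ :=
  if n ≤ k then weight s k * X.levelSum (X.normD u) k ξ else 0

theorem weight_mul_kernelOp_rpow [MeasurableSpace Z] {μ : Measure Z} (X : HyperbolicFilling Z) (R s : ℝ) (u : X.Vertex → ℂ)
    {n k : ℕ} (hk : n ≤ k) (m : ℕ) {r : ℝ} (hr : 0 < r) (ξ : Z) :
    weight s k * kernelOp μ (X.kernel μ R m) (fun η => X.levelSum (X.normD u) k η ^ r) ξ ^ (1 / r) =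
      kernelOp μ (X.kernel μ R m) (fun η => X.tailSum s u n k η ^ r) ξ ^ (1 / r) := by
  have h1 : kernelOp μ (X.kernel μ R m) (fun η => X.tailSum s u n k η ^ r) ξ =
      weight s k ^ r *
        kernelOp μ (X.kernel μ R m) (fun η => X.levelSum (X.normD u) k η ^ r) ξ := by
    unfold kernelOp
    rw [← lintegral_const_mul' _ _ (ENNReal.rpow_ne_top_of_nonneg hr.le (weight_ne_top s k))]
    refine lintegral_congr fun η => ?_
    have h2 : X.tailSum s u n k η = weight s k * X.levelSum (X.normD u) k η := if_pos hk
    simp only [h2]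
    rw [ENNReal.mul_rpow_of_nonneg _ _ hr.le]
    ring
  rw [h1, ENNReal.mul_rpow_of_nonneg _ _ (by positivity), ENNReal.rpow_one_div_rpow hr]

variable [BoundedSpace Z] [MeasurableSpace Z] [BorelSpace Z] {μ : Measure Z} {Q : ℝ}

theorem exists_normD_sub_le (X : HyperbolicFilling Z) (hμ : IsDoublingOfDimension μ Q) :
    ∃ C : ℝ≥0∞, C ≠ ∞ ∧ ∀ (u v : X.Vertex → ℂ) (x : X.Vertex),
      X.normD (fun y => u y - v y) x ≤ C * (X.normD u x + X.normD v x) := by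
  obtain ⟨N, hN, hle⟩ := X.exists_normD_le hμ
  refine ⟨N, hN, fun u v x => hle _ _ _ fun y hy => ?_⟩
  calc _ = ‖(u y - u x) - (v y - v x)‖ₑ := by congr 1; ring
    _ ≤ _ := enorm_sub_le.trans
      (add_le_add (X.enorm_sub_le_normD u hy) (X.enorm_sub_le_normD v hy))

/-- On levels well above n, the ball of x and those of its neighbours lie in a single B(z) of level
n. There T_n u oscillates by at most a multiple of 2^n |du|(z) times the size 2^(-|x|) of the set.
-/
theorem LipschitzPartition.exists_normD_poisson_T_le {X : HyperbolicFilling Z}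
    (ψ : X.LipschitzPartition) (hμ : IsDoublingOfDimension μ Q) :
    ∃ (c : ℕ) (C : ℝ≥0∞), C ≠ ∞ ∧ ∀ (u : X.Vertex → ℂ) (n : ℕ) (x : X.Vertex), n + c ≤ x.1 →
      ∀ ξ ∈ X.ball x, X.normD (X.poisson μ (ψ.T n u)) x ≤
        C * (2⁻¹ ^ (x.1 - n) * X.levelSum (X.normD u) n ξ) := by
  have := X.isFiniteMeasure hμ
  have := X.finite_net hμ
  set R := 5 * (Metric.diam (Set.univ : Set Z) + 1) with hR
  have hR0 : 0 < R := by linarith [Metric.diam_nonneg (s := (Set.univ : Set Z))]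
  obtain ⟨c, hc⟩ : ∃ c : ℕ, R * (1 / 2 : ℝ) ^ c ≤ 1 / 2 := by
    obtain ⟨c, hc⟩ := exists_pow_lt_of_lt_one (show (0 : ℝ) < 1 / 2 / R by positivity)
      (show (1 / 2 : ℝ) < 1 by norm_num)
    refine ⟨c, ?_⟩
    rw [lt_div_iff₀ hR0] at hc
    linarith
  obtain ⟨N, hN, hle⟩ := X.exists_normD_le hμ
  obtain ⟨C, hC, hlip⟩ := ψ.exists_enorm_T_sub_T_le hμ
  refine ⟨c, N * (2 * (C * ENNReal.ofReal (2 * R))), by finiteness, fun u n x hx ξ hξ => ?_⟩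
  obtain ⟨z, hz⟩ := X.exists_bigBall_subset_ball hc hx hR0.le
  have hxR : X.ball x ⊆ X.bigBall R x := X.ball_subset_bigBall
    (by linarith [Metric.diam_nonneg (s := (Set.univ : Set Z))]) x
  have hpow : ENNReal.ofReal (2 * R * (1 / 2) ^ x.1) * 2 ^ n =
      ENNReal.ofReal (2 * R) * 2⁻¹ ^ (x.1 - n) := by
    obtain ⟨j, hj⟩ : ∃ j, x.1 = n + j := ⟨x.1 - n, by omega⟩
    have h1 : (2 : ℝ≥0∞) ^ n = ENNReal.ofReal (2 ^ n) := by
      rw [ENNReal.ofReal_pow (by norm_num)]; simp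
    have h2 : (2⁻¹ : ℝ≥0∞) ^ j = ENNReal.ofReal ((1 / 2) ^ j) := by
      rw [ENNReal.ofReal_pow (by norm_num)]; simp
    rw [show x.1 - n = j by omega, h1, h2, ← ENNReal.ofReal_mul (by positivity),
      ← ENNReal.ofReal_mul (by positivity), hj]
    congr 1
    have h3 : (1 / 2 : ℝ) ^ n * 2 ^ n = 1 := by rw [← mul_pow]; norm_num
    calc 2 * R * (1 / 2) ^ (n + j) * 2 ^ n = 2 * R * (1 / 2) ^ j * ((1 / 2) ^ n * 2 ^ n) := by
          rw [pow_add]; ring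
      _ = _ := by rw [h3, mul_one]
  set A := C * ENNReal.ofReal (2 * R) * (2⁻¹ ^ (x.1 - n) * X.normD u ⟨n, z⟩) with hA
  have hosc : ∀ η ∈ X.bigBall R x, ‖ψ.T n u η - ψ.T n u ξ‖ₑ ≤ A := by
    intro η hη
    refine (hlip n u z η ξ (hz hη) (hz (hxR hξ))).trans ?_
    have hd : edist η ξ ≤ ENNReal.ofReal (2 * R * (1 / 2) ^ x.1) := by
      rw [edist_dist]
      refine ENNReal.ofReal_le_ofReal ?_
      have e1 : dist η (x.2 : Z) ≤ R * (1 / 2) ^ x.1 := hη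
      have e2 : dist ξ (x.2 : Z) ≤ R * (1 / 2) ^ x.1 := hxR hξ
      have := dist_triangle_right η ξ (x.2 : Z)
      linarith
    calc C * 2 ^ n * edist η ξ * X.normD u ⟨n, z⟩
        ≤ C * 2 ^ n * ENNReal.ofReal (2 * R * (1 / 2) ^ x.1) * X.normD u ⟨n, z⟩ := by gcongr
      _ = C * (ENNReal.ofReal (2 * R * (1 / 2) ^ x.1) * 2 ^ n) * X.normD u ⟨n, z⟩ := by ring
      _ = A := by rw [hpow, hA]; ring
  have hint := ψ.integrable_T n μ u
  refine (hle _ x (A + A) fun y hy => ?_).trans ?_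
  · have hy1 := X.enorm_poisson_sub_le hμ hint y (ψ.T n u ξ) fun η hη =>
      hosc η (X.ball_subset_bigBall_of_adj le_rfl hy hη)
    have hx1 := X.enorm_poisson_sub_le hμ hint x (ψ.T n u ξ) fun η hη => hosc η (hxR hη)
    calc _ = ‖(X.poisson μ (ψ.T n u) y - ψ.T n u ξ) -
          (X.poisson μ (ψ.T n u) x - ψ.T n u ξ)‖ₑ := by congr 1; ring
      _ ≤ _ := enorm_sub_le.trans (add_le_add hy1 hx1)
  · have h1 : X.normD u ⟨n, z⟩ ≤ X.levelSum (X.normD u) n ξ :=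
      X.le_levelSum (X.normD u) (x := ⟨n, z⟩) (hz (hxR hξ))
    calc N * (A + A) = N * (2 * (C * ENNReal.ofReal (2 * R))) *
          (2⁻¹ ^ (x.1 - n) * X.normD u ⟨n, z⟩) := by rw [hA]; ring
      _ ≤ _ := by gcongr

/-- On the remaining levels the differences of averages are bounded by the averages themselves. Each
is at most a constant times the mean of the error over a dilate of B(x), which telescoping and the
passage to r-means control. -/
theorem LipschitzPartition.exists_normD_poisson_T_sub_le {X : HyperbolicFilling Z}
    (ψ : X.LipschitzPartition) (hμ : IsDoublingOfDimension μ Q) {r : ℝ} (hr : 0 < r) (hr1 : r ≤ 1)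
    (c : ℕ) : ∃ R : ℝ, 0 < R ∧ ∃ C : ℝ≥0∞, C ≠ ∞ ∧ ∀ (f : Z → ℂ), Integrable f μ →
      ∀ (n : ℕ) (x : X.Vertex), x.1 ≤ n + c → ∀ ξ ∈ X.ball x,
      X.normD (X.poisson μ fun η => ψ.T n (X.poisson μ f) η - f η) x ≤
        C * ∑' k, if n ≤ k then ENNReal.ofReal (2 ^ (((k : ℝ) - x.1) * Q)) ^ (1 / r - 1) *
          kernelOp μ (X.kernel μ R x.1)
            (fun η => X.levelSum (X.normD (X.poisson μ f)) k η ^ r) ξ ^ (1 / r) else 0 := by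
  have := X.isFiniteMeasure hμ
  have := X.finite_net hμ
  set D := Metric.diam (Set.univ : Set Z) + 1 with hD
  have hD0 : 0 < D := by linarith [Metric.diam_nonneg (s := (Set.univ : Set Z))]
  -- 5D contains the neighbouring balls; 2D 2^c is the enlargement required by
  -- `exists_lintegral_levelSum_le`.
  set R := 5 * D + 2 * D * 2 ^ c with hR
  have hR0 : 0 < R := by positivity
  have hDc : 0 < D * 2 ^ c := by positivity
  have hRD : 5 * D ≤ R := by rw [hR]; linarith
  have hRD1 : D ≤ R := by linarith
  obtain ⟨N, hN, hle⟩ := X.exists_normD_le hμ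
  obtain ⟨C₁, hC₁, hvol⟩ := X.exists_measure_bigBall_le hμ R 1
  obtain ⟨C₂, hC₂, havg⟩ := X.exists_lintegral_levelSum_le hμ hr hr1 c (R := 5 * D) hR0 hR.symm.le
  set V := C₁ * ENNReal.ofReal (2 ^ Q) with hV
  refine ⟨R, hR0, N * (2 * (V * (2 * C₂))), by finiteness, fun f hf n x hx ξ hξ => ?_⟩
  set g : Z → ℂ := fun η => ψ.T n (X.poisson μ f) η - f η with hg
  set a := X.normD (X.poisson μ f) with ha
  set S := ∑' k, (if n ≤ k then ENNReal.ofReal (2 ^ (((k : ℝ) - x.1) * Q)) ^ (1 / r - 1) *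
    kernelOp μ (X.kernel μ R x.1) (fun η => X.levelSum a k η ^ r) ξ ^ (1 / r) else 0) with hS
  have hξR : ξ ∈ X.bigBall R x := X.ball_subset_bigBall hRD1 x hξ
  set B := μ (X.bigBall R x) with hB
  have hint : ∫⁻ η in X.bigBall (5 * D) x, ‖g η‖ₑ ∂μ ≤ 2 * (C₂ * B * S) := by
    refine (ψ.lintegral_T_poisson_sub_le hμ hf n _).trans ?_
    refine mul_le_mul_right ?_ _
    rw [hS, ← ENNReal.tsum_mul_left]
    refine ENNReal.tsum_le_tsum fun k => ?_
    split_ifs with hk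
    · refine (havg a x k (by omega)).trans ?_
      have h1 := X.average_le_kernelOp hμ R ((X.measurable_levelSum hμ a k).pow_const r) x hξR
      calc _ ≤ C₂ * ENNReal.ofReal (2 ^ (((k : ℝ) - x.1) * Q)) ^ (1 / r - 1) * B *
            kernelOp μ (X.kernel μ R x.1) (fun η => X.levelSum a k η ^ r) ξ ^ (1 / r) := by
            gcongr
        _ = _ := by ring
    · exact zero_le
  have hpt : ∀ y : X.Vertex, X.ball y ⊆ X.bigBall (5 * D) x → x.1 ≤ y.1 + 1 → y.1 ≤ x.1 + 1 →
      ‖X.poisson μ g y‖ₑ ≤ V * (2 * C₂) * S := by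
    intro y hy hxy hyx
    have hbig : X.bigBall (5 * D) x ⊆ X.bigBall R x :=
      Metric.closedBall_subset_closedBall (by gcongr)
    have hb0 := (X.measure_ball_pos hμ y).ne'
    have hbt : μ (X.ball y) ≠ ∞ := measure_ne_top _ _
    have hBV : (μ (X.ball y))⁻¹ * B ≤ V := by
      have h1 := hvol x y hxy (hbig (hy (X.center_mem_ball y)))
      rw [mul_comm, ← div_eq_mul_inv, ENNReal.div_le_iff_le_mul (Or.inl hb0) (Or.inl hbt)]
      have h2 : (y.1 : ℝ) ≤ x.1 + 1 := by exact_mod_cast hyx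
      have h3 : ENNReal.ofReal (2 ^ (((y.1 : ℝ) - x.1) * Q)) ≤ ENNReal.ofReal (2 ^ Q) :=
        ENNReal.ofReal_le_ofReal (Real.rpow_le_rpow_of_exponent_le one_le_two
          (by nlinarith [hμ.Q_pos]))
      exact h1.trans (mul_le_mul_left (mul_le_mul_right h3 _) _)
    calc ‖X.poisson μ g y‖ₑ ≤ (μ (X.ball y))⁻¹ * ∫⁻ η in X.ball y, ‖g η‖ₑ ∂μ :=
          X.enorm_poisson_le hμ g y
      _ ≤ (μ (X.ball y))⁻¹ * (2 * (C₂ * B * S)) := by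
          refine mul_le_mul_right ((lintegral_mono_set hy).trans hint) _
      _ = ((μ (X.ball y))⁻¹ * B) * (2 * C₂) * S := by ring
      _ ≤ _ := by gcongr
  refine (hle _ x (V * (2 * C₂) * S + V * (2 * C₂) * S) fun y hy => ?_).trans_eq (by ring)
  refine enorm_sub_le.trans (add_le_add ?_ ?_)
  · obtain ⟨_, ⟨h1, h2⟩, _⟩ := id hy
    exact hpt y (X.ball_subset_bigBall_of_adj le_rfl hy) h1 h2
  · exact hpt x (X.ball_subset_bigBall (by linarith) x) (by omega) (by omega)

theorem measurable_tailSum (X : HyperbolicFilling Z) (hμ : IsDoublingOfDimension μ Q) (s : ℝ)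
    (u : X.Vertex → ℂ) (n k : ℕ) : Measurable (X.tailSum s u n k) := by
  unfold tailSum
  split_ifs
  · exact (X.measurable_levelSum hμ _ k).const_mul _
  · exact measurable_const

/-- Pointwise control of the discrete derivative of the error `T_n (Pf) - f` by the levels of
`|d(Pf)|` from `n` on. -/
theorem LipschitzPartition.exists_weight_mul_normD_le {X : HyperbolicFilling Z}
    (ψ : X.LipschitzPartition) (hμ : IsDoublingOfDimension μ Q) (s : ℝ) {r : ℝ} (hr : 0 < r)
    (hr1 : r ≤ 1) : ∃ (c : ℕ) (R : ℝ), 0 < R ∧ ∃ C : ℝ≥0∞, C ≠ ∞ ∧ ∀ (f : Z → ℂ),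
      Integrable f μ → ∀ (n : ℕ) (x : X.Vertex), ∀ ξ ∈ X.ball x,
      weight s x.1 * X.normD (X.poisson μ fun η => ψ.T n (X.poisson μ f) η - f η) x ≤
        C * ((X.tailSum s (X.poisson μ f) n x.1 ξ +
          (if n ≤ x.1 then ((2 : ℝ≥0∞) ^ (s - 1)) ^ (x.1 - n) *
            X.tailSum s (X.poisson μ f) n n ξ else 0)) +
          ∑' k, decay ((2 : ℝ≥0∞) ^ (-(s - Q * (1 / r - 1)))) c k x.1 *
            kernelOp μ (X.kernel μ R x.1)
              (fun η => X.tailSum s (X.poisson μ f) n k η ^ r) ξ ^ (1 / r)) := by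
  have := X.isFiniteMeasure hμ
  have := X.finite_net hμ
  obtain ⟨c, C₁, hC₁, hfar⟩ := ψ.exists_normD_poisson_T_le hμ
  obtain ⟨R, hR, C₂, hC₂, hnear⟩ := ψ.exists_normD_poisson_T_sub_le hμ hr hr1 c
  obtain ⟨C₃, hC₃, hsub⟩ := X.exists_normD_sub_le hμ
  set κ := (2 : ℝ≥0∞) ^ (c * (s - Q * (1 / r - 1))) with hκ
  have hκt : κ ≠ ∞ := by simp [hκ, ENNReal.rpow_eq_top_iff]
  refine ⟨c, R, hR, C₃ * C₁ + C₃ + C₂ * κ, by finiteness, fun f hf n x ξ hξ => ?_⟩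
  set u := X.poisson μ f with hu
  -- Fine levels use the smoothness of T_n u and the tail of |du| separately; coarse levels use that
  -- the error is small in mean.
  rcases le_total (n + c) x.1 with hx | hx
  · have hnx : n ≤ x.1 := by omega
    have hPg : (X.poisson μ fun η => ψ.T n u η - f η) =
        fun y => X.poisson μ (ψ.T n u) y - u y := by
      funext y
      exact X.poisson_sub (ψ.integrable_T n μ u) hf y
    rw [hPg, if_pos hnx]
    have h1 := X.le_levelSum (X.normD u) hξ
    have hα : X.tailSum s u n x.1 ξ = weight s x.1 * X.levelSum (X.normD u) x.1 ξ := if_pos hnx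
    have hβ : X.tailSum s u n n ξ = weight s n * X.levelSum (X.normD u) n ξ := if_pos le_rfl
    calc weight s x.1 * X.normD (fun y => X.poisson μ (ψ.T n u) y - u y) x
        ≤ weight s x.1 * (C₃ * (C₁ * (2⁻¹ ^ (x.1 - n) * X.levelSum (X.normD u) n ξ) +
          X.levelSum (X.normD u) x.1 ξ)) := by
          refine mul_le_mul_right ((hsub _ _ x).trans (mul_le_mul_right ?_ _)) _
          exact add_le_add (hfar u n x hx ξ hξ) h1
      _ = C₃ * C₁ * ((weight s x.1 * 2⁻¹ ^ (x.1 - n)) * X.levelSum (X.normD u) n ξ) +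
          C₃ * (weight s x.1 * X.levelSum (X.normD u) x.1 ξ) := by ring
      _ = C₃ * C₁ * (((2 : ℝ≥0∞) ^ (s - 1)) ^ (x.1 - n) * X.tailSum s u n n ξ) +
          C₃ * X.tailSum s u n x.1 ξ := by
          rw [weight_mul_inv_two_pow s hnx, hα, hβ, mul_assoc _ (weight s n)]
      _ ≤ (C₃ * C₁ + C₃ + C₂ * κ) * (X.tailSum s u n x.1 ξ +
          ((2 : ℝ≥0∞) ^ (s - 1)) ^ (x.1 - n) * X.tailSum s u n n ξ) := by
          rw [mul_add, add_comm]
          refine add_le_add ?_ ?_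
          · gcongr
            exact le_add_self.trans le_self_add
          · gcongr
            exact le_self_add.trans le_self_add
      _ ≤ _ := mul_le_mul_right le_self_add _
  · refine (mul_le_mul_right (hnear f hf n x hx ξ hξ) _).trans ?_
    calc _ = C₂ * ∑' k, weight s x.1 * (if n ≤ k then
          ENNReal.ofReal (2 ^ (((k : ℝ) - x.1) * Q)) ^ (1 / r - 1) *
          kernelOp μ (X.kernel μ R x.1)
            (fun η => X.levelSum (X.normD u) k η ^ r) ξ ^ (1 / r) else 0) := by
          rw [ENNReal.tsum_mul_left]; ring
      _ ≤ C₂ * ∑' k, κ * (decay ((2 : ℝ≥0∞) ^ (-(s - Q * (1 / r - 1)))) c k x.1 *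
            kernelOp μ (X.kernel μ R x.1) (fun η => X.tailSum s u n k η ^ r) ξ ^ (1 / r)) := by
          refine mul_le_mul_right (ENNReal.tsum_le_tsum fun k => ?_) _
          split_ifs with hk
          · rw [← mul_assoc, weight_mul_ofReal_rpow s (show x.1 ≤ k + c by omega), mul_assoc,
              mul_assoc, X.weight_mul_kernelOp_rpow R s u hk x.1 hr]
          · rw [mul_zero]; exact zero_le
      _ = C₂ * κ * ∑' k, (decay ((2 : ℝ≥0∞) ^ (-(s - Q * (1 / r - 1)))) c k x.1 *
            kernelOp μ (X.kernel μ R x.1) (fun η => X.tailSum s u n k η ^ r) ξ ^ (1 / r)) := by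
          rw [ENNReal.tsum_mul_left, mul_assoc]
      _ ≤ _ := by
          gcongr
          · exact le_add_self
          · exact le_add_self

end HyperbolicFilling

/-! ### Quasi-norm estimates for the error -/

namespace HyperbolicFilling

variable {Z : Type*} [MetricSpace Z]

/-- Indicators make the index set independent of ξ, so that measurability in ξ can be read off. -/
theorem lqNorm_cone (X : HyperbolicFilling Z) {q : ℝ≥0∞} (hq : 0 < q) (b : X.Vertex → ℝ≥0∞)
    (ξ : Z) : lqNorm q (fun x : X.cone ξ => b x) =
      lqNorm q (fun x : X.Vertex => (X.ball x).indicator (fun _ => b x) ξ) := by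
  by_cases h : q = ∞
  · subst h
    rw [lqNorm_top, lqNorm_top]
    refine le_antisymm (iSup_le fun x => ?_) (iSup_le fun x => ?_)
    · refine le_trans (le_of_eq ?_) (le_iSup _ x.1)
      exact (Set.indicator_of_mem (s := X.ball x.1) x.2 fun _ => b x).symm
    · by_cases hx : ξ ∈ X.ball x
      · rw [Set.indicator_of_mem hx]
        exact le_iSup (fun x : X.cone ξ => b x) ⟨x, hx⟩
      · rw [Set.indicator_of_notMem hx]; exact zero_le
  · have hq' := ENNReal.toReal_pos hq.ne' h
    rw [lqNorm_of_ne_top h, lqNorm_of_ne_top h, tsum_subtype (X.cone ξ) fun x => b x ^ q.toReal]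
    congr 1
    refine tsum_congr fun x => ?_
    by_cases hx : ξ ∈ X.ball x
    · rw [Set.indicator_of_mem hx, Set.indicator_of_mem (s := X.cone ξ) hx]
    · rw [Set.indicator_of_notMem hx, Set.indicator_of_notMem (s := X.cone ξ) hx,
        ENNReal.zero_rpow_of_pos hq']

/-- A finite set of vertices lies below some level, so the cut-off sum is dominated by the tail of a
convergent series. This fails for suprema, hence q is finite. -/
theorem tendsto_lqNorm_tail {X : HyperbolicFilling Z} {q : ℝ≥0∞} (hq : 0 < q) (hqt : q ≠ ∞)
    (b : X.Vertex → ℝ≥0∞) (ξ : Z) (hfin : lqNorm q (fun x : X.cone ξ => b x) ≠ ∞) :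
    Tendsto (fun n => lqNorm q fun x : X.cone ξ => if n ≤ x.1.1 then b x else 0) atTop (𝓝 0) := by
  set e := q.toReal with he
  have he0 : 0 < e := ENNReal.toReal_pos hq.ne' hqt
  simp_rw [lqNorm_of_ne_top hqt, ← he] at hfin ⊢
  have hsum : ∑' x : X.cone ξ, b x ^ e ≠ ∞ := fun h => hfin (by
    rw [h, ENNReal.top_rpow_of_pos (by positivity)])
  have hlim : Tendsto (fun n => ∑' x : X.cone ξ, (if n ≤ x.1.1 then b x else 0) ^ e)
      atTop (𝓝 0) := by
    rw [ENNReal.tendsto_nhds_zero]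
    intro ε hε
    obtain ⟨F, hF⟩ := (ENNReal.tendsto_nhds_zero.1
      (ENNReal.tendsto_tsum_compl_atTop_zero hsum) ε hε).exists
    filter_upwards [eventually_gt_atTop (F.sup fun x => x.1.1)] with n hn
    refine le_trans ?_ hF
    have hsub : ∑' x : {x // x ∉ F}, b x.1 ^ e =
        ∑' x, {x | x ∉ F}.indicator (fun x : X.cone ξ => b x ^ e) x :=
      tsum_subtype {x | x ∉ F} fun x : X.cone ξ => b x ^ e
    rw [hsub]
    refine ENNReal.tsum_le_tsum fun x => ?_
    by_cases hx : x ∈ F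
    · have : x.1.1 ≤ F.sup fun x => x.1.1 := Finset.le_sup (f := fun x : X.cone ξ => x.1.1) hx
      rw [if_neg (by omega), ENNReal.zero_rpow_of_pos he0]
      exact zero_le
    · rw [Set.indicator_of_mem (s := {x | x ∉ F}) hx]
      refine ENNReal.rpow_le_rpow ?_ he0.le
      split_ifs
      · exact le_rfl
      · exact zero_le
  have := (ENNReal.continuous_rpow_const (y := 1 / e)).tendsto 0 |>.comp hlim
  rwa [ENNReal.zero_rpow_of_pos (by positivity)] at this

theorem normD_neg (X : HyperbolicFilling Z) (u : X.Vertex → ℂ) (x : X.Vertex) :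
    X.normD (fun y => -u y) x = X.normD u x := by
  have h : ∀ y, ‖-u y - -u x‖ₑ = ‖u y - u x‖ₑ := fun y => by
    rw [← enorm_neg]; congr 1; ring
  simp_rw [normD, h]

theorem tailSum_eq_levelSum (X : HyperbolicFilling Z) (s : ℝ) (u : X.Vertex → ℂ) (n k : ℕ) (ξ : Z) :
    X.tailSum s u n k ξ = X.levelSum (fun x => (2 : ℝ≥0∞) ^ ((X.level x : ℝ) * s) *
      if n ≤ X.level x then X.normD u x else 0) k ξ := by
  have h := X.levelSum_const_mul (X.normD u) (fun m => if n ≤ m then weight s m else 0) k ξ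
  have h2 : X.tailSum s u n k ξ = (if n ≤ k then weight s k else 0) *
      X.levelSum (X.normD u) k ξ := by
    unfold tailSum
    split_ifs
    · rfl
    · rw [zero_mul]
  rw [h2, ← h]
  congr 1
  funext x
  by_cases hx : n ≤ x.1 <;> simp [hx, weight, level]

variable [MeasurableSpace Z] {μ : Measure Z} {Q : ℝ}

theorem jNorm_mono (X : HyperbolicFilling Z) {s p : ℝ} (hp : 0 < p) {q : ℝ≥0∞}
    {a b : X.Vertex → ℝ≥0∞} (h : ∀ x, a x ≤ b x) : X.jNorm μ s p q a ≤ X.jNorm μ s p q b := by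
  refine ENNReal.rpow_le_rpow (lintegral_mono fun ξ => ENNReal.rpow_le_rpow
    (lqNorm_mono fun x => ?_) hp.le) (by positivity)
  gcongr
  exact h x

theorem jNorm_const_mul (X : HyperbolicFilling Z) {s p : ℝ} (hp : 0 < p) {q : ℝ≥0∞} (hq : 0 < q)
    {c : ℝ≥0∞} (hc : c ≠ ∞) (a : X.Vertex → ℝ≥0∞) :
    X.jNorm μ s p q (fun x => c * a x) = c * X.jNorm μ s p q a := by
  unfold jNorm
  simp_rw [mul_left_comm _ c, lqNorm_const_mul hq, ENNReal.mul_rpow_of_nonneg _ _ hp.le]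
  rw [lintegral_const_mul' _ _ (ENNReal.rpow_ne_top_of_nonneg hp.le hc),
    ENNReal.mul_rpow_of_nonneg _ _ (by positivity), ENNReal.rpow_one_div_rpow hp]

variable [BoundedSpace Z] [BorelSpace Z]

theorem measurable_lqNorm_cone (X : HyperbolicFilling Z) (hμ : IsDoublingOfDimension μ Q)
    {q : ℝ≥0∞} (hq : 0 < q) (b : X.Vertex → ℝ≥0∞) :
    Measurable fun ξ => lqNorm q (fun x : X.cone ξ => b x) := by
  have := X.countable_vertex hμ
  simp_rw [X.lqNorm_cone hq b]
  exact measurable_lqNorm fun x => measurable_const.indicator (X.measurableSet_ball x)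

theorem exists_jNorm_add_le (X : HyperbolicFilling Z) (hμ : IsDoublingOfDimension μ Q) (s : ℝ)
    {p : ℝ} (hp : 0 < p) {q : ℝ≥0∞} (hq : 0 < q) : ∃ C : ℝ≥0∞, C ≠ ∞ ∧ ∀ a b : X.Vertex → ℝ≥0∞,
      X.jNorm μ s p q (fun x => a x + b x) ≤ C * (X.jNorm μ s p q a + X.jNorm μ s p q b) := by
  obtain ⟨K, hK, hadd⟩ := exists_lqNorm_add_le q
  have hp' : 0 ≤ 1 / p := by positivity
  refine ⟨(K ^ p * 2 ^ p) ^ (1 / p) * 2 ^ (1 / p), ENNReal.mul_ne_top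
    (ENNReal.rpow_ne_top_of_nonneg hp' (ENNReal.mul_ne_top
      (ENNReal.rpow_ne_top_of_nonneg hp.le hK) (ENNReal.rpow_ne_top_of_nonneg hp.le (by simp))))
    (ENNReal.rpow_ne_top_of_nonneg hp' (by simp)), fun a b => ?_⟩
  unfold jNorm
  set A : Z → ℝ≥0∞ := fun ξ =>
    lqNorm q (fun x : X.cone ξ => (2 : ℝ≥0∞) ^ ((X.level x : ℝ) * s) * a x) with hA
  set B : Z → ℝ≥0∞ := fun ξ =>
    lqNorm q (fun x : X.cone ξ => (2 : ℝ≥0∞) ^ ((X.level x : ℝ) * s) * b x) with hB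
  have hAm : Measurable A :=
    X.measurable_lqNorm_cone hμ hq fun x => (2 : ℝ≥0∞) ^ ((X.level x : ℝ) * s) * a x
  calc _ ≤ (∫⁻ ξ, K ^ p * 2 ^ p * (A ξ ^ p + B ξ ^ p) ∂μ) ^ (1 / p) := by
        refine ENNReal.rpow_le_rpow (lintegral_mono fun ξ => ?_) hp'
        have hab : ∀ x : X.cone ξ, (2 : ℝ≥0∞) ^ ((X.level x : ℝ) * s) * (a x + b x) =
            2 ^ ((X.level x : ℝ) * s) * a x + 2 ^ ((X.level x : ℝ) * s) * b x :=
          fun x => mul_add _ _ _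
        simp_rw [hab]
        refine (ENNReal.rpow_le_rpow (hadd _ _) hp.le).trans ?_
        rw [ENNReal.mul_rpow_of_nonneg _ _ hp.le, mul_assoc]
        gcongr
        exact ENNReal.add_rpow_le_two_rpow_mul _ _ hp.le
    _ = (K ^ p * 2 ^ p) ^ (1 / p) * (∫⁻ ξ, A ξ ^ p ∂μ + ∫⁻ ξ, B ξ ^ p ∂μ) ^ (1 / p) := by
        rw [lintegral_const_mul' _ _ (ENNReal.mul_ne_top (ENNReal.rpow_ne_top_of_nonneg hp.le hK)
          (ENNReal.rpow_ne_top_of_nonneg hp.le (by simp))),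
          lintegral_add_left (hAm.pow_const p), ENNReal.mul_rpow_of_nonneg _ _ hp']
    _ ≤ _ := by
        rw [mul_assoc]
        gcongr
        exact ENNReal.add_rpow_le_two_rpow_mul _ _ hp'

theorem tendsto_jNorm_tail (X : HyperbolicFilling Z) (hμ : IsDoublingOfDimension μ Q) {s p : ℝ}
    (hp : 0 < p) {q : ℝ≥0∞} (hq : 0 < q) (hqt : q ≠ ∞) {a : X.Vertex → ℝ≥0∞}
    (ha : X.jNorm μ s p q a ≠ ∞) :
    Tendsto (fun n => X.jNorm μ s p q fun x => if n ≤ X.level x then a x else 0) atTop (𝓝 0) := by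
  set b : X.Vertex → ℝ≥0∞ := fun x => (2 : ℝ≥0∞) ^ ((X.level x : ℝ) * s) * a x with hb
  have hint : ∫⁻ ξ, lqNorm q (fun x : X.cone ξ => b x) ^ p ∂μ ≠ ∞ := fun h => ha (by
    unfold jNorm
    rw [h, ENNReal.top_rpow_of_pos (by positivity)])
  have hlim : Tendsto (fun n => ∫⁻ ξ,
      lqNorm q (fun x : X.cone ξ => if n ≤ x.1.1 then b x else 0) ^ p ∂μ) atTop (𝓝 0) := by
    have := tendsto_lintegral_of_dominated_convergence (μ := μ)
      (F := fun n ξ => lqNorm q (fun x : X.cone ξ => if n ≤ x.1.1 then b x else 0) ^ p)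
      (f := fun _ => 0) (fun ξ => lqNorm q (fun x : X.cone ξ => b x) ^ p)
      (fun n => (X.measurable_lqNorm_cone hμ hq fun x => if n ≤ x.1 then b x else 0).pow_const p)
      (fun n => Eventually.of_forall fun ξ => ENNReal.rpow_le_rpow (lqNorm_mono fun x => by
        split_ifs
        · exact le_rfl
        · exact zero_le) hp.le) hint ?_
    · simpa using this
    · filter_upwards [ae_lt_top ((X.measurable_lqNorm_cone hμ hq b).pow_const p) hint] with ξ hξ
      have hξ' : lqNorm q (fun x : X.cone ξ => b x) ≠ ∞ := fun h => by
        rw [h, ENNReal.top_rpow_of_pos hp] at hξ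
        exact lt_irrefl _ hξ
      have := (ENNReal.continuous_rpow_const (y := p)).tendsto 0 |>.comp
        (tendsto_lqNorm_tail hq hqt b ξ hξ')
      rwa [ENNReal.zero_rpow_of_pos hp] at this
  have := (ENNReal.continuous_rpow_const (y := 1 / p)).tendsto 0 |>.comp hlim
  rw [ENNReal.zero_rpow_of_pos (by positivity)] at this
  refine this.congr fun n => ?_
  simp only [Function.comp_apply, jNorm, hb, mul_ite, mul_zero]

/-- The error `T_n (Pf) - f` is controlled by the part of `d(Pf)` on the levels from `n` on. -/
theorem LipschitzPartition.exists_fNorm_T_poisson_sub_le {X : HyperbolicFilling Z}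
    (ψ : X.LipschitzPartition) (hμ : IsDoublingOfDimension μ Q) {s p r : ℝ} {q : ℝ≥0∞}
    (hs : s < 1 ∨ (s ≤ 1 ∧ q = ∞)) (hr : 0 < r) (hr1 : r ≤ 1) (hrp : r < p)
    (hrq : ENNReal.ofReal r < q) (hrs : 0 < s - Q * (1 / r - 1)) :
    ∃ C : ℝ≥0∞, C ≠ ∞ ∧ ∀ f : Z → ℂ, Integrable f μ → ∀ n : ℕ,
      X.fNorm μ s p q (fun ξ => ψ.T n (X.poisson μ f) ξ - f ξ) ≤ C * X.jNorm μ s p q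
        fun x => if n ≤ X.level x then X.normD (X.poisson μ f) x else 0 := by
  have := X.isFiniteMeasure hμ
  have hp : 0 < p := hr.trans hrp
  have hp' : 0 ≤ 1 / p := by positivity
  have hq : 0 < q := (ENNReal.ofReal_pos.2 hr).trans hrq
  obtain ⟨c, R, hR, C₁, hC₁, hpt⟩ := ψ.exists_weight_mul_normD_le hμ s hr hr1
  obtain ⟨N, hKer⟩ := X.exists_isAveragingFamily hμ hR
  -- The two geometric ratios: this one governs the coarse levels, the next the fine levels, where
  -- the endpoint s = 1 gives ratio 1.
  have hρ : (2 : ℝ≥0∞) ^ (-(s - Q * (1 / r - 1))) < 1 :=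
    ENNReal.rpow_lt_one_of_one_lt_of_neg (by norm_num) (by linarith)
  have hρ' : (2 : ℝ≥0∞) ^ (s - 1) < 1 ∨ ((2 : ℝ≥0∞) ^ (s - 1) ≤ 1 ∧ q = ∞) := by
    rcases hs with h | ⟨h, h'⟩
    · exact Or.inl (ENNReal.rpow_lt_one_of_one_lt_of_neg (by norm_num) (by linarith))
    · exact Or.inr ⟨by
        simpa using ENNReal.rpow_le_rpow_of_exponent_le (x := 2) (by norm_num) (show s - 1 ≤ 0 by linarith), h'⟩
  obtain ⟨Cγ, hCγ, hγ⟩ := hKer.exists_lintegral_lqNorm_decay_le hr hrp hrq hρ c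
  obtain ⟨Cβ, hCβ, hβ⟩ := exists_lqNorm_geometric_le hq hρ'
  obtain ⟨C₂, hC₂, hcone⟩ := X.exists_lqNorm_cone_le hμ hq
  obtain ⟨C₃, hC₃, hlev⟩ := X.exists_lqNorm_levelSum_le hμ hq
  obtain ⟨K, hK, hadd⟩ := exists_lqNorm_add_le q
  set A := C₂ * C₁ * (K * (K * (1 + Cβ) + 1)) with hA
  have hAt : A ≠ ∞ := by finiteness
  have hB : A ^ p * (2 ^ p * (1 + Cγ)) * C₃ ^ p ≠ ∞ := by
    have h1 : A ^ p ≠ ∞ := ENNReal.rpow_ne_top_of_nonneg hp.le hAt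
    have h2 : (2 : ℝ≥0∞) ^ p ≠ ∞ := ENNReal.rpow_ne_top_of_nonneg hp.le (by simp)
    have h3 : C₃ ^ p ≠ ∞ := ENNReal.rpow_ne_top_of_nonneg hp.le hC₃
    finiteness
  refine ⟨(A ^ p * (2 ^ p * (1 + Cγ)) * C₃ ^ p) ^ (1 / p),
    ENNReal.rpow_ne_top_of_nonneg hp' hB, fun f hf n => ?_⟩
  set u := X.poisson μ f with hu
  set g : Z → ℂ := fun ξ => ψ.T n u ξ - f ξ with hg
  set G : ℕ → Z → ℝ≥0∞ := X.tailSum s u n with hG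
  have hGm : ∀ k, Measurable (G k) := X.measurable_tailSum hμ s u n
  set γ : ℕ → Z → ℝ≥0∞ := fun m ξ => ∑' k, decay ((2 : ℝ≥0∞) ^ (-(s - Q * (1 / r - 1)))) c k m *
    kernelOp μ (X.kernel μ R m) (fun η => G k η ^ r) ξ ^ (1 / r) with hγdef
  have hpoint : ∀ ξ, lqNorm q (fun x : X.cone ξ => (2 : ℝ≥0∞) ^ ((X.level x : ℝ) * s) *
      X.normD (X.poisson μ g) x) ≤ A * (lqNorm q (fun k => G k ξ) + lqNorm q fun m => γ m ξ) := by
    intro ξ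
    set β : ℕ → ℝ≥0∞ := fun m => if n ≤ m then ((2 : ℝ≥0∞) ^ (s - 1)) ^ (m - n) * G n ξ else 0
      with hβdef
    -- At fixed ξ the bound from `hpt` depends on x only through its level, so the norm over the
    -- cone passes to a norm over levels.
    have h1 := hcone ξ (fun x : X.cone ξ => (2 : ℝ≥0∞) ^ ((X.level x : ℝ) * s) *
      X.normD (X.poisson μ g) x) (fun m => C₁ * ((G m ξ + β m) + γ m ξ))
      fun x => hpt f hf n x ξ x.2
    rw [lqNorm_const_mul hq] at h1
    have h2 : lqNorm q β ≤ Cβ * lqNorm q (fun k => G k ξ) :=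
      (hβ n (G n ξ)).trans (mul_le_mul_right (le_lqNorm hq (fun k => G k ξ) n) _)
    have h3 : lqNorm q (fun m => G m ξ + β m) ≤ K * ((1 + Cβ) * lqNorm q (fun k => G k ξ)) := by
      refine (hadd _ _).trans (mul_le_mul_right ?_ _)
      rw [add_mul, one_mul]
      gcongr
    have h4 := hadd (fun m => G m ξ + β m) (fun m => γ m ξ)
    set g₁ := lqNorm q (fun k => G k ξ)
    set g₂ := lqNorm q (fun m => γ m ξ)
    calc _ ≤ C₂ * (C₁ * (K * (K * ((1 + Cβ) * g₁) + g₂))) := by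
          refine h1.trans (mul_le_mul_right (mul_le_mul_right (h4.trans ?_) _) _)
          gcongr
      _ = C₂ * C₁ * (K * (K * (1 + Cβ) * g₁ + 1 * g₂)) := by ring
      _ ≤ C₂ * C₁ * (K * ((K * (1 + Cβ) + 1) * g₁ + (K * (1 + Cβ) + 1) * g₂)) := by
          gcongr
          · exact le_self_add
          · exact le_add_self
      _ = A * (g₁ + g₂) := by rw [hA]; ring
  have hGint : ∫⁻ ξ, lqNorm q (fun k => G k ξ) ^ p ∂μ ≤ C₃ ^ p *
      ∫⁻ ξ, lqNorm q (fun x : X.cone ξ => (2 : ℝ≥0∞) ^ ((X.level x : ℝ) * s) *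
        if n ≤ X.level x then X.normD u x else 0) ^ p ∂μ := by
    rw [← lintegral_const_mul' _ _ (ENNReal.rpow_ne_top_of_nonneg hp.le hC₃)]
    refine lintegral_mono fun ξ => ?_
    rw [← ENNReal.mul_rpow_of_nonneg _ _ hp.le]
    refine ENNReal.rpow_le_rpow ?_ hp.le
    simp_rw [hG, X.tailSum_eq_levelSum s u n]
    exact hlev ξ _
  have hlqm : Measurable fun ξ => lqNorm q (fun k => G k ξ) := measurable_lqNorm hGm
  unfold fNorm jNorm
  rw [← ENNReal.mul_rpow_of_nonneg _ _ hp']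
  refine ENNReal.rpow_le_rpow ?_ hp'
  calc _ ≤ ∫⁻ ξ, (A ^ p * 2 ^ p) *
        (lqNorm q (fun k => G k ξ) ^ p + lqNorm q (fun m => γ m ξ) ^ p) ∂μ := by
        refine lintegral_mono fun ξ => (ENNReal.rpow_le_rpow (hpoint ξ) hp.le).trans ?_
        rw [ENNReal.mul_rpow_of_nonneg _ _ hp.le, mul_assoc]
        gcongr
        exact ENNReal.add_rpow_le_two_rpow_mul _ _ hp.le
    _ = (A ^ p * 2 ^ p) * (∫⁻ ξ, lqNorm q (fun k => G k ξ) ^ p ∂μ +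
        ∫⁻ ξ, lqNorm q (fun m => γ m ξ) ^ p ∂μ) := by
        rw [lintegral_const_mul' _ _ (ENNReal.mul_ne_top (ENNReal.rpow_ne_top_of_nonneg hp.le hAt)
          (ENNReal.rpow_ne_top_of_nonneg hp.le (by simp))),
          lintegral_add_left (hlqm.pow_const p)]
    _ ≤ (A ^ p * 2 ^ p) * (∫⁻ ξ, lqNorm q (fun k => G k ξ) ^ p ∂μ +
        Cγ * ∫⁻ ξ, lqNorm q (fun k => G k ξ) ^ p ∂μ) := by
        gcongr
        exact hγ G hGm
    _ = A ^ p * (2 ^ p * (1 + Cγ)) * ∫⁻ ξ, lqNorm q (fun k => G k ξ) ^ p ∂μ := by ring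
    _ ≤ _ := by
        rw [mul_assoc _ (C₃ ^ p)]
        exact mul_le_mul_right hGint _

theorem LipschitzPartition.exists_fNorm_T_poisson_le {X : HyperbolicFilling Z}
    (ψ : X.LipschitzPartition) (hμ : IsDoublingOfDimension μ Q) {s p r : ℝ} {q : ℝ≥0∞}
    (hs : s < 1 ∨ (s ≤ 1 ∧ q = ∞)) (hr : 0 < r) (hr1 : r ≤ 1) (hrp : r < p)
    (hrq : ENNReal.ofReal r < q) (hrs : 0 < s - Q * (1 / r - 1)) :
    ∃ C : ℝ≥0∞, C ≠ ∞ ∧ ∀ f : Z → ℂ, Integrable f μ → ∀ n : ℕ,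
      X.fNorm μ s p q (ψ.T n (X.poisson μ f)) ≤ C * X.fNorm μ s p q f := by
  have := X.isFiniteMeasure hμ
  have := X.finite_net hμ
  have hp : 0 < p := hr.trans hrp
  have hq : 0 < q := (ENNReal.ofReal_pos.2 hr).trans hrq
  obtain ⟨C₁, hC₁, h1⟩ := ψ.exists_fNorm_T_poisson_sub_le hμ hs hr hr1 hrp hrq hrs
  obtain ⟨C₂, hC₂, h2⟩ := X.exists_jNorm_add_le hμ s hp hq
  obtain ⟨C₃, hC₃, h3⟩ := X.exists_normD_sub_le hμ
  refine ⟨C₃ * (C₂ * (C₁ + 1)), by finiteness, fun f hf n => ?_⟩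
  set u := X.poisson μ f with hu
  have hTi := ψ.integrable_T n μ u
  have hgi : Integrable (fun ξ => ψ.T n u ξ - f ξ) μ := hTi.sub hf
  -- The sum of the error and u is written as a difference with -u so that `exists_normD_sub_le`
  -- applies.
  have hPT : X.poisson μ (ψ.T n u) =
      fun y => X.poisson μ (fun ξ => ψ.T n u ξ - f ξ) y - -u y := by
    funext y
    rw [X.poisson_sub hTi hf y]
    ring
  have htail : (X.jNorm μ s p q fun x => if n ≤ X.level x then X.normD u x else 0) ≤
      X.fNorm μ s p q f := X.jNorm_mono hp fun x => by
    split_ifs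
    · exact le_rfl
    · exact zero_le
  calc X.fNorm μ s p q (ψ.T n u)
      ≤ X.jNorm μ s p q fun x => C₃ * (X.normD (X.poisson μ fun ξ => ψ.T n u ξ - f ξ) x +
          X.normD u x) := by
        refine X.jNorm_mono hp fun x => ?_
        rw [hPT, ← X.normD_neg u x]
        exact h3 _ _ x
    _ ≤ C₃ * (C₂ * (X.fNorm μ s p q (fun ξ => ψ.T n u ξ - f ξ) + X.fNorm μ s p q f)) := by
        rw [X.jNorm_const_mul hp hq hC₃]
        exact mul_le_mul_right (h2 _ _) _
    _ ≤ C₃ * (C₂ * (C₁ * X.fNorm μ s p q f + X.fNorm μ s p q f)) := by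
        gcongr
        exact (h1 f hf n).trans (mul_le_mul_right htail _)
    _ = _ := by ring

/-- The last inequality is r > Q/(Q+s) rewritten. As q may be infinite, a finite q' below it serves
as the upper bound for r. -/
theorem exists_exponent_between {Q s p : ℝ} {q : ℝ≥0∞} (hQ : 0 < Q) (hs : 0 < s)
    (hp : Q / (Q + s) < p) (hq : ENNReal.ofReal (Q / (Q + s)) < q) :
    ∃ r : ℝ, 0 < r ∧ r ≤ 1 ∧ r < p ∧ ENNReal.ofReal r < q ∧ 0 < s - Q * (1 / r - 1) := by
  have h0 : 0 < Q / (Q + s) := by positivity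
  obtain ⟨q', hq1, hq2⟩ := ENNReal.lt_iff_exists_nnreal_btwn.1 hq
  rw [← ENNReal.ofReal_coe_nnreal, ENNReal.ofReal_lt_ofReal_iff_of_nonneg h0.le] at hq1
  have h1 : Q / (Q + s) < 1 := by rw [div_lt_one (by positivity)]; linarith
  obtain ⟨r, hr1, hr2⟩ := exists_between (lt_min hp (lt_min hq1 h1))
  have hr0 : 0 < r := h0.trans hr1
  refine ⟨r, hr0, (hr2.trans_le ((min_le_right _ _).trans (min_le_right _ _))).le,
    hr2.trans_le (min_le_left _ _), lt_of_le_of_lt ?_ hq2, ?_⟩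
  · rw [← ENNReal.ofReal_coe_nnreal]
    exact ENNReal.ofReal_le_ofReal (hr2.trans_le ((min_le_right _ _).trans (min_le_left _ _))).le
  · rw [div_lt_iff₀ (by positivity)] at hr1
    have h2 : Q * (1 / r) < Q + s := by
      rw [mul_one_div, div_lt_iff₀ hr0]; linarith
    linarith

end HyperbolicFilling
end

/-! ### Boundedness and convergence of the discrete approximations -/

theorem theorem3p3 {Z : Type*} [MetricSpace Z] [BoundedSpace Z] [MeasurableSpace Z]
    [BorelSpace Z] (μ : Measure Z) (Q : ℝ) (hμ : IsDoublingOfDimension μ Q)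
    (X : HyperbolicFilling Z) (ψ : X.LipschitzPartition) :
    (∀ (s p : ℝ) (q : ℝ≥0∞),
      ((0 < s ∧ s < 1 ∧ Q / (Q + s) < p ∧ ENNReal.ofReal (Q / (Q + s)) < q) ∨
        (s = 1 ∧ Q / (Q + 1) < p ∧ q = ∞)) →
      ∃ C : ℝ≥0, ∀ f : Z → ℂ, X.MemF μ s p q f → ∀ n : ℕ,
        X.MemF μ s p q (ψ.T n (X.poisson μ f)) ∧
          X.fNorm μ s p q (ψ.T n (X.poisson μ f)) ≤ C * X.fNorm μ s p q f) ∧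
    (∀ (s p : ℝ) (q : ℝ≥0∞), 0 < s → s < 1 → Q / (Q + s) < p →
      ENNReal.ofReal (Q / (Q + s)) < q → q < ∞ →
      ∀ f : Z → ℂ, X.MemF μ s p q f →
        (∀ n : ℕ, X.MemF μ s p q (ψ.T n (X.poisson μ f))) ∧
          Tendsto (fun n : ℕ => X.fNorm μ s p q (fun ξ => ψ.T n (X.poisson μ f) ξ - f ξ))
            atTop (𝓝 0)) := by
  have := X.isFiniteMeasure hμ
  have := X.finite_net hμ
  -- Z is itself a bounded measurable set, so members of the space are integrable.
  have hint : ∀ {s p : ℝ} {q : ℝ≥0∞} {f : Z → ℂ}, X.MemF μ s p q f → Integrable f μ :=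
    fun hf => integrableOn_univ.1
      (hf.1 Set.univ (Bornology.isBounded_univ.2 inferInstance) MeasurableSet.univ)
  have hbdd : ∀ (s p : ℝ) (q : ℝ≥0∞),
      ((0 < s ∧ s < 1 ∧ Q / (Q + s) < p ∧ ENNReal.ofReal (Q / (Q + s)) < q) ∨
        (s = 1 ∧ Q / (Q + 1) < p ∧ q = ∞)) →
      ∃ C : ℝ≥0, ∀ f : Z → ℂ, X.MemF μ s p q f → ∀ n : ℕ,
        X.MemF μ s p q (ψ.T n (X.poisson μ f)) ∧
          X.fNorm μ s p q (ψ.T n (X.poisson μ f)) ≤ C * X.fNorm μ s p q f := by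
    intro s p q h
    obtain ⟨hs0, hs1, hp, hq⟩ : 0 < s ∧ (s < 1 ∨ (s ≤ 1 ∧ q = ∞)) ∧ Q / (Q + s) < p ∧
        ENNReal.ofReal (Q / (Q + s)) < q := by
      rcases h with ⟨h1, h2, h3, h4⟩ | ⟨rfl, h2, rfl⟩
      · exact ⟨h1, Or.inl h2, h3, h4⟩
      · exact ⟨one_pos, Or.inr ⟨le_rfl, rfl⟩, h2, ENNReal.ofReal_lt_top⟩
    obtain ⟨r, hr, hr1, hrp, hrq, hrs⟩ := HyperbolicFilling.exists_exponent_between hμ.Q_pos hs0 hp hq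
    obtain ⟨C, hC, hle⟩ := ψ.exists_fNorm_T_poisson_le hμ hs1 hr hr1 hrp hrq hrs
    refine ⟨C.toNNReal, fun f hf n => ?_⟩
    rw [ENNReal.coe_toNNReal hC]
    have h1 := hle f (hint hf) n
    exact ⟨⟨fun A _ _ => (ψ.integrable_T n μ _).integrableOn,
      h1.trans_lt (ENNReal.mul_lt_top hC.lt_top hf.2)⟩, h1⟩
  refine ⟨hbdd, fun s p q hs0 hs1 hp hq hqt f hf => ⟨fun n => ?_, ?_⟩⟩
  · obtain ⟨C, hC⟩ := hbdd s p q (Or.inl ⟨hs0, hs1, hp, hq⟩)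
    exact (hC f hf n).1
  · obtain ⟨r, hr, hr1, hrp, hrq, hrs⟩ := HyperbolicFilling.exists_exponent_between hμ.Q_pos hs0 hp hq
    obtain ⟨C, hC, hle⟩ :=
      ψ.exists_fNorm_T_poisson_sub_le hμ (Or.inl hs1) hr hr1 hrp hrq hrs
    have htail := X.tendsto_jNorm_tail hμ (s := s) (hr.trans hrp)
      ((ENNReal.ofReal_pos.2 hr).trans hrq) hqt.ne (a := X.normD (X.poisson μ f)) hf.2.ne
    have hlim := ENNReal.Tendsto.const_mul (a := C) htail (Or.inr hC)
    rw [mul_zero] at hlim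
    exact tendsto_of_tendsto_of_tendsto_of_le_of_le tendsto_const_nhds hlim
      (fun _ => zero_le) fun n => hle f (hint hf) n
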